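/- Let $n\ge 2$ and let $\mathfrak g=\mathfrak{sl}(n+1,\mathbb H)$ (quaternionic $(n+1)\times(n+1)$ matrices, rows and columns numbered $0,\dots,n$, whose trace has zero real part), with the grading $\mathfrak g=\mathfrak g_{-1}\oplus\mathfrak g_0\oplus\mathfrak g_1$ coming from the $(1,n)$-block decomposition: $\mathfrak g_{-1}=\mathbb H^n$ is the lower left block, $\mathfrak g_0=\mathfrak{sp}(1)\oplus\mathbb R Z\oplus\mathfrak{sl}(n,\mathbb H)$ is the block diagonal part and $Z=\mathrm{diag}(\frac n{n+1},\frac{-1}{n+1},\dots,\frac{-1}{n+1})$. Let $H^2_k$ be the part of the Lie algebra cohomology $H^2(\mathfrak g_{-1},\mathfrak g)$ on which $Z$ acts by $k$ ($H^2_1$ is the torsion module, $H^2_2$ the curvature module). Let $Z'=E_{11}-E_{nn}\in\mathfrak{sl}(n,\mathbb H)$, where $E_{ij}$ are the matrix units. A nonzero element of $H^2_k$ is called extremal if it lies in the eigenspace of $Z'$ on $H^2_k$ with the largest eigenvalue. Put $\mathfrak{ann}(w)=\{A\in\mathfrak g_0: A\cdot w=0\}$ and $\mathfrak a^{w}=\mathfrak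 g_{-1}\oplus\mathfrak{ann}(w)\subset\mathfrak g$, the semidirect product of $\mathfrak{ann}(w)$ with the abelian algebra $\mathbb H^n$. Let $\mathfrak{sp}(1)_{\rm left}$, $\mathfrak{gl}(n-2,\mathbb H)$, $\mathfrak{sp}(1)_{\rm right}$ be associated with the diagonal blocks of indices $\{1\}$, $\{2,\dots,n-1\}$, $\{n\}$, and let $\mathfrak{heis}(8n-12,\mathbb H)\subset\mathfrak{sl}(n,\mathbb H)$ be the $(8n-12)$-dimensional subalgebra of matrices (indices $1,\dots,n$) that vanish outside the first row and the last column and on the diagonal. Then nonzero extremal elements exist in $H^2_1$ and in $H^2_2$, and for every nonzero extremal $w\in H^2_1$ whose annihilator has the largest dimension among those of the nonzero extremal elements of $H^2_1$ the following hold. 1. As an internal semidirect product of a reductive subalgebra and an ideal, $$\mathfrak{ann}(w)=\bigl(\mathfrak{so}(2)\oplus\mathbb R\oplus\mathfrak{gl}(n-2,\mathbb H)\oplus\mathfrak{sp}(1)_{\rm right}\bigr)\ltimes\mathfrak{heis}(8n-12,\mathbb H).$$ Here $\mathfrak{so}(2)$ is spanned by an element $(u,v)\in\mathfrak{sp}(1)\oplus\mathfrak{sp}(1)_{\rm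 left}$ with $u\ne0$ and $v\ne 0$; $\mathbb R$ is spanned by $3Z-Z'$; $B\in\mathfrak{gl}(n-2,\mathbb H)$ is embedded as the middle block $B$ minus $\frac13\mathrm{Re}(\mathrm{tr}\,B)\,(2E_{11}+E_{nn})$; and $\mathfrak{sp}(1)_{\rm right}$ consists of the imaginary quaternions in position $(n,n)$. 2. $\dim\mathfrak a^{w}=4n^2-4n+9$. 3. If $w'\in H^2_2$ is a nonzero extremal element whose annihilator has the largest dimension among those of the nonzero extremal elements of $H^2_2$, then $\mathfrak{ann}(w)\not\cong\mathfrak{ann}(w')$ and $\mathfrak a^{w}\not\cong\mathfrak a^{w'}$ as real Lie algebras. -/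

import Mathlib

open scoped Quaternion

attribute [local instance 100] LieRing.ofAssociativeRing

noncomputable section

namespace AlmostQuat

/-! ### The graded Lie algebra -/

lemma re_sum {m : ℕ} (s : Finset (Fin m)) (f : Fin m → ℍ[ℝ]) :
    (∑ i ∈ s, f i).re = ∑ i ∈ s, (f i).re := by
  induction s using Finset.cons_induction with
  | empty => simp
  | cons a s ha ih => rw [Finset.sum_cons, Finset.sum_cons, Quaternion.re_add, ih]

lemma re_trace_mul_comm {m : ℕ} (X Y : Matrix (Fin m) (Fin m) ℍ[ℝ]) :
    (Matrix.trace (X * Y)).re = (Matrix.trace (Y * X)).re := by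
  simp only [Matrix.trace, Matrix.diag, Matrix.mul_apply, re_sum]
  rw [Finset.sum_comm]
  refine Finset.sum_congr rfl fun i _ => Finset.sum_congr rfl fun j _ => ?_
  simp only [Quaternion.re_mul]
  ring

/-- `𝔰𝔩(m, ℍ)`: quaternionic matrices whose trace has zero real part. -/
def slH (m : ℕ) : LieSubalgebra ℝ (Matrix (Fin m) (Fin m) ℍ[ℝ]) where
  carrier := {X | (Matrix.trace X).re = 0}
  add_mem' {X Y} hX hY := by
    simp only [Set.mem_ofPred_eq] at *
    simp [Matrix.trace_add, hX, hY]
  zero_mem' := by simp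
  smul_mem' c X hX := by
    simp only [Set.mem_ofPred_eq] at *
    simp [Matrix.trace_smul, hX]
  lie_mem' {X Y} _ _ := by
    change (Matrix.trace ⁅X, Y⁆).re = 0
    rw [Ring.lie_def, Matrix.trace_sub, Quaternion.re_sub, re_trace_mul_comm, sub_self]

-- Instance shortcuts for the type-class search; they are the inherited structures.
instance (n : ℕ) : LieRing (slH n) := LieSubalgebra.lieRing ℝ _ _
instance (n : ℕ) : LieAlgebra ℝ (slH n) := LieSubalgebra.lieAlgebra ℝ _ _
instance (n : ℕ) : AddCommGroup (slH n) := LieRing.toAddCommGroup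
instance (n : ℕ) : AddCommMonoid (slH n) := AddCommGroup.toAddCommMonoid
instance (n : ℕ) : Module ℝ (slH n) := LieAlgebra.toModule
instance (n : ℕ) : DistribMulAction ℝ (slH n) := Module.toDistribMulAction
instance (n : ℕ) : MulAction ℝ (slH n) := DistribMulAction.toMulAction

/-- `𝔰𝔭(1)`: the imaginary quaternions. -/
def sp1 : LieSubalgebra ℝ ℍ[ℝ] where
  carrier := {q | q.re = 0}
  add_mem' {p q} hp hq := by
    simp only [Set.mem_ofPred_eq] at *
    simp [hp, hq]
  zero_mem' := by simp
  smul_mem' c q hq := by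
    simp only [Set.mem_ofPred_eq] at *
    simp [hq]
  lie_mem' {p q} _ _ := by
    change (⁅p, q⁆ : ℍ[ℝ]).re = 0
    rw [Ring.lie_def]
    simp only [Quaternion.re_sub, Quaternion.re_mul]
    ring

/-- `𝔤₋₁ ⊂ 𝔤 = 𝔰𝔩(n+1, ℍ)`: only the entries `(i, 0)`, `i ≥ 1`, may be nonzero; it is `ℍⁿ`. -/
def gMinus (n : ℕ) : LieSubalgebra ℝ (slH (n + 1)) where
  carrier := {X | ∀ i j, (i = 0 ∨ j ≠ 0) → X.1 i j = 0}
  add_mem' {X Y} hX hY i j h := by simp [hX i j h, hY i j h]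
  zero_mem' i j _ := by simp
  smul_mem' c X hX i j h := by simp [hX i j h]
  lie_mem' {X Y} hX hY i j h := by
    have key : ∀ A B : slH (n + 1), (∀ i j, (i = 0 ∨ j ≠ 0) → A.1 i j = 0) →
        (∀ i j, (i = 0 ∨ j ≠ 0) → B.1 i j = 0) → (A.1 * B.1) i j = 0 := by
      intro A B hA hB
      rw [Matrix.mul_apply]
      refine Finset.sum_eq_zero fun k _ => ?_
      by_cases hk : k = 0
      · rw [hB k j (Or.inl hk), mul_zero]
      · rw [hA i k (Or.inr hk), zero_mul]
    rw [LieSubalgebra.coe_bracket, Ring.lie_def, Matrix.sub_apply, key X Y hX hY, key Y X hY hX,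
      sub_zero]

/-- `𝔤₀ ⊂ 𝔤`: the block diagonal matrices `(a, A)` with `a ∈ ℍ`, `A ∈ 𝔤𝔩(n, ℍ)`,
`Re a + Re tr A = 0`. -/
def g0 (n : ℕ) : LieSubalgebra ℝ (slH (n + 1)) where
  carrier := {X | ∀ i, i ≠ 0 → X.1 i 0 = 0 ∧ X.1 0 i = 0}
  add_mem' {X Y} hX hY i h := by simp [hX i h, hY i h]
  zero_mem' i _ := by simp
  smul_mem' c X hX i h := by simp [hX i h]
  lie_mem' {X Y} hX hY i h := by
    have key : ∀ A B : slH (n + 1), (∀ i, i ≠ 0 → A.1 i 0 = 0 ∧ A.1 0 i = 0) →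
        (∀ i, i ≠ 0 → B.1 i 0 = 0 ∧ B.1 0 i = 0) →
        (A.1 * B.1) i 0 = 0 ∧ (A.1 * B.1) 0 i = 0 := by
      intro A B hA hB
      simp only [Matrix.mul_apply]
      refine ⟨Finset.sum_eq_zero fun k _ => ?_, Finset.sum_eq_zero fun k _ => ?_⟩
      · by_cases hk : k = 0
        · rw [hk, (hA i h).1, zero_mul]
        · rw [(hB k hk).1, mul_zero]
      · by_cases hk : k = 0
        · rw [hk, (hB i h).2, mul_zero]
        · rw [(hA k hk).2, zero_mul]
    rw [LieSubalgebra.coe_bracket, Ring.lie_def, Matrix.sub_apply, Matrix.sub_apply,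
      (key X Y hX hY).1, (key X Y hX hY).2, (key Y X hY hX).1, (key Y X hY hX).2]
    simp

-- Instance shortcuts for the type-class search; they are the inherited structures.
instance (n : ℕ) : LieRing (gMinus n) := LieSubalgebra.lieRing ℝ _ _
instance (n : ℕ) : LieAlgebra ℝ (gMinus n) := LieSubalgebra.lieAlgebra ℝ _ _
instance (n : ℕ) : AddCommGroup (gMinus n) := LieRing.toAddCommGroup
instance (n : ℕ) : AddCommMonoid (gMinus n) := AddCommGroup.toAddCommMonoid
instance (n : ℕ) : Module ℝ (gMinus n) := LieAlgebra.toModule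
instance (n : ℕ) : DistribMulAction ℝ (gMinus n) := Module.toDistribMulAction
instance (n : ℕ) : MulAction ℝ (gMinus n) := DistribMulAction.toMulAction
instance (n : ℕ) : LieRing (g0 n) := LieSubalgebra.lieRing ℝ _ _
instance (n : ℕ) : LieAlgebra ℝ (g0 n) := LieSubalgebra.lieAlgebra ℝ _ _
instance (n : ℕ) : AddCommGroup (g0 n) := LieRing.toAddCommGroup
instance (n : ℕ) : AddCommMonoid (g0 n) := AddCommGroup.toAddCommMonoid
instance (n : ℕ) : Module ℝ (g0 n) := LieAlgebra.toModule
instance (n : ℕ) : DistribMulAction ℝ (g0 n) := Module.toDistribMulAction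
instance (n : ℕ) : MulAction ℝ (g0 n) := DistribMulAction.toMulAction

lemma lie_mem_gMinus {n : ℕ} {A v : slH (n + 1)} (hA : A ∈ g0 n) (hv : v ∈ gMinus n) :
    ⁅A, v⁆ ∈ gMinus n := by
  intro i j h
  replace hA : ∀ i, i ≠ 0 → A.1 i 0 = 0 ∧ A.1 0 i = 0 := hA
  replace hv : ∀ i j, (i = 0 ∨ j ≠ 0) → v.1 i j = 0 := hv
  rw [LieSubalgebra.coe_bracket, Ring.lie_def, Matrix.sub_apply, Matrix.mul_apply,
    Matrix.mul_apply]
  rw [Finset.sum_eq_zero, Finset.sum_eq_zero, sub_zero]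
  · intro k _
    by_cases hk : k = 0
    · rcases h with h | h
      · rw [hv i k (Or.inl h), zero_mul]
      · rw [hk, (hA j h).2, mul_zero]
    · rw [hv i k (Or.inr hk), zero_mul]
  · intro k _
    by_cases hk : k = 0
    · rw [hv k j (Or.inl hk), mul_zero]
    · rcases h with h | h
      · rw [h, (hA k hk).2, zero_mul]
      · rw [hv k j (Or.inr h), mul_zero]

/-- The adjoint action of `𝔤₀` on `𝔤₋₁`. -/
instance (n : ℕ) : LieRingModule (g0 n) (gMinus n) where
  bracket A v := ⟨⁅(A : slH (n + 1)), (v : slH (n + 1))⁆, lie_mem_gMinus A.2 v.2⟩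
  add_lie A B v := Subtype.ext (add_lie (A : slH (n + 1)) B (v : slH (n + 1)))
  lie_add A v v' := Subtype.ext (lie_add (A : slH (n + 1)) (v : slH (n + 1)) v')
  leibniz_lie A B v := Subtype.ext (leibniz_lie (A : slH (n + 1)) (B : slH (n + 1)) (v : slH (n + 1)))

instance (n : ℕ) : LieModule ℝ (g0 n) (gMinus n) where
  smul_lie c A v := Subtype.ext (smul_lie c (A : slH (n + 1)) (v : slH (n + 1)))
  lie_smul c A v := Subtype.ext (lie_smul c (A : slH (n + 1)) (v : slH (n + 1)))

@[simp]
lemma coe_lie_gMinus {n : ℕ} (A : g0 n) (v : gMinus n) :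
    ((⁅A, v⁆ : gMinus n) : slH (n + 1)) = ⁅(A : slH (n + 1)), (v : slH (n + 1))⁆ := rfl

/-! ### The second cohomology `H²(𝔤₋₁, 𝔤)` as a `𝔤₀`-module -/

open LieModule.Cohomology

/-- The `𝔤₀`-module of bilinear maps `𝔤₋₁ × 𝔤₋₁ → 𝔤`. -/
abbrev Bilin (n : ℕ) : Type := gMinus n →ₗ[ℝ] gMinus n →ₗ[ℝ] slH (n + 1)

lemma bilin_lie_apply {n : ℕ} (A : g0 n) (c : Bilin n) (x y : gMinus n) :
    (⁅A, c⁆ : Bilin n) x y = ⁅(A : slH (n + 1)), c x y⁆ - c x ⁅A, y⁆ - c ⁅A, x⁆ y := rfl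

lemma gMinus_lie_eq_zero {n : ℕ} (x y : gMinus n) : ⁅x, y⁆ = 0 := by
  have key : ∀ A B : gMinus n, A.1.1 * B.1.1 = 0 := by
    intro A B
    have hA : ∀ i j, (i = 0 ∨ j ≠ 0) → A.1.1 i j = 0 := A.2
    have hB : ∀ i j, (i = 0 ∨ j ≠ 0) → B.1.1 i j = 0 := B.2
    ext1 i j
    rw [Matrix.mul_apply, Matrix.zero_apply]
    refine Finset.sum_eq_zero fun k _ => ?_
    by_cases hk : k = 0
    · rw [hB k j (Or.inl hk), mul_zero]
    · rw [hA i k (Or.inr hk), zero_mul]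
  apply Subtype.ext
  apply Subtype.ext
  rw [LieSubalgebra.coe_bracket, LieSubalgebra.coe_bracket, Ring.lie_def, key, key, sub_zero]
  rfl

lemma lie_lie_gMinus {n : ℕ} (A : g0 n) (x : gMinus n) (m : slH (n + 1)) :
    ⁅x, ⁅(A : slH (n + 1)), m⁆⁆ = ⁅(A : slH (n + 1)), ⁅x, m⁆⁆ - ⁅⁅A, x⁆, m⁆ := by
  change ⁅(x : slH (n + 1)), ⁅(A : slH (n + 1)), m⁆⁆ =
    ⁅(A : slH (n + 1)), ⁅(x : slH (n + 1)), m⁆⁆ - ⁅⁅(A : slH (n + 1)), (x : slH (n + 1))⁆, m⁆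
  rw [leibniz_lie (A : slH (n + 1)) (x : slH (n + 1)) m]
  abel

lemma d₂₃_lie {n : ℕ} (A : g0 n) (c : Bilin n) (hc : c ∈ twoCochain ℝ (gMinus n) (slH (n + 1)))
    (hc' : d₂₃ ℝ (gMinus n) (slH (n + 1)) ⟨c, hc⟩ = 0)
    (h : ⁅A, c⁆ ∈ twoCochain ℝ (gMinus n) (slH (n + 1))) :
    d₂₃ ℝ (gMinus n) (slH (n + 1)) ⟨⁅A, c⁆, h⟩ = 0 := by
  have hd : ∀ x y z, ⁅x, c y z⁆ - ⁅y, c x z⁆ + ⁅z, c x y⁆ = 0 := by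
    intro x y z
    have := LinearMap.congr_fun (LinearMap.congr_fun (LinearMap.congr_fun hc' x) y) z
    rw [d₂₃_apply] at this
    simpa [gMinus_lie_eq_zero, ← twoCochain_val_apply] using this
  ext1 x; ext1 y; ext1 z
  rw [d₂₃_apply]
  simp only [gMinus_lie_eq_zero, map_zero, ← twoCochain_val_apply, LinearMap.zero_apply, sub_zero,
    add_zero]
  simp only [bilin_lie_apply, lie_sub, lie_lie_gMinus]
  have h1 := congrArg (fun m => ⁅(A : slH (n + 1)), m⁆) (hd x y z)
  simp only [lie_add, lie_sub, lie_zero] at h1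
  have h2 := hd ⁅A, x⁆ y z
  have h3 := hd x ⁅A, y⁆ z
  have h4 := hd x y ⁅A, z⁆
  linear_combination (norm := abel) h1 - h2 - h3 - h4

lemma lie_mem_twoCochain {n : ℕ} (A : g0 n) (c : Bilin n)
    (hc : c ∈ twoCochain ℝ (gMinus n) (slH (n + 1))) :
    ⁅A, c⁆ ∈ twoCochain ℝ (gMinus n) (slH (n + 1)) := by
  intro x
  have h1 : c x x = 0 := hc x
  have h2 : c x ⁅A, x⁆ = - c ⁅A, x⁆ x := (twoCochain_skew ⟨c, hc⟩ ⁅A, x⁆ x).symm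
  rw [bilin_lie_apply, h1, h2]
  simp

/-- The 2-cocycles of `𝔤₋₁` with values in `𝔤`, as a `𝔤₀`-submodule. -/
def cocycles (n : ℕ) : LieSubmodule ℝ (g0 n) (Bilin n) where
  toSubmodule := (twoCocycle ℝ (gMinus n) (slH (n + 1))).map (Submodule.subtype _)
  lie_mem := by
    rintro A _ ⟨⟨c, hc⟩, hc', rfl⟩
    exact ⟨⟨⁅A, c⁆, lie_mem_twoCochain A c hc⟩, d₂₃_lie A c hc hc' _, rfl⟩

/-- The 2-coboundaries inside the 2-cocycles, as a `𝔤₀`-submodule. -/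
def coboundaries (n : ℕ) : LieSubmodule ℝ (g0 n) (cocycles n) where
  toSubmodule := ((LinearMap.range (d₁₂ ℝ (gMinus n) (slH (n + 1)))).map
    (Submodule.subtype _)).comap (cocycles n).toSubmodule.subtype
  lie_mem := by
    rintro A ⟨c, hc⟩ ⟨_, ⟨f, rfl⟩, hf⟩
    change _ = c at hf
    refine ⟨d₁₂ ℝ (gMinus n) (slH (n + 1)) ⁅A, f⁆, ⟨_, rfl⟩, ?_⟩
    change (d₁₂ ℝ (gMinus n) (slH (n + 1)) ⁅A, f⁆).1 = ⁅A, c⁆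
    subst hf
    ext1 x; ext1 y
    rw [bilin_lie_apply]
    change ⁅x, (⁅A, f⁆ : gMinus n →ₗ[ℝ] slH (n + 1)) y⁆ -
      ⁅y, (⁅A, f⁆ : gMinus n →ₗ[ℝ] slH (n + 1)) x⁆ -
      (⁅A, f⁆ : gMinus n →ₗ[ℝ] slH (n + 1)) ⁅x, y⁆ =
      ⁅(A : slH (n + 1)), ⁅x, f y⁆ - ⁅y, f x⁆ - f ⁅x, y⁆⁆ -
      (⁅x, f ⁅A, y⁆⁆ - ⁅⁅A, y⁆, f x⁆ - f ⁅x, ⁅A, y⁆⁆) -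
      (⁅⁅A, x⁆, f y⁆ - ⁅y, f ⁅A, x⁆⁆ - f ⁅⁅A, x⁆, y⁆)
    have hl : ∀ z, (⁅A, f⁆ : gMinus n →ₗ[ℝ] slH (n + 1)) z =
      ⁅(A : slH (n + 1)), f z⁆ - f ⁅A, z⁆ := fun z => rfl
    simp only [gMinus_lie_eq_zero, map_zero, sub_zero, hl, lie_sub, lie_zero, lie_lie_gMinus]
    abel

/-- `H²(𝔤₋₁, 𝔤)` with its natural `𝔤₀`-module structure. -/
def H2 (n : ℕ) : Type := cocycles n ⧸ coboundaries n

instance (n : ℕ) : AddCommGroup (H2 n) :=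
  inferInstanceAs (AddCommGroup (cocycles n ⧸ coboundaries n))
instance (n : ℕ) : Module ℝ (H2 n) := inferInstanceAs (Module ℝ (cocycles n ⧸ coboundaries n))
instance (n : ℕ) : LieRingModule (g0 n) (H2 n) :=
  inferInstanceAs (LieRingModule (g0 n) (cocycles n ⧸ coboundaries n))
instance (n : ℕ) : LieModule ℝ (g0 n) (H2 n) :=
  inferInstanceAs (LieModule ℝ (g0 n) (cocycles n ⧸ coboundaries n))

/-- The cohomology class of a cocycle. -/
def H2.mk (n : ℕ) : cocycles n →ₗ⁅ℝ, g0 n⁆ H2 n := LieSubmodule.Quotient.mk' (coboundaries n)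

/-- The annihilator of a vector `w` of an `L`-module, as a subalgebra of `L`. -/
def annihilatorOf {L M : Type*} [LieRing L] [LieAlgebra ℝ L] [AddCommGroup M] [Module ℝ M]
    [LieRingModule L M] [LieModule ℝ L M] (w : M) : LieSubalgebra ℝ L where
  carrier := {A | ⁅A, w⁆ = 0}
  add_mem' {A B} hA hB := by
    simp only [Set.mem_ofPred_eq] at *
    rw [add_lie, hA, hB, add_zero]
  zero_mem' := by simp
  smul_mem' c A hA := by
    simp only [Set.mem_ofPred_eq] at *
    rw [smul_lie, hA, smul_zero]
  lie_mem' {A B} hA hB := by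
    change ⁅⁅A, B⁆, w⁆ = 0
    change ⁅A, w⁆ = 0 at hA
    change ⁅B, w⁆ = 0 at hB
    rw [lie_lie, hA, hB, lie_zero, lie_zero, sub_zero]

/-- The annihilator of `w` in `𝔤₀`. -/
def ann {n : ℕ} (w : H2 n) : LieSubalgebra ℝ (g0 n) := annihilatorOf w

/-! ### Grading elements and extremal elements -/

/-- The real diagonal matrix with entries `d` and trace zero, as an element of `𝔤₀`. -/
def diagElt {n : ℕ} (d : Fin (n + 1) → ℝ) (hd : ∑ i, d i = 0) : g0 n :=
  ⟨⟨Matrix.diagonal fun i => (d i : ℍ[ℝ]), by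
    change (Matrix.trace (Matrix.diagonal fun i => (d i : ℍ[ℝ]))).re = 0
    rw [Matrix.trace_diagonal, re_sum]
    simpa using hd⟩, fun i hi => ⟨Matrix.diagonal_apply_ne _ hi, Matrix.diagonal_apply_ne _ hi.symm⟩⟩

/-- The grading element `Z = diag(n/(n+1), -1/(n+1), …, -1/(n+1))` of `𝔤`. -/
def gradingZ (n : ℕ) : g0 n :=
  diagElt (fun i => if i = 0 then (n : ℝ) / (n + 1) else -1 / (n + 1)) (by
    rw [Fin.sum_univ_succ]
    simp [Fin.succ_ne_zero]
    ring)

/-- `Z' = E₁₁ - Eₙₙ`. For `n ≥ 3` this is the grading element of `𝔰𝔩(n, ℍ)` for the block sizes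
`(1, n-2, 1)`; for `n = 2` it is twice the grading element for the block sizes `(1, 1)`, which has
the same eigenspaces in the same order. -/
def gradingZ' (n : ℕ) : g0 n :=
  diagElt (fun i => (if i = 1 then (1 : ℝ) else 0) - (if i = Fin.last n then 1 else 0)) (by
    simp)

/-- `H²_k`, the part of `H²(𝔤₋₁, 𝔤)` of homogeneity `k`, i.e. the `k`-eigenspace of `Z`. -/
def H2hom (n k : ℕ) : Submodule ℝ (H2 n) :=
  Module.End.eigenspace (LieModule.toEnd ℝ (g0 n) (H2 n) (gradingZ n)) (k : ℝ)

/-- `w` is a nonzero extremal element of `V = H²_k`: a nonzero element of `V_{θmax}`, the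
eigenspace of `Z'` on `V` with the largest eigenvalue. -/
def IsExtremal {n : ℕ} (k : ℕ) (w : H2 n) : Prop :=
  w ≠ 0 ∧ w ∈ H2hom n k ∧ ∃ θ : ℝ, ⁅gradingZ' n, w⁆ = θ • w ∧
    ∀ w' ∈ H2hom n k, w' ≠ 0 → ∀ θ' : ℝ, ⁅gradingZ' n, w'⁆ = θ' • w' → θ' ≤ θ

/-- `w` is a nonzero extremal element of `H²_k` whose annihilator in `𝔤₀` is largest (of maximal
dimension) among the annihilators of all nonzero extremal elements of `H²_k`. -/
def HasLargestAnn {n : ℕ} (k : ℕ) (w : H2 n) : Prop :=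
  IsExtremal k w ∧ ∀ w' : H2 n, IsExtremal k w' →
    Module.finrank ℝ (ann w') ≤ Module.finrank ℝ (ann w)

/-- The subalgebra `𝔤₋₁ ⊕ ann(w)` of `𝔤`, the semidirect product of `ann(w)` and the abelian
algebra `𝔤₋₁ = ℍⁿ`. -/
def gradedAlg {n : ℕ} (w : H2 n) : LieSubalgebra ℝ (slH (n + 1)) where
  carrier := {X | ∃ v ∈ gMinus n, ∃ A ∈ ann w, X = v + (A : slH (n + 1))}
  add_mem' := by
    rintro _ _ ⟨v, hv, A, hA, rfl⟩ ⟨v', hv', A', hA', rfl⟩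
    refine ⟨v + v', add_mem hv hv', A + A', add_mem hA hA', ?_⟩
    change v + A.1 + (v' + A'.1) = v + v' + (A.1 + A'.1)
    abel
  zero_mem' := ⟨0, zero_mem _, 0, zero_mem _, by simp⟩
  smul_mem' := by
    rintro c _ ⟨v, hv, A, hA, rfl⟩
    exact ⟨c • v, (gMinus n).smul_mem c hv, c • A, (ann w).smul_mem c hA, by simp⟩
  lie_mem' := by
    rintro _ _ ⟨v, hv, A, hA, rfl⟩ ⟨v', hv', A', hA', rfl⟩
    refine ⟨⁅v, v'⁆ + ⁅(A : slH (n + 1)), v'⁆ - ⁅(A' : slH (n + 1)), v⁆,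
      sub_mem (add_mem ((gMinus n).lie_mem hv hv') (lie_mem_gMinus A.2 hv'))
        (lie_mem_gMinus A'.2 hv), ⁅A, A'⁆, (ann w).lie_mem hA hA', ?_⟩
    rw [LieSubalgebra.coe_bracket, ← lie_skew (A' : slH (n + 1)) v]
    simp only [add_lie, lie_add]
    abel

/-! ### The explicit subalgebras of `𝔤₀` -/

/-- `𝔥𝔢𝔦𝔰(8n-12, ℍ) = 𝔥₊ ⊂ 𝔰𝔩(n, ℍ) ⊂ 𝔤₀`: the matrices in `𝔤𝔩(n, ℍ)` (rows and columns
`1, …, n`) with zeros everywhere except in the first row and in the last column, and with zeros on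
the diagonal. -/
def heis (n : ℕ) : LieSubalgebra ℝ (g0 n) where
  carrier := {X | ∀ i j : Fin (n + 1),
    ¬((i.val = 1 ∧ 1 < j.val) ∨ (j.val = n ∧ 1 ≤ i.val ∧ i.val < n)) → X.1.1 i j = 0}
  add_mem' {X Y} hX hY i j h := by simp [hX i j h, hY i j h]
  zero_mem' i j _ := by simp
  smul_mem' c X hX i j h := by simp [hX i j h]
  lie_mem' {X Y} hX hY i j h := by
    have key : ∀ A B : g0 n,
        (∀ i j : Fin (n + 1), ¬((i.val = 1 ∧ 1 < j.val) ∨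
          (j.val = n ∧ 1 ≤ i.val ∧ i.val < n)) → A.1.1 i j = 0) →
        (∀ i j : Fin (n + 1), ¬((i.val = 1 ∧ 1 < j.val) ∨
          (j.val = n ∧ 1 ≤ i.val ∧ i.val < n)) → B.1.1 i j = 0) →
        (A.1.1 * B.1.1) i j = 0 := by
      intro A B hA hB
      rw [Matrix.mul_apply]
      refine Finset.sum_eq_zero fun k _ => ?_
      by_cases hk : (i.val = 1 ∧ 1 < k.val) ∨ (k.val = n ∧ 1 ≤ i.val ∧ i.val < n)
      · rw [hB k j (by omega), mul_zero]
      · rw [hA i k hk, zero_mul]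
    rw [LieSubalgebra.coe_bracket, LieSubalgebra.coe_bracket, Ring.lie_def, Matrix.sub_apply,
      key X Y hX hY, key Y X hY hX, sub_zero]

/-- The middle indices `2, …, n-1` among `0, …, n`. -/
def mid (n : ℕ) (k : Fin (n - 2)) : Fin (n + 1) := ⟨k.val + 2, by omega⟩

/-- The matrix of the element `(t, r, B, q)` of `𝔰𝔬(2) ⊕ ℝ ⊕ 𝔤𝔩(n-2, ℍ) ⊕ 𝔰𝔭(1)_right` in `𝔤₀`:
`𝔰𝔬(2)` is spanned by `u` in position `(0, 0)` (the summand `𝔰𝔭(1)` of `𝔤₀`) plus `v` in position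
`(1, 1)` (the summand `𝔰𝔭(1)_left`), `ℝ` is spanned by `3Z - Z'`, `𝔤𝔩(n-2, ℍ)` is the middle block
compensated by multiples of `2E₁₁ + Eₙₙ`, and `𝔰𝔭(1)_right` is in position `(n, n)`. -/
def leviMatrix (n : ℕ) (u v : ℍ[ℝ]) (t r : ℝ) (B : Matrix (Fin (n - 2)) (Fin (n - 2)) ℍ[ℝ])
    (q : ℍ[ℝ]) : Matrix (Fin (n + 1)) (Fin (n + 1)) ℍ[ℝ] :=
  t • (Matrix.single 0 0 u + Matrix.single 1 1 v)
    + r • ((3 : ℝ) • (gradingZ n).1.1 - (gradingZ' n).1.1)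
    + ((∑ i, ∑ j, Matrix.single (mid n i) (mid n j) (B i j))
      - ((Matrix.trace B).re / 3) •
        (Matrix.single 1 1 2 + Matrix.single (Fin.last n) (Fin.last n) 1))
    + Matrix.single (Fin.last n) (Fin.last n) q

end AlmostQuat

end

/-!
Since `𝔤₋₁` is abelian, a `2`-cocycle is an alternating map `c : 𝔤₋₁ × 𝔤₋₁ → 𝔤` with
`[x, c(y, z)] + cyclic = 0`. The elements `Z` and `Z'` are real diagonal matrices, hence act
diagonally on cochains, and an eigenclass of both has a representative that is an eigenvector of
both (`exists_simultaneous_lift`: apply a polynomial in `Z`, `Z'` to any representative). Comparing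
weights, the eigenclasses of the largest `Z'`-eigenvalue (`3` in `H²₁`, `4` in `H²₂`) are represented
by the cochains `(x, y) ↦ ψ(xₙ, yₙ)` with `ψ` an alternating form on `ℍ`, whose value is put into the
matrix position `(1, 0)` for the torsion and `(1, n)` for the curvature.

*Torsion.* Alternating forms on `ℍ` are, up to coboundaries, of the form `φ(Im (p̄ q))` with a linear
map `φ : Im ℍ → ℍ` such that `φ(i) i + φ(j) j + φ(k) k = 0` (`exists_normal_form`), and such a
normal map is determined by its class. To find the annihilator of the class, restrict cochains to
quaternionic lines: there coboundaries contribute left multiplications only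
(`coboundary_on_line`, `IsNormal.eq_zero_of_coboundary`). The result is that `A ∈ 𝔤₀` annihilates the
class if and only if the entries of `A` of negative `Z'`-weight vanish,
`Re A₁₁ + Re A₀₀ = 2 Re Aₙₙ`, and `(Im A₀₀, Im A₁₁) ∈ 𝔰𝔭(1) ⊕ 𝔰𝔭(1)_left` stabilises `φ`. The
stabiliser of `φ ≠ 0` is at most a line, because two independent elements and their commutator would
lift all of `𝔰𝔭(1)` (`Stab.proportional`), and a line occurs: the `φ` with the values `0, 1, i` at
`i, j, k` is stabilised by `(i, 3i)` (`stableTriple_stab`).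
So the largest annihilators are those with a line as stabiliser, and this line is spanned by a pair
`(u, v)` with `u ≠ 0`, `v ≠ 0` (`ann_of_hasLargestAnn`). Reading off the diagonal blocks yields the
Levi factor, and the entries left over form the Heisenberg algebra.

*Curvature.* There `ψ` satisfies the Bianchi identity, which forces it to be invariant under right
multiplication by imaginary quaternions (`bianchi_invariant`). Hence the annihilator of an extremal
curvature class contains the summand `𝔰𝔭(1)` of `𝔤₀` (`spElt_mem_ann`), as an ideal.

*Non-isomorphism.* An ideal `𝔰𝔭(1)` of `ann(w)`, for a torsion class `w`, would centralize the
Heisenberg algebra, whose elements are `ad`-nilpotent of order three, while `𝔰𝔭(1)` has no such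
elements; but the centralizer of the Heisenberg algebra in `ann(w)` is abelian. For the graded
algebras, the first coordinate vector of `𝔤₋₁` commutes with `[𝔞ʷ, 𝔞ʷ]` for a torsion class, because
`(Im A₀₀, Im A₁₁)` ranges over a line only, while for an extremal curvature class the summand `𝔰𝔭(1)`
and `𝔤₋₁ = [𝔰𝔭(1), 𝔤₋₁]` leave no nonzero element that commutes with all brackets.
-/

noncomputable section

namespace AlmostQuat

/-! ### Quaternionic linear algebra of the torsion module -/

/-- The quaternion unit `i`. -/
def qi : ℍ[ℝ] := ⟨0, 1, 0, 0⟩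
/-- The quaternion unit `j`. -/
def qj : ℍ[ℝ] := ⟨0, 0, 1, 0⟩
/-- The quaternion unit `k`. -/
def qk : ℍ[ℝ] := ⟨0, 0, 0, 1⟩

@[simp] lemma re_qi : qi.re = 0 := rfl
@[simp] lemma imI_qi : qi.imI = 1 := rfl
@[simp] lemma imJ_qi : qi.imJ = 0 := rfl
@[simp] lemma imK_qi : qi.imK = 0 := rfl
@[simp] lemma re_qj : qj.re = 0 := rfl
@[simp] lemma imI_qj : qj.imI = 0 := rfl
@[simp] lemma imJ_qj : qj.imJ = 1 := rfl
@[simp] lemma imK_qj : qj.imK = 0 := rfl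
@[simp] lemma re_qk : qk.re = 0 := rfl
@[simp] lemma imI_qk : qk.imI = 0 := rfl
@[simp] lemma imJ_qk : qk.imJ = 0 := rfl
@[simp] lemma imK_qk : qk.imK = 1 := rfl

/-- The real linear map `ℍ → ℍ` that kills the reals and sends `i, j, k` to `f 0, f 1, f 2`. -/
def imMap (f : Fin 3 → ℍ[ℝ]) : ℍ[ℝ] →ₗ[ℝ] ℍ[ℝ] where
  toFun ξ := ξ.imI • f 0 + ξ.imJ • f 1 + ξ.imK • f 2
  map_add' x y := by simp only [Quaternion.imI_add, Quaternion.imJ_add, Quaternion.imK_add]; module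
  map_smul' c x := by
    simp only [Quaternion.imI_smul, Quaternion.imJ_smul, Quaternion.imK_smul, smul_eq_mul,
      RingHom.id_apply]
    module

lemma imMap_apply (f : Fin 3 → ℍ[ℝ]) (ξ : ℍ[ℝ]) :
    imMap f ξ = ξ.imI • f 0 + ξ.imJ • f 1 + ξ.imK • f 2 := rfl

@[simp] lemma imMap_qi (f : Fin 3 → ℍ[ℝ]) : imMap f qi = f 0 := by simp [imMap_apply]
@[simp] lemma imMap_qj (f : Fin 3 → ℍ[ℝ]) : imMap f qj = f 1 := by simp [imMap_apply]
@[simp] lemma imMap_qk (f : Fin 3 → ℍ[ℝ]) : imMap f qk = f 2 := by simp [imMap_apply]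

/-- The maps `Im ℍ → ℍ` without component in the left multiplications `p ↦ a p`; they are the
normal forms of the classes of largest `Z'`-weight in the torsion module. -/
def IsNormal (f : Fin 3 → ℍ[ℝ]) : Prop := f 0 * qi + f 1 * qj + f 2 * qk = 0

/-- The action of `(u, v) ∈ 𝔰𝔭(1) ⊕ 𝔰𝔭(1)_left` on a map `φ : Im ℍ → ℍ`,
namely `ξ ↦ v φ(ξ) - φ(ξ) u + φ([ξ, u])`. -/
def stabMap (f : Fin 3 → ℍ[ℝ]) (u v : ℍ[ℝ]) (ξ : ℍ[ℝ]) : ℍ[ℝ] :=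
  v * imMap f ξ - imMap f ξ * u + imMap f (ξ * u - u * ξ)

/-- The pair `(u, v)` annihilates the map `φ : Im ℍ → ℍ` given by `f`. -/
def Stab (f : Fin 3 → ℍ[ℝ]) (u v : ℍ[ℝ]) : Prop := ∀ ξ, stabMap f u v ξ = 0

lemma ext_three {f : Fin 3 → ℍ[ℝ]} (h0 : f 0 = 0) (h1 : f 1 = 0) (h2 : f 2 = 0) : f = 0 := by
  funext k
  fin_cases k
  · exact h0
  · exact h1
  · exact h2

lemma qi_mul_qi : qi * qi = -1 := by ext <;> simp
lemma qj_mul_qj : qj * qj = -1 := by ext <;> simp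
lemma qk_mul_qk : qk * qk = -1 := by ext <;> simp
lemma qi_mul_qj : qi * qj = qk := by ext <;> simp
lemma qj_mul_qk : qj * qk = qi := by ext <;> simp
lemma qk_mul_qi : qk * qi = qj := by ext <;> simp
lemma qj_mul_qi : qj * qi = -qk := by ext <;> simp
lemma qk_mul_qj : qk * qj = -qi := by ext <;> simp
lemma qi_mul_qk : qi * qk = -qj := by ext <;> simp

lemma eq_mul_neg_unit {a b e : ℍ[ℝ]} (he : e * e = -1) (h : a * e = b) : a = -(b * e) := by
  rw [← h, mul_assoc, he]; simp

/-- A normal map that agrees with a left multiplication vanishes. -/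
lemma IsNormal.eq_zero {f : Fin 3 → ℍ[ℝ]} (hf : IsNormal f) (h1 : f 0 * qi = f 1 * qj)
    (h2 : f 1 * qj = f 2 * qk) : f = 0 := by
  have h : f 2 * qk = 0 := by
    have h3 : (3 : ℝ) • (f 2 * qk) = 0 := by
      rw [IsNormal, h1, h2] at hf
      rw [← hf]; module
    simpa using h3
  have e2 := eq_mul_neg_unit qk_mul_qk h
  have e1 := eq_mul_neg_unit qj_mul_qj (h2.trans h)
  have e0 := eq_mul_neg_unit qi_mul_qi (h1.trans (h2.trans h))
  simp only [zero_mul, neg_zero] at e0 e1 e2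
  exact ext_three e0 e1 e2

lemma Stab.lie {f : Fin 3 → ℍ[ℝ]} {u v u' v' : ℍ[ℝ]} (h : Stab f u v) (h' : Stab f u' v') :
    Stab f (u * u' - u' * u) (v * v' - v' * v) := by
  intro ξ
  have a (x) : imMap f (x * u - u * x) = imMap f x * u - v * imMap f x := by
    have := h x; rw [stabMap] at this; linear_combination (norm := noncomm_ring) this
  have a' (x) : imMap f (x * u' - u' * x) = imMap f x * u' - v' * imMap f x := by
    have := h' x; rw [stabMap] at this; linear_combination (norm := noncomm_ring) this
  have e : ξ * (u * u' - u' * u) - (u * u' - u' * u) * ξ =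
      ((ξ * u - u * ξ) * u' - u' * (ξ * u - u * ξ)) -
        ((ξ * u' - u' * ξ) * u - u * (ξ * u' - u' * ξ)) := by noncomm_ring
  rw [stabMap, e, map_sub, a', a, a, a']
  noncomm_ring

lemma Stab.add {f : Fin 3 → ℍ[ℝ]} {u v u' v' : ℍ[ℝ]} (h : Stab f u v) (h' : Stab f u' v') :
    Stab f (u + u') (v + v') := by
  intro ξ
  have e : ξ * (u + u') - (u + u') * ξ = (ξ * u - u * ξ) + (ξ * u' - u' * ξ) := by noncomm_ring
  have h1 := h ξ
  have h2 := h' ξ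
  rw [stabMap] at *
  rw [e, map_add]
  linear_combination (norm := noncomm_ring) h1 + h2

lemma Stab.smul {f : Fin 3 → ℍ[ℝ]} {u v : ℍ[ℝ]} (h : Stab f u v) (t : ℝ) :
    Stab f (t • u) (t • v) := by
  intro ξ
  have h1 := h ξ
  rw [stabMap] at *
  rw [mul_smul_comm, smul_mul_assoc, mul_smul_comm, smul_mul_assoc, ← smul_sub, ← smul_sub,
    map_smul, ← smul_add, h1, smul_zero]

lemma Stab.eq_zero_of_left {f : Fin 3 → ℍ[ℝ]} (hf : f ≠ 0) {v : ℍ[ℝ]} (h : Stab f 0 v) :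
    v = 0 := by
  by_contra hv
  refine hf (ext_three ?_ ?_ ?_)
  · simpa [stabMap, hv] using h qi
  · simpa [stabMap, hv] using h qj
  · simpa [stabMap, hv] using h qk

lemma Stab.eq_zero_of_right {f : Fin 3 → ℍ[ℝ]} (hf : f ≠ 0) {u : ℍ[ℝ]} (hu : u.re = 0)
    (h : Stab f u 0) : u = 0 := by
  by_contra hu0
  have a (x) : imMap f (x * u - u * x) = imMap f x * u := by
    have := h x; rw [stabMap] at this; linear_combination (norm := noncomm_ring) this
  have h0 : imMap f u = 0 := by simpa [hu0] using (a u).symm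
  set s : ℝ := u.imI ^ 2 + u.imJ ^ 2 + u.imK ^ 2 with hs
  have huu : u * u = -((s : ℝ) : ℍ[ℝ]) := by
    ext <;> simp [hu] <;> (try rw [hs]) <;> ring
  have hs0 : s ≠ 0 := by
    intro h
    apply hu0
    have h1 : u.imI = 0 := by nlinarith [sq_nonneg u.imI, sq_nonneg u.imJ, sq_nonneg u.imK]
    have h2 : u.imJ = 0 := by nlinarith [sq_nonneg u.imI, sq_nonneg u.imJ, sq_nonneg u.imK]
    have h3 : u.imK = 0 := by nlinarith [sq_nonneg u.imI, sq_nonneg u.imJ, sq_nonneg u.imK]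
    ext <;> simp [*]
  have key (x) : imMap f x = 0 := by
    have h1 := a (x * u - u * x)
    rw [a x, mul_assoc, huu] at h1
    -- modulo `u`, the double commutator with `u` is multiplication by `-4|u|²`
    have h2 : ((x * u - u * x) * u - u * (x * u - u * x)) =
        (-4 * s) • x + ((4 * s) * x.re) • 1 +
          (4 * (x.imI * u.imI + x.imJ * u.imJ + x.imK * u.imK)) • u := by
      ext <;> simp [hu] <;> (try rw [hs]) <;> ring
    have h3 : imMap f 1 = 0 := by simp [imMap_apply]
    rw [h2, map_add, map_add, map_smul, map_smul, map_smul, h0, h3] at h1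
    have h4 : (3 * s) • imMap f x = 0 := by
      have h5 : imMap f x * -(s : ℍ[ℝ]) = -(s • imMap f x) := by
        rw [mul_neg, Quaternion.mul_coe_eq_smul]
      rw [h5] at h1
      linear_combination (norm := module) -h1
    simpa [hs0] using h4
  refine hf (ext_three ?_ ?_ ?_)
  · simpa using key qi
  · simpa using key qj
  · simpa using key qk

/-- No nonzero normal map is stabilised by lifts of all of `𝔰𝔭(1)`: its `𝔰𝔭(1)`-module is an
irreducible one. -/
lemma IsNormal.eq_zero_of_stab {f : Fin 3 → ℍ[ℝ]} (hf : IsNormal f) {a b c : ℍ[ℝ]}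
    (hi : Stab f qi a) (hj : Stab f qj b) (hk : Stab f qk c) : f = 0 := by
  have ii := hi qi
  have ij := hi qj
  have ik := hi qk
  have ji := hj qi
  have jj := hj qj
  have jk := hj qk
  have ki := hk qi
  have kj := hk qj
  simp only [stabMap, imMap_qi, imMap_qj, imMap_qk, qi_mul_qi, qj_mul_qj, qi_mul_qj,
    qj_mul_qk, qk_mul_qi, qj_mul_qi, qk_mul_qj, qi_mul_qk, sub_self, map_zero, add_zero, map_sub,
    map_neg, map_add, sub_neg_eq_add] at ii ij ik ji jj jk ki kj
  by_cases h0 : f 0 = 0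
  · rw [h0] at ji ki
    refine ext_three h0 ?_ ?_
    · have : (2 : ℝ) • f 1 = 0 := by linear_combination (norm := (simp; module)) -ki
      simpa using this
    · have : (2 : ℝ) • f 2 = 0 := by linear_combination (norm := (simp; module)) ji
      simpa using this
  by_cases h1 : f 1 = 0
  · rw [h1] at ij kj
    refine absurd ?_ h0
    have : (2 : ℝ) • f 0 = 0 := by linear_combination (norm := (simp; module)) kj
    simpa using this
  -- a lift of a unit that stabilises a nonzero value squares to `-1`
  have sq {v x e : ℍ[ℝ]} (hx : x ≠ 0) (he : e * e = -1) (h : v * x - x * e = 0) : v * v = -1 := by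
    rw [sub_eq_zero] at h
    have : v * v * x = -1 * x := by
      rw [mul_assoc, h, ← mul_assoc, h, mul_assoc, he]; simp
    exact mul_right_cancel₀ hx this
  have ha := sq h0 qi_mul_qi ii
  have hb := sq h1 qj_mul_qj jj
  have step {v x y e : ℍ[ℝ]} (hv : v * v = -1) (he : e * e = -1)
      (hx : v * x - x * e + (-y - y) = 0) (hy : v * y - y * e + (x + x) = 0) : x = y * e := by
    have h2 : v * (v * x) = - x := by rw [← mul_assoc, hv]; simp
    have h3 : v * x = x * e + (2 : ℝ) • y := by
      linear_combination (norm := module) hx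
    have h4 : v * y = y * e - (2 : ℝ) • x := by
      linear_combination (norm := module) hy
    rw [h3, mul_add, mul_smul_comm, h4, ← mul_assoc, h3, add_mul, mul_assoc, he,
      smul_mul_assoc] at h2
    have h5 : (4 : ℝ) • (x - y * e) = 0 := by
      linear_combination (norm := (simp; module)) -h2
    exact sub_eq_zero.1 (by simpa using h5)
  have r1 : f 1 = f 2 * qi := step ha qi_mul_qi ij ik
  have r2 : f 2 = f 0 * qj := step hb qj_mul_qj jk ji
  have r3 : f 1 = -(f 0 * qk) := by rw [r1, r2, mul_assoc, qj_mul_qi]; simp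
  refine hf.eq_zero ?_ ?_
  · rw [r3, neg_mul, mul_assoc, qk_mul_qj]; simp
  · rw [r3, r2, neg_mul, mul_assoc, mul_assoc, qk_mul_qj, qj_mul_qk]; simp

/-- The stabiliser of a nonzero normal map in `𝔰𝔭(1) ⊕ 𝔰𝔭(1)_left` is at most one-dimensional. -/
lemma Stab.proportional {f : Fin 3 → ℍ[ℝ]} (hf : IsNormal f) (hf0 : f ≠ 0) {u v u' v' : ℍ[ℝ]}
    (hu : u.re = 0) (hu' : u'.re = 0) (hu0 : u ≠ 0) (h : Stab f u v) (h' : Stab f u' v') :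
    ∃ t : ℝ, u' = t • u ∧ v' = t • v := by
  have hs : 0 < u.imI ^ 2 + u.imJ ^ 2 + u.imK ^ 2 := by
    by_contra hcon
    apply hu0
    have h1 : u.imI = 0 := by nlinarith [sq_nonneg u.imI, sq_nonneg u.imJ, sq_nonneg u.imK]
    have h2 : u.imJ = 0 := by nlinarith [sq_nonneg u.imI, sq_nonneg u.imJ, sq_nonneg u.imK]
    have h3 : u.imK = 0 := by nlinarith [sq_nonneg u.imI, sq_nonneg u.imJ, sq_nonneg u.imK]
    ext <;> simp [*]
  set x1 := u.imI; set x2 := u.imJ; set x3 := u.imK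
  set y1 := u'.imI; set y2 := u'.imJ; set y3 := u'.imK
  obtain ⟨m1, hm1⟩ : ∃ m, m = x2 * y3 - x3 * y2 := ⟨_, rfl⟩
  obtain ⟨m2, hm2⟩ : ∃ m, m = x3 * y1 - x1 * y3 := ⟨_, rfl⟩
  obtain ⟨m3, hm3⟩ : ∃ m, m = x1 * y2 - x2 * y1 := ⟨_, rfl⟩
  by_cases hm : m1 ^ 2 + m2 ^ 2 + m3 ^ 2 = 0
  · have z1 : m1 = 0 := by nlinarith [sq_nonneg m1, sq_nonneg m2, sq_nonneg m3]
    have z2 : m2 = 0 := by nlinarith [sq_nonneg m1, sq_nonneg m2, sq_nonneg m3]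
    have z3 : m3 = 0 := by nlinarith [sq_nonneg m1, sq_nonneg m2, sq_nonneg m3]
    rw [hm1] at z1; rw [hm2] at z2; rw [hm3] at z3
    set t : ℝ := (x1 * y1 + x2 * y2 + x3 * y3) / (x1 ^ 2 + x2 ^ 2 + x3 ^ 2) with ht
    have hut : u' = t • u := by
      have q1 : y1 = t * x1 := by
        rw [ht]; field_simp; linear_combination (-x2) * z3 + x3 * z2
      have q2 : y2 = t * x2 := by
        rw [ht]; field_simp; linear_combination x1 * z3 - x3 * z1
      have q3 : y3 = t * x3 := by
        rw [ht]; field_simp; linear_combination x2 * z1 - x1 * z2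
      ext
      · simp [hu, hu']
      · simpa using q1
      · simpa using q2
      · simpa using q3
    refine ⟨t, hut, ?_⟩
    have h2 := h'.add (h.smul (-t))
    rw [hut, ← add_smul, add_neg_cancel, zero_smul] at h2
    have := h2.eq_zero_of_left hf0
    linear_combination (norm := module) this
  · -- otherwise `u`, `u'` and their commutator span `Im ℍ`
    exfalso
    have span (p : ℍ[ℝ]) (hp : p.re = 0) : ∃ w, Stab f p w := by
      have h3 := ((h.smul (((y2 * m3 - y3 * m2) * p.imI + (y3 * m1 - y1 * m3) * p.imJ +
          (y1 * m2 - y2 * m1) * p.imK) / (m1 ^ 2 + m2 ^ 2 + m3 ^ 2))).add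
        (h'.smul (((m2 * x3 - m3 * x2) * p.imI + (m3 * x1 - m1 * x3) * p.imJ +
          (m1 * x2 - m2 * x1) * p.imK) / (m1 ^ 2 + m2 ^ 2 + m3 ^ 2)))).add
        ((h.lie h').smul ((m1 * p.imI + m2 * p.imJ + m3 * p.imK) /
          (2 * (m1 ^ 2 + m2 ^ 2 + m3 ^ 2))))
      refine ⟨_, Eq.subst (motive := fun z => Stab f z _) ?_ h3⟩
      ext
      · simp [hp, hu, hu']; right; ring
      all_goals
        simp only [Quaternion.imI_add, Quaternion.imI_smul, Quaternion.imI_sub, Quaternion.imI_mul,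
          Quaternion.imJ_add, Quaternion.imJ_smul, Quaternion.imJ_sub, Quaternion.imJ_mul,
          Quaternion.imK_add, Quaternion.imK_smul, Quaternion.imK_sub, Quaternion.imK_mul, hu, hu',
          smul_eq_mul]
        field_simp
        simp only [x1, x2, x3, y1, y2, y3] at *
        subst hm1 hm2 hm3
        ring
    obtain ⟨a, ha⟩ := span qi rfl
    obtain ⟨b, hb⟩ := span qj rfl
    obtain ⟨c, hc⟩ := span qk rfl
    exact hf0 (hf.eq_zero_of_stab ha hb hc)

lemma stabMap_qi (f : Fin 3 → ℍ[ℝ]) (u v : ℍ[ℝ]) : stabMap f u v qi =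
    v * f 0 - f 0 * u + (2 * u.imJ) • f 2 - (2 * u.imK) • f 1 := by
  ext <;> simp [stabMap, imMap_apply] <;> ring

lemma stabMap_qj (f : Fin 3 → ℍ[ℝ]) (u v : ℍ[ℝ]) : stabMap f u v qj =
    v * f 1 - f 1 * u + (2 * u.imK) • f 0 - (2 * u.imI) • f 2 := by
  ext <;> simp [stabMap, imMap_apply] <;> ring

lemma stabMap_qk (f : Fin 3 → ℍ[ℝ]) (u v : ℍ[ℝ]) : stabMap f u v qk =
    v * f 2 - f 2 * u + (2 * u.imI) • f 1 - (2 * u.imJ) • f 0 := by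
  ext <;> simp [stabMap, imMap_apply] <;> ring

/-- The values of `stabMap f u v` at `i, j, k`. -/
def stabTriple (f : Fin 3 → ℍ[ℝ]) (u v : ℍ[ℝ]) : Fin 3 → ℍ[ℝ] :=
  ![stabMap f u v qi, stabMap f u v qj, stabMap f u v qk]

lemma imMap_stabTriple (f : Fin 3 → ℍ[ℝ]) (u v ξ : ℍ[ℝ]) :
    imMap (stabTriple f u v) ξ = stabMap f u v ξ := by
  rw [imMap_apply]
  simp only [stabTriple, Matrix.cons_val_zero, Matrix.cons_val_one, Matrix.cons_val, stabMap_qi,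
    stabMap_qj, stabMap_qk]
  ext <;> simp [stabMap, imMap_apply] <;> ring

lemma stab_iff_stabTriple {f : Fin 3 → ℍ[ℝ]} {u v : ℍ[ℝ]} :
    Stab f u v ↔ stabTriple f u v = 0 := by
  constructor
  · intro h
    exact ext_three (h qi) (h qj) (h qk)
  · intro h ξ
    rw [← imMap_stabTriple, h]
    simp [imMap_apply]

/-- The complement of the left multiplications is invariant. -/
lemma IsNormal.stabTriple {f : Fin 3 → ℍ[ℝ]} (hf : IsNormal f) {u : ℍ[ℝ]} (hu : u.re = 0)
    (v : ℍ[ℝ]) : IsNormal (stabTriple f u v) := by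
  have h : AlmostQuat.stabTriple f u v 0 * qi + AlmostQuat.stabTriple f u v 1 * qj +
      AlmostQuat.stabTriple f u v 2 * qk =
      v * (f 0 * qi + f 1 * qj + f 2 * qk) - (f 0 * qi + f 1 * qj + f 2 * qk) * u := by
    simp only [AlmostQuat.stabTriple, Matrix.cons_val_zero, Matrix.cons_val_one, Matrix.cons_val,
      stabMap_qi, stabMap_qj, stabMap_qk]
    ext <;> simp [hu] <;> ring
  rw [IsNormal] at *
  rw [h, hf]
  simp

lemma IsNormal.add {f g : Fin 3 → ℍ[ℝ]} (hf : IsNormal f) (hg : IsNormal g) :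
    IsNormal (f + g) := by
  rw [IsNormal] at *
  simp only [Pi.add_apply]
  linear_combination (norm := noncomm_ring) hf + hg

lemma IsNormal.smul {f : Fin 3 → ℍ[ℝ]} (hf : IsNormal f) (r : ℝ) :
    IsNormal (r • f) := by
  rw [IsNormal] at *
  simp only [Pi.smul_apply, smul_mul_assoc, ← smul_add, hf, smul_zero]

lemma IsNormal.mul_left {f : Fin 3 → ℍ[ℝ]} (hf : IsNormal f) (a : ℍ[ℝ]) :
    IsNormal (fun k => a * f k) := by
  rw [IsNormal] at *
  simp only [mul_assoc, ← mul_add, hf, mul_zero]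

lemma imMap_add (f g : Fin 3 → ℍ[ℝ]) (ξ : ℍ[ℝ]) : imMap (f + g) ξ = imMap f ξ + imMap g ξ := by
  simp only [imMap_apply, Pi.add_apply]; module

lemma imMap_smul' (r : ℝ) (f : Fin 3 → ℍ[ℝ]) (ξ : ℍ[ℝ]) : imMap (r • f) ξ = r • imMap f ξ := by
  simp only [imMap_apply, Pi.smul_apply]; module

lemma imMap_mul_left (a : ℍ[ℝ]) (f : Fin 3 → ℍ[ℝ]) (ξ : ℍ[ℝ]) :
    imMap (fun k => a * f k) ξ = a * imMap f ξ := by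
  simp only [imMap_apply, mul_add, mul_smul_comm]

/-- `𝔰𝔭(1) ⊕ 𝔰𝔭(1)_left` acts by skew-symmetric maps, which have no nonzero real eigenvalue. -/
lemma eq_zero_of_smul_add_stabTriple {f : Fin 3 → ℍ[ℝ]} (hf : f ≠ 0) {u v : ℍ[ℝ]}
    (hu : u.re = 0) (hv : v.re = 0) {r : ℝ} (h : r • f + stabTriple f u v = 0) : r = 0 := by
  by_contra hr
  have h0 := congrFun h 0
  have h1 := congrFun h 1
  have h2 := congrFun h 2
  simp only [stabTriple, Pi.add_apply, Pi.smul_apply, Matrix.cons_val_zero, Matrix.cons_val_one,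
    Matrix.cons_val, stabMap_qi, stabMap_qj, stabMap_qk, Pi.zero_apply, Quaternion.ext_iff,
    Quaternion.re_add, Quaternion.re_sub, Quaternion.re_smul, Quaternion.re_mul,
    Quaternion.imI_add, Quaternion.imI_sub, Quaternion.imI_smul, Quaternion.imI_mul,
    Quaternion.imJ_add, Quaternion.imJ_sub, Quaternion.imJ_smul, Quaternion.imJ_mul,
    Quaternion.imK_add, Quaternion.imK_sub, Quaternion.imK_smul, Quaternion.imK_mul,
    Quaternion.re_zero, Quaternion.imI_zero, Quaternion.imJ_zero, Quaternion.imK_zero,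
    smul_eq_mul, hu, hv] at h0 h1 h2
  obtain ⟨a0, a1, a2, a3⟩ := h0
  obtain ⟨b0, b1, b2, b3⟩ := h1
  obtain ⟨c0, c1, c2, c3⟩ := h2
  have key : r * (((f 0).re ^ 2 + (f 0).imI ^ 2 + (f 0).imJ ^ 2 + (f 0).imK ^ 2) +
      ((f 1).re ^ 2 + (f 1).imI ^ 2 + (f 1).imJ ^ 2 + (f 1).imK ^ 2) +
      ((f 2).re ^ 2 + (f 2).imI ^ 2 + (f 2).imJ ^ 2 + (f 2).imK ^ 2)) = 0 := by
    linear_combination (f 0).re * a0 + (f 0).imI * a1 + (f 0).imJ * a2 + (f 0).imK * a3 +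
      (f 1).re * b0 + (f 1).imI * b1 + (f 1).imJ * b2 + (f 1).imK * b3 +
      (f 2).re * c0 + (f 2).imI * c1 + (f 2).imJ * c2 + (f 2).imK * c3
  have hn (k : Fin 3) : (f k).re ^ 2 + (f k).imI ^ 2 + (f k).imJ ^ 2 + (f k).imK ^ 2 =
      Quaternion.normSq (f k) := by rw [Quaternion.normSq_def']
  rw [hn, hn, hn] at key
  have key' := (mul_eq_zero.1 key).resolve_left hr
  have p0 := Quaternion.normSq_nonneg (a := f 0)
  have p1 := Quaternion.normSq_nonneg (a := f 1)
  have p2 := Quaternion.normSq_nonneg (a := f 2)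
  exact hf (ext_three (Quaternion.normSq_eq_zero.1 (by linarith))
    (Quaternion.normSq_eq_zero.1 (by linarith)) (Quaternion.normSq_eq_zero.1 (by linarith)))

/-- A normal map is not the value of a coboundary: coboundaries have the form
`h(p) q - h(q) p`, which contributes a left multiplication only. -/
lemma IsNormal.eq_zero_of_coboundary {f : Fin 3 → ℍ[ℝ]} (hf : IsNormal f) (h : ℍ[ℝ] → ℍ[ℝ])
    (hh : ∀ p q, imMap f (star p * q) = h p * q - h q * p) : f = 0 := by
  have si : star qj * qk = -qi := by ext <;> simp
  have sj : star qk * qi = -qj := by ext <;> simp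
  have sk : star qi * qj = -qk := by ext <;> simp
  have a1 := hh 1 qi
  have a2 := hh 1 qj
  have a3 := hh 1 qk
  have b1 := hh qj qk
  have b2 := hh qk qi
  have b3 := hh qi qj
  simp only [si, sj, sk, star_one, one_mul, map_neg, imMap_qi, imMap_qj, imMap_qk, mul_one] at *
  have e1 : (2 : ℝ) • (f 0 * qi) = -(h 1 + h qi * qi + h qj * qj + h qk * qk) := by
    have : (2 : ℝ) • f 0 = h 1 * qi - h qi - (h qj * qk - h qk * qj) := by
      rw [← a1, ← b1]; module
    rw [← smul_mul_assoc, this]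
    simp only [sub_mul, mul_assoc, qi_mul_qi, qk_mul_qi, qj_mul_qi]
    noncomm_ring
  have e2 : (2 : ℝ) • (f 1 * qj) = -(h 1 + h qi * qi + h qj * qj + h qk * qk) := by
    have : (2 : ℝ) • f 1 = h 1 * qj - h qj - (h qk * qi - h qi * qk) := by
      rw [← a2, ← b2]; module
    rw [← smul_mul_assoc, this]
    simp only [sub_mul, mul_assoc, qj_mul_qj, qk_mul_qj, qi_mul_qj]
    noncomm_ring
  have e3 : (2 : ℝ) • (f 2 * qk) = -(h 1 + h qi * qi + h qj * qj + h qk * qk) := by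
    have : (2 : ℝ) • f 2 = h 1 * qk - h qk - (h qi * qj - h qj * qi) := by
      rw [← a3, ← b3]; module
    rw [← smul_mul_assoc, this]
    simp only [sub_mul, mul_assoc, qk_mul_qk, qi_mul_qk, qj_mul_qk]
    noncomm_ring
  refine hf.eq_zero ?_ ?_
  · exact smul_right_injective _ (two_ne_zero (α := ℝ)) (e1.trans e2.symm)
  · exact smul_right_injective _ (two_ne_zero (α := ℝ)) (e2.trans e3.symm)

lemma quaternion_eq_basis (p : ℍ[ℝ]) :
    p = p.re • 1 + p.imI • qi + p.imJ • qj + p.imK • qk := by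
  ext <;> simp

lemma form_skew {ψ : ℍ[ℝ] →ₗ[ℝ] ℍ[ℝ] →ₗ[ℝ] ℍ[ℝ]} (hψ : ∀ p, ψ p p = 0) (x y : ℍ[ℝ]) :
    ψ x y = -ψ y x := by
  have := hψ (x + y)
  simp only [map_add, LinearMap.add_apply, hψ] at this
  linear_combination (norm := module) this

lemma alternating_expand (ψ : ℍ[ℝ] →ₗ[ℝ] ℍ[ℝ] →ₗ[ℝ] ℍ[ℝ]) (hψ : ∀ p, ψ p p = 0) (p q : ℍ[ℝ]) :
    ψ p q = (p.re * q.imI - p.imI * q.re) • ψ 1 qi + (p.re * q.imJ - p.imJ * q.re) • ψ 1 qj +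
      (p.re * q.imK - p.imK * q.re) • ψ 1 qk + (p.imI * q.imJ - p.imJ * q.imI) • ψ qi qj +
      (p.imJ * q.imK - p.imK * q.imJ) • ψ qj qk + (p.imK * q.imI - p.imI * q.imK) • ψ qk qi := by
  have sk := form_skew hψ
  conv_lhs => rw [quaternion_eq_basis p, quaternion_eq_basis q]
  simp only [map_add, map_smul, LinearMap.add_apply, LinearMap.smul_apply, hψ]
  rw [sk qi 1, sk qj 1, sk qk 1, sk qj qi, sk qk qj, sk qi qk]
  module

/-- Every alternating form on `ℍ` is a normal map of `Im (p̄ q)` up to a coboundary. -/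
lemma exists_normal_form (ψ : ℍ[ℝ] →ₗ[ℝ] ℍ[ℝ] →ₗ[ℝ] ℍ[ℝ]) (hψ : ∀ p, ψ p p = 0) :
    ∃ f, IsNormal f ∧ ∃ g : ℍ[ℝ] →ₗ[ℝ] ℍ[ℝ],
      ∀ p q, ψ p q = imMap f (star p * q) + (g p * q - g q * p) := by
  have hexp := alternating_expand ψ hψ
  generalize ψ 1 qi = A at hexp
  generalize ψ 1 qj = B at hexp
  generalize ψ 1 qk = C at hexp
  generalize ψ qi qj = D at hexp
  generalize ψ qj qk = E at hexp
  generalize ψ qk qi = F at hexp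
  -- `a` removes the left multiplication, `X₁, X₂, X₃` the part of the form that is not
  -- a function of `Im (p̄ q)`
  obtain ⟨a, ha⟩ : ∃ a, a = (-1 / 3 : ℝ) • ((A - E) * qi + (B - F) * qj + (C - D) * qk) := ⟨_, rfl⟩
  let X₁ := (A + E) * qi
  let X₂ := (B + F) * qj
  let X₃ := (C + D) * qk
  let G₀ := (1 / 4 : ℝ) • (a - X₁ - X₂ - X₃)
  let G₁ := (-1 / 4 : ℝ) • ((a - X₁ + X₂ + X₃) * qi)
  let G₂ := (-1 / 4 : ℝ) • ((a + X₁ - X₂ + X₃) * qj)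
  let G₃ := (-1 / 4 : ℝ) • ((a + X₁ + X₂ - X₃) * qk)
  refine ⟨![(1 / 2 : ℝ) • (A - E - a * qi), (1 / 2 : ℝ) • (B - F - a * qj),
    (1 / 2 : ℝ) • (C - D - a * qk)], ?_,
    { toFun := fun p => p.re • G₀ + p.imI • G₁ + p.imJ • G₂ + p.imK • G₃
      map_add' := fun x y => by simp; module
      map_smul' := fun c x => by simp; module }, ?_⟩
  · simp only [IsNormal, Matrix.cons_val_zero, Matrix.cons_val_one, Matrix.cons_val, ha]
    ext <;> simp <;> ring
  · intro p q
    rw [hexp]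
    simp only [LinearMap.coe_mk, AddHom.coe_mk, imMap_apply, G₀, G₁, G₂, G₃, X₁, X₂, X₃,
      Matrix.cons_val_zero, Matrix.cons_val_one, Matrix.cons_val]
    ext <;> simp <;> ring

/-- The algebraic Bianchi identity makes an alternating form on `ℍ` invariant under right
multiplication by imaginary quaternions. -/
lemma bianchi_invariant (ψ : ℍ[ℝ] →ₗ[ℝ] ℍ[ℝ] →ₗ[ℝ] ℍ[ℝ]) (hψ : ∀ p, ψ p p = 0)
    (hb : ∀ x y z, ψ x y * z + ψ y z * x + ψ z x * y = 0) {u : ℍ[ℝ]} (hu : u.re = 0)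
    (x y : ℍ[ℝ]) : ψ (x * u) y + ψ x (y * u) = 0 := by
  have sk := form_skew hψ
  have hexp := alternating_expand ψ hψ
  have hD : ψ qi qj = ψ 1 qj * qi - ψ 1 qi * qj := by
    have := hb 1 qi qj
    rw [sk qj 1, mul_one] at this
    linear_combination (norm := noncomm_ring) this
  have hE : ψ qj qk = ψ 1 qk * qj - ψ 1 qj * qk := by
    have := hb 1 qj qk
    rw [sk qk 1, mul_one] at this
    linear_combination (norm := noncomm_ring) this
  have hF : ψ qk qi = ψ 1 qi * qk - ψ 1 qk * qi := by
    have := hb 1 qk qi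
    rw [sk qi 1, mul_one] at this
    linear_combination (norm := noncomm_ring) this
  have hC : ψ 1 qk = ψ 1 qi * qi * qk + ψ 1 qj * qj * qk := by
    have := hb qi qj qk
    rw [hD, hE, hF] at this
    have h2 : (-2 : ℝ) • (ψ 1 qi * qi + ψ 1 qj * qj + ψ 1 qk * qk) = 0 := by
      rw [← this]; ext <;> simp <;> ring
    have h3 := (smul_eq_zero.1 h2).resolve_left (by norm_num)
    have h4 := congrArg (· * qk) h3
    simp only [add_mul, mul_assoc, qk_mul_qk, zero_mul, mul_neg, mul_one] at h4
    rw [mul_assoc, mul_assoc]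
    linear_combination (norm := noncomm_ring) -h4
  rw [hexp, hexp x]
  rw [hD, hE, hF, hC]
  generalize ψ 1 qi = A
  generalize ψ 1 qj = B
  ext <;> simp [hu] <;> ring

open LieModule.Cohomology

/-! ### Eigenvectors modulo an invariant submodule -/

/-- If the coordinates `Φ a` of `M` are eigenfunctionals of `T` with finitely many eigenvalues, then
an eigenvector of `T` modulo an invariant submodule `N` lifts to an eigenvector of `T`. The lift
lies in every `T`-invariant submodule that contains the given vector, since it is a polynomial
in `T` applied to it. -/
lemma exists_eigenvector_lift {M W ι : Type*} [AddCommGroup M] [Module ℝ M] [AddCommGroup W]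
    [Module ℝ W] (T : Module.End ℝ M) (N : Submodule ℝ M) (hN : ∀ m ∈ N, T m ∈ N)
    (Φ : ι → M →ₗ[ℝ] W) (hΦ : ∀ m, (∀ a, Φ a m = 0) → m = 0) (ev : ι → ℝ) (S : Finset ℝ)
    (hS : ∀ a, ev a ∈ S) (hT : ∀ a m, Φ a (T m) = ev a • Φ a m) {θ : ℝ} {m : M}
    (hm : T m - θ • m ∈ N) :
    ∃ m', T m' = θ • m' ∧ m - m' ∈ N ∧
      ∀ P : Submodule ℝ M, (∀ x ∈ P, T x ∈ P) → m ∈ P → m' ∈ P := by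
  -- a product of `T - s` over any set of numbers is scalar modulo `N`
  have key (R : Finset ℝ) : ∃ m' : M, (∀ a, Φ a m' = (∏ s ∈ R, (ev a - s)) • Φ a m) ∧
      m' - (∏ s ∈ R, (θ - s)) • m ∈ N ∧
      ∀ P : Submodule ℝ M, (∀ x ∈ P, T x ∈ P) → m ∈ P → m' ∈ P := by
    induction R using Finset.induction_on with
    | empty => exact ⟨m, by simp, by simp, fun P _ h => h⟩
    | insert s R hs ih =>
      obtain ⟨m', h1, h2, h3⟩ := ih
      refine ⟨T m' - s • m', fun a => ?_, ?_, fun P hP hmP => ?_⟩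
      · rw [map_sub, map_smul, hT, h1, Finset.prod_insert hs]
        module
      · rw [Finset.prod_insert hs]
        have e : T m' - s • m' - ((θ - s) * ∏ s ∈ R, (θ - s)) • m =
            T (m' - (∏ s ∈ R, (θ - s)) • m) - s • (m' - (∏ s ∈ R, (θ - s)) • m) +
              (∏ s ∈ R, (θ - s)) • (T m - θ • m) := by
          rw [map_sub, map_smul]; module
        rw [e]
        exact N.add_mem (N.sub_mem (hN _ h2) (N.smul_mem _ h2)) (N.smul_mem _ hm)
      · exact P.sub_mem (hP _ (h3 P hP hmP)) (P.smul_mem _ (h3 P hP hmP))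
  obtain ⟨m', h1, h2, h3⟩ := key (S.erase θ)
  have hne : ∏ s ∈ S.erase θ, (θ - s) ≠ 0 :=
    Finset.prod_ne_zero_iff.2 fun s hs => sub_ne_zero.2 (Finset.ne_of_mem_erase hs).symm
  refine ⟨(∏ s ∈ S.erase θ, (θ - s))⁻¹ • m', ?_, ?_, fun P hP hmP => P.smul_mem _ (h3 P hP hmP)⟩
  · rw [map_smul, smul_comm θ]
    congr 1
    rw [← sub_eq_zero]
    refine hΦ _ fun a => ?_
    rw [map_sub, map_smul, hT, ← sub_smul, h1]
    by_cases ha : ev a = θ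
    · simp [ha]
    · rw [Finset.prod_eq_zero (Finset.mem_erase.2 ⟨ha, hS a⟩) (sub_self _)]
      simp
  · have h4 := N.smul_mem (-(∏ s ∈ S.erase θ, (θ - s))⁻¹) h2
    rw [smul_sub, smul_smul, neg_mul, inv_mul_cancel₀ hne] at h4
    convert h4 using 1
    module

/-- A simultaneous eigenvector, in a quotient module, of two commuting elements that act diagonally
in suitable coordinates lifts to a simultaneous eigenvector. -/
lemma exists_simultaneous_lift {L M Q W ι : Type*} [LieRing L] [LieAlgebra ℝ L] [AddCommGroup M]
    [Module ℝ M] [LieRingModule L M] [LieModule ℝ L M] [AddCommGroup Q] [Module ℝ Q]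
    [LieRingModule L Q] [LieModule ℝ L Q] [AddCommGroup W] [Module ℝ W] (π : M →ₗ⁅ℝ, L⁆ Q)
    (hπ : ∀ w, ∃ m, π m = w) {A B : L} (hAB : ⁅A, B⁆ = 0) (Φ : ι → M →ₗ[ℝ] W)
    (hΦ : ∀ m, (∀ a, Φ a m = 0) → m = 0) (evA evB : ι → ℝ) (SA SB : Finset ℝ)
    (hSA : ∀ a, evA a ∈ SA) (hSB : ∀ a, evB a ∈ SB) (hA : ∀ a m, Φ a ⁅A, m⁆ = evA a • Φ a m)
    (hB : ∀ a m, Φ a ⁅B, m⁆ = evB a • Φ a m) {μ θ : ℝ} {w : Q} (h1 : ⁅A, w⁆ = μ • w)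
    (h2 : ⁅B, w⁆ = θ • w) : ∃ m, π m = w ∧ ⁅A, m⁆ = μ • m ∧ ⁅B, m⁆ = θ • m := by
  have inv (C : L) : ∀ m ∈ LinearMap.ker π.toLinearMap,
      LieModule.toEnd ℝ L M C m ∈ LinearMap.ker π.toLinearMap := by
    intro m hm
    have hm' : π m = 0 := hm
    change π ⁅C, m⁆ = 0
    rw [LieModuleHom.map_lie, hm', lie_zero]
  have step {C : L} {ν : ℝ} {m : M} (h : ⁅C, π m⁆ = ν • π m) :
      LieModule.toEnd ℝ L M C m - ν • m ∈ LinearMap.ker π.toLinearMap := by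
    change π (⁅C, m⁆ - ν • m) = 0
    rw [map_sub, LieModuleHom.map_lie, map_smul, h, sub_self]
  obtain ⟨m, rfl⟩ := hπ w
  obtain ⟨m', e1, e2, -⟩ := exists_eigenvector_lift (LieModule.toEnd ℝ L M A) _ (inv A) Φ hΦ evA SA
    hSA hA (step h1)
  have e3 : π m = π m' := by
    have : π (m - m') = 0 := e2
    rwa [map_sub, sub_eq_zero] at this
  rw [e3] at h2 ⊢
  obtain ⟨m'', f1, f2, f3⟩ := exists_eigenvector_lift (LieModule.toEnd ℝ L M B) _ (inv B) Φ hΦ evB SB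
    hSB hB (step h2)
  have f4 : π m' = π m'' := by
    have : π (m' - m'') = 0 := f2
    rwa [map_sub, sub_eq_zero] at this
  refine ⟨m'', f4.symm, ?_, f1⟩
  have f5 := f3 (Module.End.eigenspace (LieModule.toEnd ℝ L M A) μ) (fun x hx => ?_)
    (Module.End.mem_eigenspace_iff.2 e1)
  · exact Module.End.mem_eigenspace_iff.1 f5
  · rw [Module.End.mem_eigenspace_iff, LieModule.toEnd_apply_apply] at *
    rw [LieModule.toEnd_apply_apply, leibniz_lie, hAB, zero_lie, zero_add, hx, lie_smul]

/-! ### Coordinates on the cochains -/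

lemma slH_ext {n : ℕ} {X Y : slH n} (h : ∀ k l, X.1 k l = Y.1 k l) : X = Y :=
  Subtype.ext (Matrix.ext h)

lemma g0_ext {n : ℕ} {X Y : g0 n} (h : ∀ k l, X.1.1 k l = Y.1.1 k l) : X = Y :=
  Subtype.ext (slH_ext h)

/-- The element of `𝔤₋₁ = ℍⁿ` with the coordinates `v 1, …, v n`; the value `v 0` is ignored. -/
def col (n : ℕ) : (Fin (n + 1) → ℍ[ℝ]) →ₗ[ℝ] gMinus n where
  toFun v := ⟨⟨Matrix.of fun i j => if i ≠ 0 ∧ j = 0 then v i else 0, by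
      change (Matrix.trace (_ : Matrix (Fin (n + 1)) (Fin (n + 1)) ℍ[ℝ])).re = 0
      rw [Matrix.trace, Finset.sum_eq_zero]
      · simp
      · intro i _
        simp only [Matrix.diag_apply, Matrix.of_apply, ite_eq_right_iff, and_imp]
        exact fun h h' => absurd h' h⟩, by
      intro i j h
      simp only [Matrix.of_apply, ite_eq_right_iff, and_imp]
      intro h1 h2
      rcases h with h | h
      · exact absurd h h1
      · exact absurd h2 h⟩
  map_add' v w := by
    refine Subtype.ext (slH_ext fun i j => ?_)
    change (if i ≠ 0 ∧ j = 0 then v i + w i else 0) =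
      (if i ≠ 0 ∧ j = 0 then v i else 0) + (if i ≠ 0 ∧ j = 0 then w i else 0)
    split_ifs <;> simp
  map_smul' c v := by
    refine Subtype.ext (slH_ext fun i j => ?_)
    change (if i ≠ 0 ∧ j = 0 then c • v i else 0) = c • (if i ≠ 0 ∧ j = 0 then v i else 0)
    split_ifs <;> simp

lemma col_apply {n : ℕ} (v : Fin (n + 1) → ℍ[ℝ]) (i j : Fin (n + 1)) :
    (col n v).1.1 i j = if i ≠ 0 ∧ j = 0 then v i else 0 := rfl

lemma col_apply_zero {n : ℕ} (v : Fin (n + 1) → ℍ[ℝ]) {i : Fin (n + 1)} (hi : i ≠ 0) :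
    (col n v).1.1 i 0 = v i := by simp [col_apply, hi]

lemma gMinus_ext {n : ℕ} {x y : gMinus n} (h : ∀ i, i ≠ 0 → x.1.1 i 0 = y.1.1 i 0) : x = y := by
  apply Subtype.ext; apply Subtype.ext
  ext1 i j
  by_cases hij : i = 0 ∨ j ≠ 0
  · exact (x.2 i j hij).trans (y.2 i j hij).symm
  · push Not at hij
    rw [hij.2]
    exact h i hij.1

lemma col_eq {n : ℕ} (x : gMinus n) : col n (fun i => x.1.1 i 0) = x :=
  gMinus_ext fun _ hi => col_apply_zero _ hi

lemma coe_lie_slH {n : ℕ} (X Y : slH n) : (⁅X, Y⁆ : slH n).1 = X.1 * Y.1 - Y.1 * X.1 := by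
  rw [LieSubalgebra.coe_bracket, Ring.lie_def]

lemma g0_apply_zero {n : ℕ} (A : g0 n) {i : Fin (n + 1)} (hi : i ≠ 0) : A.1.1 i 0 = 0 :=
  (A.2 i hi).1

lemma g0_zero_apply {n : ℕ} (A : g0 n) {i : Fin (n + 1)} (hi : i ≠ 0) : A.1.1 0 i = 0 :=
  (A.2 i hi).2

/-- The action of `𝔤₀` on `𝔤₋₁` in coordinates. -/
lemma lie_gMinus_apply {n : ℕ} (A : g0 n) (x : gMinus n) (i : Fin (n + 1)) :
    (⁅A, x⁆ : gMinus n).1.1 i 0 = ∑ k, A.1.1 i k * x.1.1 k 0 - x.1.1 i 0 * A.1.1 0 0 := by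
  rw [coe_lie_gMinus, coe_lie_slH, Matrix.sub_apply, Matrix.mul_apply, Matrix.mul_apply]
  congr 1
  rw [Finset.sum_eq_single 0]
  · intro k _ hk
    rw [x.2 i k (Or.inr hk), zero_mul]
  · simp

lemma lie_col_single {n : ℕ} (A : g0 n) (j : Fin (n + 1)) (p : ℍ[ℝ]) {i : Fin (n + 1)}
    (hi : i ≠ 0) (hj : j ≠ 0) : (⁅A, col n (Pi.single j p)⁆ : gMinus n).1.1 i 0 =
      A.1.1 i j * p - (Pi.single j p : Fin (n + 1) → ℍ[ℝ]) i * A.1.1 0 0 := by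
  rw [lie_gMinus_apply _ _ i, Finset.sum_eq_single j]
  · rw [col_apply_zero _ hi, col_apply_zero _ hj, Pi.single_eq_same]
  · intro k _ hk
    by_cases hk0 : k = 0
    · rw [hk0, g0_apply_zero _ hi, zero_mul]
    · rw [col_apply_zero _ hk0, Pi.single_eq_of_ne hk, mul_zero]
  · simp

lemma diagElt_apply {n : ℕ} (d : Fin (n + 1) → ℝ) (hd : ∑ i, d i = 0) (i j : Fin (n + 1)) :
    (diagElt d hd).1.1 i j = if i = j then (d i : ℍ[ℝ]) else 0 := by
  change Matrix.diagonal _ i j = _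
  rw [Matrix.diagonal_apply]

lemma diagElt_lie_apply {n : ℕ} (d : Fin (n + 1) → ℝ) (hd : ∑ i, d i = 0) (X : slH (n + 1))
    (k l : Fin (n + 1)) :
    (⁅(diagElt d hd : slH (n + 1)), X⁆ : slH (n + 1)).1 k l = (d k - d l) • X.1 k l := by
  rw [coe_lie_slH]
  change ((Matrix.diagonal fun i => (d i : ℍ[ℝ])) * X.1 -
    X.1 * (Matrix.diagonal fun i => (d i : ℍ[ℝ]))) k l = _
  rw [Matrix.sub_apply, Matrix.diagonal_mul, Matrix.mul_diagonal, Quaternion.coe_mul_eq_smul,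
    Quaternion.mul_coe_eq_smul, sub_smul]

lemma diagElt_lie_col {n : ℕ} (d : Fin (n + 1) → ℝ) (hd : ∑ i, d i = 0) (j : Fin (n + 1))
    (p : ℍ[ℝ]) : ⁅diagElt d hd, col n (Pi.single j p)⁆ = (d j - d 0) • col n (Pi.single j p) := by
  apply gMinus_ext
  intro i hi
  rw [coe_lie_gMinus, diagElt_lie_apply]
  change _ = (d j - d 0) • (col n (Pi.single j p)).1.1 i 0
  by_cases hij : i = j
  · rw [hij]
  · rw [col_apply_zero _ hi, Pi.single_eq_of_ne hij, smul_zero, smul_zero]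

/-- The weight of the diagonal element with entries `d` on the cochains that send the coordinates
`a = (i, j)` to the matrix entry `b = (k, l)`. -/
def diagWeight {n : ℕ} (d : Fin (n + 1) → ℝ) (a b : Fin (n + 1) × Fin (n + 1)) : ℝ :=
  d b.1 - d b.2 - (d a.1 - d 0) - (d a.2 - d 0)

lemma diagElt_lie_bilin {n : ℕ} (d : Fin (n + 1) → ℝ) (hd : ∑ i, d i = 0) (c : Bilin n)
    (i j k l : Fin (n + 1)) (p q : ℍ[ℝ]) :
    ((⁅diagElt d hd, c⁆ : Bilin n) (col n (Pi.single i p)) (col n (Pi.single j q))).1 k l =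
      diagWeight d (i, j) (k, l) •
        (c (col n (Pi.single i p)) (col n (Pi.single j q))).1 k l := by
  rw [bilin_lie_apply, diagElt_lie_col, diagElt_lie_col, map_smul, map_smul, LinearMap.smul_apply]
  generalize c (col n (Pi.single i p)) (col n (Pi.single j q)) = X
  change (⁅(diagElt d hd : slH (n + 1)), X⁆ : slH (n + 1)).1 k l - (d j - d 0) • X.1 k l -
    (d i - d 0) • X.1 k l = _
  rw [diagElt_lie_apply, diagWeight]
  module

lemma col_sum {n : ℕ} (x : gMinus n) : x = ∑ i, col n (Pi.single i (x.1.1 i 0)) := by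
  conv_lhs => rw [← col_eq x, ← Finset.univ_sum_single (fun i => x.1.1 i 0), map_sum]

lemma bilin_expand {n : ℕ} (c : Bilin n) (x y : gMinus n) :
    c x y = ∑ i, ∑ j, c (col n (Pi.single i (x.1.1 i 0))) (col n (Pi.single j (y.1.1 j 0))) := by
  conv_lhs => rw [col_sum x, col_sum y]
  simp only [map_sum, LinearMap.sum_apply]
  rw [Finset.sum_comm]

lemma col_single_zero {n : ℕ} (p : ℍ[ℝ]) : col n (Pi.single 0 p) = 0 := by
  apply gMinus_ext
  intro i hi
  rw [col_apply_zero _ hi, Pi.single_eq_of_ne hi]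
  rfl

lemma bilin_eq_zero {n : ℕ} {c : Bilin n}
    (h : ∀ i j k l p q, i ≠ 0 → j ≠ 0 →
      (c (col n (Pi.single i p)) (col n (Pi.single j q))).1 k l = 0) :
    c = 0 := by
  refine LinearMap.ext fun x => LinearMap.ext fun y => ?_
  rw [bilin_expand]
  have : ∀ i j, c (col n (Pi.single i (x.1.1 i 0))) (col n (Pi.single j (y.1.1 j 0))) = 0 := by
    intro i j
    by_cases hi : i = 0
    · rw [hi, col_single_zero, map_zero, LinearMap.zero_apply]
    by_cases hj : j = 0
    · rw [hj, col_single_zero, map_zero]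
    exact slH_ext fun a b => h i j a b _ _ hi hj
  simp [this]

/-! ### Cocycles, coboundaries and classes -/

-- Instance shortcuts for the type-class search; they are the inherited structures.
instance (n : ℕ) : AddCommGroup (cocycles n) := AddSubgroupClass.toAddCommGroup (cocycles n)
instance (n : ℕ) : Module ℝ (cocycles n) := SubmoduleClass.module (cocycles n)
instance (n : ℕ) : SMul ℝ (cocycles n) := Module.toDistribMulAction.toMulAction.toSMul
instance (n : ℕ) : SMul ℝ (H2 n) := Module.toDistribMulAction.toMulAction.toSMul

lemma mem_cocycles {n : ℕ} {c : Bilin n} (halt : ∀ x, c x x = 0)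
    (hd : ∀ x y z : gMinus n, ⁅(x : slH (n + 1)), c y z⁆ - ⁅(y : slH (n + 1)), c x z⁆ +
      ⁅(z : slH (n + 1)), c x y⁆ = 0) : c ∈ cocycles n := by
  refine ⟨⟨c, halt⟩, ?_, rfl⟩
  change d₂₃ ℝ (gMinus n) (slH (n + 1)) ⟨c, halt⟩ = 0
  ext1 x; ext1 y; ext1 z
  rw [d₂₃_apply]
  simp only [gMinus_lie_eq_zero, map_zero, ← twoCochain_val_apply, LinearMap.zero_apply, sub_zero,
    add_zero]
  exact hd x y z

lemma cocycle_alt {n : ℕ} (c : cocycles n) (x : gMinus n) : c.1 x x = 0 := by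
  obtain ⟨⟨c, hc⟩, hc', h⟩ := c.2
  rw [← h]
  exact hc x

lemma cocycle_closed {n : ℕ} (c : cocycles n) (x y z : gMinus n) :
    ⁅(x : slH (n + 1)), c.1 y z⁆ - ⁅(y : slH (n + 1)), c.1 x z⁆ +
      ⁅(z : slH (n + 1)), c.1 x y⁆ = 0 := by
  obtain ⟨⟨c, hc⟩, hc', h⟩ := c.2
  rw [← h]
  have := LinearMap.congr_fun (LinearMap.congr_fun (LinearMap.congr_fun
    (show d₂₃ ℝ (gMinus n) (slH (n + 1)) ⟨c, hc⟩ = 0 from hc') x) y) z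
  rw [d₂₃_apply] at this
  simp only [gMinus_lie_eq_zero, map_zero, ← twoCochain_val_apply, LinearMap.zero_apply, sub_zero,
    add_zero] at this
  exact this

lemma mem_coboundaries_iff {n : ℕ} (c : cocycles n) : c ∈ coboundaries n ↔
    ∃ f : gMinus n →ₗ[ℝ] slH (n + 1), ∀ x y : gMinus n,
      c.1 x y = ⁅(x : slH (n + 1)), f y⁆ - ⁅(y : slH (n + 1)), f x⁆ := by
  constructor
  · rintro ⟨_, ⟨f, rfl⟩, hf⟩
    refine ⟨f, fun x y => ?_⟩
    change _ = c.1 at hf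
    rw [← hf]
    change ⁅x, f y⁆ - ⁅y, f x⁆ - f ⁅x, y⁆ = _
    rw [gMinus_lie_eq_zero, map_zero, sub_zero]
    rfl
  · rintro ⟨f, hf⟩
    refine ⟨d₁₂ ℝ (gMinus n) (slH (n + 1)) f, ⟨f, rfl⟩, ?_⟩
    change (d₁₂ ℝ (gMinus n) (slH (n + 1)) f).1 = c.1
    ext1 x; ext1 y
    change ⁅x, f y⁆ - ⁅y, f x⁆ - f ⁅x, y⁆ = _
    rw [gMinus_lie_eq_zero, map_zero, sub_zero, hf]
    rfl

lemma mk_eq_zero {n : ℕ} {c : cocycles n} : H2.mk n c = 0 ↔ c ∈ coboundaries n :=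
  LieSubmodule.Quotient.mk_eq_zero (coboundaries n)

lemma mk_sub {n : ℕ} (c c' : cocycles n) : H2.mk n (c - c') = H2.mk n c - H2.mk n c' :=
  LinearMap.map_sub (H2.mk n).toLinearMap c c'

lemma mk_smul {n : ℕ} (t : ℝ) (c : cocycles n) : H2.mk n (t • c) = t • H2.mk n c :=
  LinearMap.map_smul (H2.mk n).toLinearMap t c

lemma mk_lie {n : ℕ} (A : g0 n) (c : cocycles n) : H2.mk n ⁅A, c⁆ = ⁅A, H2.mk n c⁆ :=
  LieModuleHom.map_lie _ _ _

lemma mk_surjective {n : ℕ} (w : H2 n) : ∃ c, H2.mk n c = w :=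
  LieSubmodule.Quotient.surjective_mk' _ w

lemma lie_diagElt_diagElt {n : ℕ} (d e : Fin (n + 1) → ℝ) (hd : ∑ i, d i = 0)
    (he : ∑ i, e i = 0) : ⁅diagElt d hd, diagElt e he⁆ = 0 := by
  refine g0_ext fun k l => ?_
  rw [LieSubalgebra.coe_bracket, diagElt_lie_apply, diagElt_apply]
  split_ifs with h
  · rw [h, sub_self, zero_smul]; rfl
  · rw [smul_zero]; rfl

/-- The value of a cocycle on coordinate vectors, at a matrix entry. -/
def entry {n : ℕ} (a : (Fin (n + 1) × Fin (n + 1)) × (Fin (n + 1) × Fin (n + 1)) × ℍ[ℝ] × ℍ[ℝ]) :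
    cocycles n →ₗ[ℝ] ℍ[ℝ] where
  toFun c := (c.1 (col n (Pi.single a.1.1 a.2.2.1)) (col n (Pi.single a.1.2 a.2.2.2))).1
    a.2.1.1 a.2.1.2
  map_add' _ _ := rfl
  map_smul' _ _ := rfl

/-- An eigenclass of two diagonal elements is represented by a cocycle that is an eigenvector
of both. -/
lemma exists_eigen_cocycle {n : ℕ} (d e : Fin (n + 1) → ℝ) (hd : ∑ i, d i = 0)
    (he : ∑ i, e i = 0) {μ θ : ℝ} {w : H2 n} (h1 : ⁅diagElt d hd, w⁆ = μ • w)
    (h2 : ⁅diagElt e he, w⁆ = θ • w) :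
    ∃ c : cocycles n, H2.mk n c = w ∧ ⁅diagElt d hd, c⁆ = μ • c ∧ ⁅diagElt e he, c⁆ = θ • c :=
  exists_simultaneous_lift (H2.mk n) mk_surjective (lie_diagElt_diagElt d e hd he)
    (entry (n := n))
    (fun _ hm => Subtype.ext (bilin_eq_zero fun i j k l p q _ _ => hm ((i, j), (k, l), p, q)))
    (fun a => diagWeight d a.1 a.2.1) (fun a => diagWeight e a.1 a.2.1)
    (Finset.univ.image fun a : (Fin (n + 1) × Fin (n + 1)) × (Fin (n + 1) × Fin (n + 1)) =>
      diagWeight d a.1 a.2)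
    (Finset.univ.image fun a : (Fin (n + 1) × Fin (n + 1)) × (Fin (n + 1) × Fin (n + 1)) =>
      diagWeight e a.1 a.2)
    (fun a => Finset.mem_image.2 ⟨(a.1, a.2.1), Finset.mem_univ _, rfl⟩)
    (fun a => Finset.mem_image.2 ⟨(a.1, a.2.1), Finset.mem_univ _, rfl⟩)
    (fun _ m => diagElt_lie_bilin d hd m.1 _ _ _ _ _ _)
    (fun _ m => diagElt_lie_bilin e he m.1 _ _ _ _ _ _) h1 h2

/-! ### Cochains concentrated in one matrix entry -/

lemma fin_one_ne_zero {n : ℕ} (hn : 2 ≤ n) : (1 : Fin (n + 1)) ≠ 0 := by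
  intro h
  have := congrArg Fin.val h
  rw [Fin.val_one', Fin.val_zero, Nat.mod_eq_of_lt (by omega)] at this
  omega

lemma fin_last_ne_zero {n : ℕ} (hn : 2 ≤ n) : Fin.last n ≠ 0 := by
  intro h
  have := congrArg Fin.val h
  simp at this
  omega

lemma fin_one_val {n : ℕ} (hn : 2 ≤ n) : (1 : Fin (n + 1)).val = 1 := by
  rw [Fin.val_one']
  exact Nat.mod_eq_of_lt (by omega)

lemma fin_one_ne_last {n : ℕ} (hn : 2 ≤ n) : (1 : Fin (n + 1)) ≠ Fin.last n := by
  intro h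
  have := congrArg Fin.val h
  rw [fin_one_val hn, Fin.val_last] at this
  omega

/-- The matrix with the entry `p` in the off-diagonal position `(k, l)`. -/
def unit {m : ℕ} {k l : Fin m} (h : k ≠ l) : ℍ[ℝ] →ₗ[ℝ] slH m where
  toFun p := ⟨Matrix.single k l p, by
    change (Matrix.trace (Matrix.single k l p)).re = 0
    rw [Matrix.trace_single_eq_of_ne _ _ _ h]
    rfl⟩
  map_add' p q := Subtype.ext (Matrix.single_add k l p q)
  map_smul' t p := Subtype.ext (Matrix.smul_single t k l p).symm

lemma unit_apply {m : ℕ} {k l : Fin m} (h : k ≠ l) (p : ℍ[ℝ]) (a b : Fin m) :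
    (unit h p).1 a b = if k = a ∧ l = b then p else 0 := rfl

/-- The last coordinate on `𝔤₋₁ = ℍⁿ`. -/
def lastEntry (n : ℕ) : gMinus n →ₗ[ℝ] ℍ[ℝ] where
  toFun x := x.1.1 (Fin.last n) 0
  map_add' _ _ := rfl
  map_smul' _ _ := rfl

lemma lastEntry_apply {n : ℕ} (x : gMinus n) : lastEntry n x = x.1.1 (Fin.last n) 0 := rfl

lemma lastEntry_col {n : ℕ} (hn : 2 ≤ n) (v : Fin (n + 1) → ℍ[ℝ]) :
    lastEntry n (col n v) = v (Fin.last n) :=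
  col_apply_zero _ (fin_last_ne_zero hn)

/-- The cochain `(x, y) ↦ ψ(xₙ, yₙ)`, with the value put into the matrix position `(k, l)`. -/
def formCochain {n : ℕ} {k l : Fin (n + 1)} (h : k ≠ l) (ψ : ℍ[ℝ] →ₗ[ℝ] ℍ[ℝ] →ₗ[ℝ] ℍ[ℝ]) :
    Bilin n :=
  (ψ.compl₁₂ (lastEntry n) (lastEntry n)).compr₂ (unit h)

lemma formCochain_apply {n : ℕ} {k l : Fin (n + 1)} (h : k ≠ l)
    (ψ : ℍ[ℝ] →ₗ[ℝ] ℍ[ℝ] →ₗ[ℝ] ℍ[ℝ]) (x y : gMinus n) :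
    formCochain h ψ x y = unit h (ψ (lastEntry n x) (lastEntry n y)) := rfl

lemma formCochain_single {n : ℕ} (hn : 2 ≤ n) {k l : Fin (n + 1)} (h : k ≠ l)
    (ψ : ℍ[ℝ] →ₗ[ℝ] ℍ[ℝ] →ₗ[ℝ] ℍ[ℝ]) (i j a b : Fin (n + 1)) (p q : ℍ[ℝ]) :
    (formCochain h ψ (col n (Pi.single i p)) (col n (Pi.single j q))).1 a b =
      if i = Fin.last n ∧ j = Fin.last n ∧ k = a ∧ l = b then ψ p q else 0 := by
  rw [formCochain_apply, unit_apply, lastEntry_col hn, lastEntry_col hn]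
  by_cases hi : i = Fin.last n
  · by_cases hj : j = Fin.last n
    · subst hi hj
      simp
    · rw [Pi.single_eq_of_ne (Ne.symm hj), map_zero]
      simp [hj]
  · rw [Pi.single_eq_of_ne (Ne.symm hi), map_zero]
    simp [hi]

lemma diagElt_lie_formCochain {n : ℕ} (hn : 2 ≤ n) {k l : Fin (n + 1)} (h : k ≠ l)
    (ψ : ℍ[ℝ] →ₗ[ℝ] ℍ[ℝ] →ₗ[ℝ] ℍ[ℝ]) (d : Fin (n + 1) → ℝ) (hd : ∑ i, d i = 0) :
    ⁅diagElt d hd, formCochain h ψ⁆ =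
      diagWeight d (Fin.last n, Fin.last n) (k, l) • formCochain h ψ := by
  rw [← sub_eq_zero]
  refine bilin_eq_zero fun i j a b p q _ _ => ?_
  change (⁅diagElt d hd, formCochain h ψ⁆ (col n (Pi.single i p)) (col n (Pi.single j q))).1 a b -
    diagWeight d (Fin.last n, Fin.last n) (k, l) •
      (formCochain h ψ (col n (Pi.single i p)) (col n (Pi.single j q))).1 a b = 0
  rw [diagElt_lie_bilin, formCochain_single hn]
  split_ifs with hc
  · obtain ⟨rfl, rfl, rfl, rfl⟩ := hc
    rw [sub_self]
  · simp

/-- A bilinear map whose values on coordinate vectors vanish outside one component is of the form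
`formCochain`. -/
lemma eq_formCochain {n : ℕ} (hn : 2 ≤ n) {k l : Fin (n + 1)} (h : k ≠ l) (c : Bilin n)
    (hc : ∀ i j a b p q, i ≠ 0 → j ≠ 0 → ¬(i = Fin.last n ∧ j = Fin.last n ∧ k = a ∧ l = b) →
      (c (col n (Pi.single i p)) (col n (Pi.single j q))).1 a b = 0)
    (halt : ∀ x, c x x = 0) :
    ∃ ψ : ℍ[ℝ] →ₗ[ℝ] ℍ[ℝ] →ₗ[ℝ] ℍ[ℝ], (∀ p, ψ p p = 0) ∧ c = formCochain h ψ := by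
  let e : ℍ[ℝ] →ₗ[ℝ] gMinus n := (col n).comp (LinearMap.single ℝ (fun _ => ℍ[ℝ]) (Fin.last n))
  let t : slH (n + 1) →ₗ[ℝ] ℍ[ℝ] :=
    { toFun := fun X => X.1 k l
      map_add' := fun _ _ => rfl
      map_smul' := fun _ _ => rfl }
  refine ⟨(c.compl₁₂ e e).compr₂ t, fun p => ?_, ?_⟩
  · change t (c (e p) (e p)) = 0
    rw [halt, map_zero]
  · rw [← sub_eq_zero]
    refine bilin_eq_zero fun i j a b p q hi hj => ?_
    change (c (col n (Pi.single i p)) (col n (Pi.single j q))).1 a b -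
      (formCochain h ((c.compl₁₂ e e).compr₂ t) (col n (Pi.single i p))
        (col n (Pi.single j q))).1 a b = 0
    rw [formCochain_single hn]
    split_ifs with hh
    · obtain ⟨rfl, rfl, rfl, rfl⟩ := hh
      exact sub_self _
    · rw [hc i j a b p q hi hj hh, sub_zero]

/-! ### The largest weights -/

lemma gradingZ_entry {n : ℕ} (i : Fin (n + 1)) :
    (if i = 0 then (n : ℝ) / (n + 1) else -1 / (n + 1)) =
      (if i = 0 then (1 : ℝ) else 0) - 1 / (n + 1) := by
  have : (n : ℝ) + 1 ≠ 0 := by positivity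
  split_ifs
  · field_simp; ring
  · ring

lemma mem_H2hom_iff {n k : ℕ} {w : H2 n} : w ∈ H2hom n k ↔ ⁅gradingZ n, w⁆ = (k : ℝ) • w := by
  rw [H2hom, Module.End.mem_eigenspace_iff, LieModule.toEnd_apply_apply]

/-- An eigenclass of `Z` and `Z'` has a representative whose nonzero components have exactly the
weights of the class. -/
lemma exists_weight_cocycle {n : ℕ} {k : ℕ} {θ : ℝ} {w : H2 n}
    (h1 : w ∈ H2hom n k) (h2 : ⁅gradingZ' n, w⁆ = θ • w) :
    ∃ c : cocycles n, H2.mk n c = w ∧ ∀ i j a b p q, i ≠ 0 → j ≠ 0 →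
      (c.1 (col n (Pi.single i p)) (col n (Pi.single j q))).1 a b ≠ 0 →
      ((if a = 0 then (1 : ℝ) else 0) - (if b = 0 then 1 else 0) + 2 = k ∧
      diagWeight (fun i => (if i = 1 then (1 : ℝ) else 0) - (if i = Fin.last n then 1 else 0))
        (i, j) (a, b) = θ) := by
  obtain ⟨c, hc, e1, e2⟩ := exists_eigen_cocycle _ _ _ _ (mem_H2hom_iff.1 h1) h2
  refine ⟨c, hc, fun i j a b p q hi hj hne => ?_⟩
  have f1 := congrArg (fun c : cocycles n =>
    (c.1 (col n (Pi.single i p)) (col n (Pi.single j q))).1 a b) e1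
  have f2 := congrArg (fun c : cocycles n =>
    (c.1 (col n (Pi.single i p)) (col n (Pi.single j q))).1 a b) e2
  have f1' := (diagElt_lie_bilin _ _ c.1 i j a b p q).symm.trans f1
  have f2' := (diagElt_lie_bilin _ _ c.1 i j a b p q).symm.trans f2
  have g1 := smul_left_injective ℝ hne f1'
  have g2 := smul_left_injective ℝ hne f2'
  refine ⟨?_, g2⟩
  rw [funext (gradingZ_entry (n := n)), diagWeight] at g1
  rw [← g1]
  simp only [if_true, if_neg hi, if_neg hj]
  ring

lemma diagWeight_Z' {n : ℕ} (hn : 2 ≤ n) (i j a b : Fin (n + 1)) :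
    diagWeight (fun i => (if i = 1 then (1 : ℝ) else 0) - (if i = Fin.last n then 1 else 0))
        (i, j) (a, b) =
      ((if a = 1 then (1 : ℝ) else 0) - (if a = Fin.last n then 1 else 0)) -
      ((if b = 1 then (1 : ℝ) else 0) - (if b = Fin.last n then 1 else 0)) -
      ((if i = 1 then (1 : ℝ) else 0) - (if i = Fin.last n then 1 else 0)) -
      ((if j = 1 then (1 : ℝ) else 0) - (if j = Fin.last n then 1 else 0)) := by
  rw [diagWeight]
  simp only [if_neg (fin_one_ne_zero hn).symm, if_neg (fin_last_ne_zero hn).symm]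
  ring

lemma Z'_entry_bounds {n : ℕ} (hn : 2 ≤ n) (i : Fin (n + 1)) :
    let t := (if i = 1 then (1 : ℝ) else 0) - (if i = Fin.last n then 1 else 0)
    (i = 1 ∧ t = 1) ∨ (i = Fin.last n ∧ t = -1) ∨ (i ≠ 1 ∧ i ≠ Fin.last n ∧ t = 0) := by
  have := fin_one_ne_last hn
  by_cases h1 : i = 1
  · left; simp [h1, this]
  · by_cases h2 : i = Fin.last n
    · right; left; simp [h2, this.symm]
    · right; right; simp [h1, h2]

/-- In homogeneity one the largest `Z'`-weight is `3`, attained by a single matrix entry. -/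
lemma torsion_weight_le {n : ℕ} (hn : 2 ≤ n) {i j a b : Fin (n + 1)}
    (h : (if a = 0 then (1 : ℝ) else 0) - (if b = 0 then 1 else 0) + 2 = 1) {θ : ℝ} (hθ : 3 ≤ θ)
    (h' : diagWeight (fun i => (if i = 1 then (1 : ℝ) else 0) - (if i = Fin.last n then 1 else 0))
        (i, j) (a, b) = θ) :
    θ = 3 ∧ i = Fin.last n ∧ j = Fin.last n ∧ 1 = a ∧ 0 = b := by
  rw [diagWeight_Z' hn] at h'
  have hb : b = 0 := by
    by_contra hb
    rw [if_neg hb] at h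
    split_ifs at h <;> linarith
  subst hb
  rw [if_neg (fin_one_ne_zero hn).symm, if_neg (fin_last_ne_zero hn).symm] at h'
  rcases Z'_entry_bounds hn i with ⟨hi, ti⟩ | ⟨hi, ti⟩ | ⟨_, _, ti⟩ <;>
  rcases Z'_entry_bounds hn j with ⟨hj, tj⟩ | ⟨hj, tj⟩ | ⟨_, _, tj⟩ <;>
  rcases Z'_entry_bounds hn a with ⟨ha, ta⟩ | ⟨ha, ta⟩ | ⟨_, _, ta⟩ <;>
  rw [ti, tj, ta] at h' <;> first | (exfalso; linarith) | skip
  exact ⟨by linarith, hi, hj, ha.symm, rfl⟩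

/-- The largest `Z'`-weight of all is `4`, attained by a single matrix entry. -/
lemma curvature_weight_le {n : ℕ} (hn : 2 ≤ n) {i j a b : Fin (n + 1)} {θ : ℝ} (hθ : 4 ≤ θ)
    (h' : diagWeight (fun i => (if i = 1 then (1 : ℝ) else 0) - (if i = Fin.last n then 1 else 0))
        (i, j) (a, b) = θ) :
    θ = 4 ∧ i = Fin.last n ∧ j = Fin.last n ∧ 1 = a ∧ Fin.last n = b := by
  rw [diagWeight_Z' hn] at h'
  have b1 (i : Fin (n + 1)) :
      (if i = 1 then (1 : ℝ) else 0) - (if i = Fin.last n then 1 else 0) ≤ 1 := by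
    rcases Z'_entry_bounds hn i with ⟨hi, ti⟩ | ⟨hi, ti⟩ | ⟨_, _, ti⟩ <;> rw [ti] <;> norm_num
  have b2 (i : Fin (n + 1)) (hi : i ≠ Fin.last n) :
      0 ≤ (if i = 1 then (1 : ℝ) else 0) - (if i = Fin.last n then 1 else 0) := by
    rw [if_neg hi]; split_ifs <;> norm_num
  have b3 (i : Fin (n + 1)) :
      -1 ≤ (if i = 1 then (1 : ℝ) else 0) - (if i = Fin.last n then 1 else 0) := by
    split_ifs <;> norm_num
  have b4 (i : Fin (n + 1)) (hi : i ≠ 1) :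
      (if i = 1 then (1 : ℝ) else 0) - (if i = Fin.last n then 1 else 0) ≤ 0 := by
    rw [if_neg hi]; split_ifs <;> norm_num
  have := b1 a
  have := b3 b
  have := b3 i
  have := b3 j
  refine ⟨by linarith, ?_, ?_, ?_, ?_⟩
  · by_contra hc; have := b2 i hc; linarith
  · by_contra hc; have := b2 j hc; linarith
  · by_contra hc; have := b4 a (Ne.symm hc); linarith
  · by_contra hc; have := b2 b (Ne.symm hc); linarith

/-! ### The torsion module: classes of largest weight and their annihilators -/

/-- The alternating form `(p, q) ↦ φ(Im (p̄ q))` on `ℍ`, where `φ` is given by `f`. -/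
def imForm (f : Fin 3 → ℍ[ℝ]) : ℍ[ℝ] →ₗ[ℝ] ℍ[ℝ] →ₗ[ℝ] ℍ[ℝ] :=
  LinearMap.mk₂ ℝ (fun p q => imMap f (star p * q))
    (fun p p' q => by rw [star_add, add_mul, map_add])
    (fun t p q => by rw [Quaternion.star_smul, smul_mul_assoc, map_smul])
    (fun p q q' => by rw [mul_add, map_add])
    (fun t p q => by rw [mul_smul_comm, map_smul])

lemma imForm_apply (f : Fin 3 → ℍ[ℝ]) (p q : ℍ[ℝ]) : imForm f p q = imMap f (star p * q) := rfl

lemma imForm_self (f : Fin 3 → ℍ[ℝ]) (p : ℍ[ℝ]) : imForm f p p = 0 := by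
  rw [imForm_apply, Quaternion.star_mul_self, imMap_apply]
  simp

lemma unit_mem_gMinus {n : ℕ} {k : Fin (n + 1)} (h : k ≠ 0) (p : ℍ[ℝ]) :
    unit h p ∈ gMinus n := by
  intro i j hij
  rw [unit_apply, if_neg]
  rintro ⟨rfl, rfl⟩
  rcases hij with h' | h'
  · exact h h'
  · exact h' rfl

lemma lie_eq_zero_of_mem_gMinus {n : ℕ} (x : gMinus n) {y : slH (n + 1)} (hy : y ∈ gMinus n) :
    ⁅(x : slH (n + 1)), y⁆ = 0 :=
  congrArg Subtype.val (gMinus_lie_eq_zero x ⟨y, hy⟩)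

/-- The torsion cocycle with values in the first coordinate of `𝔤₋₁` given by an alternating form
in the last coordinate. -/
def torsionCocycle {n : ℕ} (hn : 2 ≤ n) (ψ : ℍ[ℝ] →ₗ[ℝ] ℍ[ℝ] →ₗ[ℝ] ℍ[ℝ]) (hψ : ∀ p, ψ p p = 0) :
    cocycles n :=
  ⟨formCochain (fin_one_ne_zero hn) ψ, mem_cocycles
    (fun x => by rw [formCochain_apply, hψ, map_zero])
    (fun x y z => by
      simp only [formCochain_apply]
      rw [lie_eq_zero_of_mem_gMinus _ (unit_mem_gMinus _ _),
        lie_eq_zero_of_mem_gMinus _ (unit_mem_gMinus _ _),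
        lie_eq_zero_of_mem_gMinus _ (unit_mem_gMinus _ _), sub_zero, add_zero])⟩

/-- The torsion class with representative `x ∧ y ↦ φ(Im (x̄ₙ yₙ))` in the first coordinate. -/
def torsionClass {n : ℕ} (hn : 2 ≤ n) (f : Fin 3 → ℍ[ℝ]) : H2 n :=
  H2.mk n (torsionCocycle hn (imForm f) (imForm_self f))

lemma slH_lie_apply {m : ℕ} (X Y : slH m) (k l : Fin m) :
    (⁅X, Y⁆ : slH m).1 k l = ∑ i, X.1 k i * Y.1 i l - ∑ i, Y.1 k i * X.1 i l := by
  rw [coe_lie_slH, Matrix.sub_apply, Matrix.mul_apply, Matrix.mul_apply]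

lemma gMinus_lie_apply_zero {n : ℕ} (x : gMinus n) (Y : slH (n + 1)) (k : Fin (n + 1)) :
    (⁅(x : slH (n + 1)), Y⁆ : slH (n + 1)).1 k 0 =
      x.1.1 k 0 * Y.1 0 0 - ∑ i, Y.1 k i * x.1.1 i 0 := by
  rw [slH_lie_apply]
  congr 1
  refine Finset.sum_eq_single 0 (fun i _ hi => ?_) (by simp)
  rw [x.2 k i (Or.inr hi), zero_mul]

/-- Restricted to a quaternionic line `v ℍ` and taken modulo that line, a coboundary has the form
`h(p) q - h(q) p`. -/
lemma coboundary_on_line {n : ℕ} {c : cocycles n} (hc : c ∈ coboundaries n)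
    (α v : Fin (n + 1) → ℍ[ℝ]) (hv : v 0 = 0) (hα : ∑ k, α k * v k = 0) :
    ∃ h : ℍ[ℝ] → ℍ[ℝ], ∀ p q, ∑ k, α k * (c.1 (col n fun i => v i * p)
      (col n fun i => v i * q)).1 k 0 = h p * q - h q * p := by
  obtain ⟨F, hF⟩ := (mem_coboundaries_iff c).1 hc
  have hcol (p : ℍ[ℝ]) (i) : (col n fun i => v i * p).1.1 i 0 = v i * p := by
    by_cases hi : i = 0
    · rw [hi, hv, zero_mul]; rfl
    · exact col_apply_zero _ hi
  refine ⟨fun p => ∑ k, α k * ∑ i, (F (col n fun i => v i * p)).1 k i * v i, fun p q => ?_⟩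
  have key (p : ℍ[ℝ]) (Y : slH (n + 1)) :
      ∑ k, α k * (⁅(col n fun i => v i * p : slH (n + 1)), Y⁆ : slH (n + 1)).1 k 0 =
        -((∑ k, α k * ∑ i, Y.1 k i * v i) * p) := by
    have e1 : ∑ k, α k * (v k * p * Y.1 0 0) = 0 := by
      simp only [← mul_assoc, ← Finset.sum_mul]
      rw [hα, zero_mul, zero_mul]
    simp only [gMinus_lie_apply_zero, hcol, mul_sub, Finset.sum_sub_distrib]
    rw [e1, zero_sub, Finset.sum_mul]
    congr 1
    refine Finset.sum_congr rfl fun k _ => ?_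
    simp only [mul_assoc, Finset.sum_mul]
  have e2 : ∀ k, (c.1 (col n fun i => v i * p) (col n fun i => v i * q)).1 k 0 =
      (⁅(col n fun i => v i * p : slH (n + 1)), F (col n fun i => v i * q)⁆ : slH (n + 1)).1 k 0 -
      (⁅(col n fun i => v i * q : slH (n + 1)), F (col n fun i => v i * p)⁆ : slH (n + 1)).1 k 0 := by
    intro k
    rw [hF]
    rfl
  simp only [e2, mul_sub, Finset.sum_sub_distrib, key]
  abel

/-- The action of `𝔤₀` on torsion cochains. -/
lemma lie_torsion_apply {n : ℕ} (hn : 2 ≤ n) (ψ : ℍ[ℝ] →ₗ[ℝ] ℍ[ℝ] →ₗ[ℝ] ℍ[ℝ]) (A : g0 n)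
    (x y : gMinus n) (k : Fin (n + 1)) :
    ((⁅A, formCochain (fin_one_ne_zero hn) ψ⁆ : Bilin n) x y).1 k 0 =
      A.1.1 k 1 * ψ (lastEntry n x) (lastEntry n y) -
      (if k = 1 then ψ (lastEntry n x) (lastEntry n y) * A.1.1 0 0 +
        ψ (lastEntry n x) (lastEntry n ⁅A, y⁆) + ψ (lastEntry n ⁅A, x⁆) (lastEntry n y) else 0) := by
  rw [bilin_lie_apply]
  simp only [formCochain_apply]
  change (⁅(A : slH (n + 1)), unit _ _⁆ : slH (n + 1)).1 k 0 - (unit _ _).1 k 0 -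
    (unit _ _).1 k 0 = _
  rw [slH_lie_apply, Finset.sum_eq_single 1, Finset.sum_eq_single 0]
  · simp only [unit_apply, and_true, if_true]
    by_cases h1 : k = 1
    · simp only [h1, if_true]; abel
    · simp only [if_neg h1, if_neg (Ne.symm h1)]; simp
  · intro i _ hi
    rw [g0_apply_zero _ hi, mul_zero]
  · simp
  · intro i _ hi
    rw [unit_apply, if_neg (fun h => hi h.1.symm), mul_zero]
  · simp

/-- The map `Im ℍ → ℍ` by which `A ∈ 𝔤₀` with `A₀₀ = a`, `A₁₁ = b` acts on the torsion class of `f`;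
`m` is the scalar by which `A` acts on the last coordinate. -/
def actTriple (f : Fin 3 → ℍ[ℝ]) (a b m : ℍ[ℝ]) : Fin 3 → ℍ[ℝ] :=
  (b.re + a.re - 2 * m.re) • f + stabTriple f a.im b.im

lemma IsNormal.actTriple {f : Fin 3 → ℍ[ℝ]} (hf : IsNormal f) (a b m : ℍ[ℝ]) :
    IsNormal (actTriple f a b m) :=
  (hf.smul _).add (hf.stabTriple (Quaternion.re_im a) _)

/-- The terms of the action of `𝔤₀` on the form `φ(Im (p̄ q))` combine to the form of `actTriple`. -/
lemma imMap_actTriple (f : Fin 3 → ℍ[ℝ]) (a b m p q : ℍ[ℝ]) :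
    b * imMap f (star p * q) - (imMap f (star p * q) * a + imMap f (star p * (m * q - q * a)) +
      imMap f (star (m * p - p * a) * q)) = imMap (actTriple f a b m) (star p * q) := by
  have e1 : star p * (m * q - q * a) + star (m * p - p * a) * q =
      (2 * m.re) • (star p * q) - ((2 * a.re) • (star p * q) +
        ((star p * q) * a.im - a.im * (star p * q))) := by
    have h1 : star m = (2 * m.re) • 1 - m := by
      ext
      · simp; ring
      all_goals simp
    have h2 : star a = a.re • 1 - a.im := by ext <;> simp
    have h3 : a = a.re • 1 + a.im := by ext <;> simp
    rw [star_sub, star_mul, star_mul, h1, h2]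
    conv_lhs => rw [h3]
    simp only [mul_add, add_mul, mul_sub, sub_mul, smul_mul_assoc, mul_smul_comm, mul_one, one_mul,
      mul_assoc, Quaternion.re_add, Quaternion.re_im, Quaternion.re_smul, Quaternion.re_one,
      Quaternion.im_add, Quaternion.im_smul, Quaternion.im_one, Quaternion.im_idem]
    simp
    module
  rw [add_assoc, ← map_add, e1, actTriple, imMap_add, imMap_smul', imMap_stabTriple, stabMap]
  simp only [map_sub, map_add, map_smul]
  have h3 : a = a.re • 1 + a.im := by ext <;> simp
  have h4 : b = b.re • 1 + b.im := by ext <;> simp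
  have h5 : imMap f (star p * q) * a = a.re • imMap f (star p * q) +
      imMap f (star p * q) * a.im := by
    conv_lhs => rw [h3]
    rw [mul_add, mul_smul_comm, mul_one]
  have h6 : b * imMap f (star p * q) = b.re • imMap f (star p * q) +
      b.im * imMap f (star p * q) := by
    conv_lhs => rw [h4]
    rw [add_mul, smul_mul_assoc, one_mul]
  rw [h5, h6]
  module

lemma lastEntry_lie_col {n : ℕ} (hn : 2 ≤ n) (A : g0 n) (v : Fin (n + 1) → ℍ[ℝ])
    (hv : v (Fin.last n) = 1) (p : ℍ[ℝ]) :
    lastEntry n ⁅A, col n fun i => v i * p⁆ =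
      (∑ k, A.1.1 (Fin.last n) k * v k) * p - p * A.1.1 0 0 := by
  rw [lastEntry_apply, lie_gMinus_apply, col_apply_zero _ (fin_last_ne_zero hn), hv, one_mul,
    Finset.sum_mul]
  congr 1
  refine Finset.sum_congr rfl fun k _ => ?_
  by_cases hk : k = 0
  · rw [hk, g0_apply_zero _ (fin_last_ne_zero hn)]; simp
  · rw [col_apply_zero _ hk, mul_assoc]

/-- The action on a torsion class, evaluated on the quaternionic line of a vector with last
coordinate `1`. -/
lemma lie_torsion_on_line {n : ℕ} (hn : 2 ≤ n) (f : Fin 3 → ℍ[ℝ]) (A : g0 n)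
    (v : Fin (n + 1) → ℍ[ℝ]) (hv : v (Fin.last n) = 1) (p q : ℍ[ℝ]) (k : Fin (n + 1)) :
    ((⁅A, torsionCocycle hn (imForm f) (imForm_self f)⁆ : cocycles n).1 (col n fun i => v i * p)
      (col n fun i => v i * q)).1 k 0 = if k = 1 then
        imMap (actTriple f (A.1.1 0 0) (A.1.1 1 1) (∑ k, A.1.1 (Fin.last n) k * v k)) (star p * q)
      else A.1.1 k 1 * imMap f (star p * q) := by
  refine (lie_torsion_apply hn (imForm f) A _ _ k).trans ?_
  rw [lastEntry_lie_col hn A v hv, lastEntry_lie_col hn A v hv, lastEntry_col hn,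
    lastEntry_col hn, hv, one_mul, one_mul]
  split_ifs with h
  · rw [h, ← imMap_actTriple]
    rfl
  · rw [sub_zero]; rfl

lemma lie_torsionClass {n : ℕ} (hn : 2 ≤ n) (f : Fin 3 → ℍ[ℝ]) (A : g0 n) :
    ⁅A, torsionClass hn f⁆ = H2.mk n ⁅A, torsionCocycle hn (imForm f) (imForm_self f)⁆ :=
  (mk_lie _ _).symm

lemma eq_zero_of_mul_triple {f : Fin 3 → ℍ[ℝ]} (hf0 : f ≠ 0) {a : ℍ[ℝ]}
    (h : (fun k => a * f k) = 0) : a = 0 := by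
  by_contra ha
  apply hf0
  funext k
  exact (mul_eq_zero.1 (congrFun h k)).resolve_left ha

/-- The conditions on `A ∈ 𝔤₀` that do not involve the choice of a torsion class: the entries of
negative `Z'`-weight vanish, and the real diagonal part acts trivially. -/
def IsTorsionShape {n : ℕ} (A : g0 n) : Prop :=
  (∀ k, k ≠ 0 → k ≠ 1 → A.1.1 k 1 = 0) ∧ (∀ j, j ≠ 0 → j ≠ Fin.last n → A.1.1 (Fin.last n) j = 0) ∧
    (A.1.1 1 1).re + (A.1.1 0 0).re - 2 * (A.1.1 (Fin.last n) (Fin.last n)).re = 0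

/-- The conditions come from evaluating `A` times the class, which is a coboundary, on the
quaternionic lines of the last coordinate vector and of its sums with multiples of the others. -/
lemma isTorsionShape_of_mem_ann {n : ℕ} (hn : 2 ≤ n) {f : Fin 3 → ℍ[ℝ]} (hf : IsNormal f)
    (hf0 : f ≠ 0) {A : g0 n} (hA : A ∈ ann (torsionClass hn f)) :
    IsTorsionShape A ∧ Stab f (A.1.1 0 0).im (A.1.1 1 1).im := by
  have h10 := fin_one_ne_zero hn
  have hl0 := fin_last_ne_zero hn
  have h1l := fin_one_ne_last hn
  have hA' : ⁅A, torsionClass hn f⁆ = 0 := hA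
  rw [lie_torsionClass, mk_eq_zero] at hA'
  -- the line of the last coordinate vector
  let e : Fin (n + 1) → ℍ[ℝ] := Pi.single (Fin.last n) 1
  have he : e (Fin.last n) = 1 := Pi.single_eq_same _ _
  have hse : ∑ k, A.1.1 (Fin.last n) k * e k = A.1.1 (Fin.last n) (Fin.last n) := by
    rw [Finset.sum_eq_single (Fin.last n) (fun k _ hk => by
      rw [show e k = 0 from Pi.single_eq_of_ne hk _, mul_zero]) (by simp), he, mul_one]
  have test1 (k : Fin (n + 1)) (hkl : k ≠ Fin.last n) :
      ∃ h : ℍ[ℝ] → ℍ[ℝ], ∀ p q, (if k = 1 then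
        imMap (actTriple f (A.1.1 0 0) (A.1.1 1 1) (A.1.1 (Fin.last n) (Fin.last n))) (star p * q)
      else A.1.1 k 1 * imMap f (star p * q)) = h p * q - h q * p := by
    obtain ⟨h, hh⟩ := coboundary_on_line hA' (Pi.single k 1) e (Pi.single_eq_of_ne hl0.symm _)
      (by
        refine Finset.sum_eq_zero fun i _ => ?_
        by_cases hi : i = k
        · rw [show e i = 0 from Pi.single_eq_of_ne (hi ▸ hkl) _, mul_zero]
        · rw [Pi.single_eq_of_ne hi, zero_mul])
    refine ⟨h, fun p q => ?_⟩
    rw [← hh, Finset.sum_eq_single k (fun i _ hi => by rw [Pi.single_eq_of_ne hi, zero_mul])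
      (by simp), Pi.single_eq_same, one_mul, lie_torsion_on_line hn f A e he, hse]
  have T0 : actTriple f (A.1.1 0 0) (A.1.1 1 1) (A.1.1 (Fin.last n) (Fin.last n)) = 0 := by
    obtain ⟨h, hh⟩ := test1 1 h1l
    simp only [if_true] at hh
    exact (hf.actTriple _ _ _).eq_zero_of_coboundary h hh
  have hr := eq_zero_of_smul_add_stabTriple hf0 (Quaternion.re_im _) (Quaternion.re_im _) T0
  have hst : Stab f (A.1.1 0 0).im (A.1.1 1 1).im := by
    rw [actTriple, hr, zero_smul, zero_add] at T0
    exact stab_iff_stabTriple.2 T0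
  -- the line of the sum of the last coordinate vector and a multiple of the `j`-th one
  have test2 (j : Fin (n + 1)) (hj0 : j ≠ 0) (hjl : j ≠ Fin.last n) (α : ℍ[ℝ]) :
      ∃ h : ℍ[ℝ] → ℍ[ℝ], ∀ p q, imMap ((-2 * (A.1.1 (Fin.last n) j * α).re) • f) (star p * q) +
        (if j = 1 then -α * (A.1.1 (Fin.last n) 1 * imMap f (star p * q)) else 0) =
          h p * q - h q * p := by
    let v : Fin (n + 1) → ℍ[ℝ] := Pi.single (Fin.last n) 1 + Pi.single j α
    have hvl : v (Fin.last n) = 1 := by simp [v, hjl.symm]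
    have hsv : ∑ k, A.1.1 (Fin.last n) k * v k =
        A.1.1 (Fin.last n) (Fin.last n) + A.1.1 (Fin.last n) j * α := by
      simp [v, mul_add, Finset.sum_add_distrib, Pi.single_apply]
    have hT : actTriple f (A.1.1 0 0) (A.1.1 1 1)
        (A.1.1 (Fin.last n) (Fin.last n) + A.1.1 (Fin.last n) j * α) =
        (-2 * (A.1.1 (Fin.last n) j * α).re) • f := by
      have e1 : actTriple f (A.1.1 0 0) (A.1.1 1 1)
          (A.1.1 (Fin.last n) (Fin.last n) + A.1.1 (Fin.last n) j * α) =
          actTriple f (A.1.1 0 0) (A.1.1 1 1) (A.1.1 (Fin.last n) (Fin.last n)) +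
          (-2 * (A.1.1 (Fin.last n) j * α).re) • f := by
        simp only [actTriple, Quaternion.re_add]
        module
      rw [e1, T0, zero_add]
    by_cases hj : j = 1
    · obtain ⟨h, hh⟩ := coboundary_on_line hA' (Pi.single 1 1 + Pi.single (Fin.last n) (-α)) v
        (by simp [v, hj0.symm, hl0.symm])
        (by subst hj; simp [v, add_mul, Finset.sum_add_distrib, Pi.single_apply, h1l, h1l.symm])
      refine ⟨h, fun p q => ?_⟩
      rw [← hh]
      simp only [lie_torsion_on_line hn f A v hvl, hsv, hT, Pi.add_apply, add_mul,
        Finset.sum_add_distrib]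
      rw [Finset.sum_eq_single 1 (fun i _ hi => by rw [Pi.single_eq_of_ne hi, zero_mul])
        (by simp), Finset.sum_eq_single (Fin.last n)
        (fun i _ hi => by rw [Pi.single_eq_of_ne hi, zero_mul]) (by simp), Pi.single_eq_same,
        Pi.single_eq_same, if_pos rfl, if_neg h1l.symm, if_pos hj, one_mul]
    · obtain ⟨h, hh⟩ := coboundary_on_line hA' (Pi.single 1 1) v
        (by simp [v, hj0.symm, hl0.symm])
        (by simp [v, Pi.single_apply, h1l, Ne.symm hj])
      refine ⟨h, fun p q => ?_⟩
      rw [← hh]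
      simp only [lie_torsion_on_line hn f A v hvl, hsv, hT]
      rw [Finset.sum_eq_single 1 (fun i _ hi => by rw [Pi.single_eq_of_ne hi, zero_mul])
        (by simp), Pi.single_eq_same, if_pos rfl, if_neg hj, one_mul, add_zero]
  have hrow : ∀ j, j ≠ 0 → j ≠ Fin.last n → A.1.1 (Fin.last n) j = 0 := by
    intro j hj0 hjl
    obtain ⟨h, hh⟩ := test2 j hj0 hjl (star (A.1.1 (Fin.last n) j))
    have hre : (A.1.1 (Fin.last n) j * star (A.1.1 (Fin.last n) j)).re =
        Quaternion.normSq (A.1.1 (Fin.last n) j) := by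
      rw [Quaternion.self_mul_star]; rfl
    rw [hre] at hh
    set N := Quaternion.normSq (A.1.1 (Fin.last n) j) with hN
    by_cases hj : j = 1
    · have h3 : ((-3 * N) • f) = 0 := by
        refine (hf.smul _).eq_zero_of_coboundary h fun p q => ?_
        have hs : -star (A.1.1 (Fin.last n) j) * A.1.1 (Fin.last n) j = ((-N : ℝ) : ℍ[ℝ]) := by
          rw [neg_mul, Quaternion.star_mul_self, Quaternion.coe_neg]
        rw [← hh, if_pos hj, ← mul_assoc, ← hj, hs, Quaternion.coe_mul_eq_smul, imMap_smul',
          imMap_smul']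
        module
      have h4 : N = 0 := by simpa using (smul_eq_zero.1 h3).resolve_right hf0
      exact Quaternion.normSq_eq_zero.1 h4
    · have h3 : ((-2 * N) • f) = 0 := by
        refine (hf.smul _).eq_zero_of_coboundary h fun p q => ?_
        rw [← hh, if_neg hj, add_zero]
      have h4 : N = 0 := by simpa using (smul_eq_zero.1 h3).resolve_right hf0
      exact Quaternion.normSq_eq_zero.1 h4
  refine ⟨⟨fun k hk0 hk1 => ?_, hrow, hr⟩, hst⟩
  by_cases hkl : k = Fin.last n
  · rw [hkl]; exact hrow 1 h10 h1l
  · obtain ⟨h, hh⟩ := test1 k hkl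
    simp only [if_neg hk1, ← imMap_mul_left] at hh
    exact eq_zero_of_mul_triple hf0 ((hf.mul_left _).eq_zero_of_coboundary h hh)

/-- Under these conditions `A` annihilates the representing cocycle and not only its class. -/
lemma mem_ann_of_isTorsionShape {n : ℕ} (hn : 2 ≤ n) {f : Fin 3 → ℍ[ℝ]} {A : g0 n}
    (hA : IsTorsionShape A) (hst : Stab f (A.1.1 0 0).im (A.1.1 1 1).im) :
    A ∈ ann (torsionClass hn f) := by
  obtain ⟨h1, h2, h3⟩ := hA
  have hlast (x : gMinus n) : lastEntry n ⁅A, x⁆ =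
      A.1.1 (Fin.last n) (Fin.last n) * lastEntry n x - lastEntry n x * A.1.1 0 0 := by
    rw [lastEntry_apply, lie_gMinus_apply, Finset.sum_eq_single (Fin.last n)]
    · rfl
    · intro k _ hk
      by_cases hk0 : k = 0
      · rw [hk0, g0_apply_zero _ (fin_last_ne_zero hn), zero_mul]
      · rw [h2 k hk0 hk, zero_mul]
    · simp
  have hT : actTriple f (A.1.1 0 0) (A.1.1 1 1) (A.1.1 (Fin.last n) (Fin.last n)) = 0 := by
    rw [actTriple, h3, zero_smul, zero_add]
    exact stab_iff_stabTriple.1 hst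
  have hz : ⁅A, torsionCocycle hn (imForm f) (imForm_self f)⁆ = (0 : cocycles n) := by
    apply Subtype.ext
    refine bilin_eq_zero fun i j k l p q _ _ => ?_
    generalize col n (Pi.single i p) = x
    generalize col n (Pi.single j q) = y
    change ((⁅A, formCochain (fin_one_ne_zero hn) (imForm f)⁆ : Bilin n) x y).1 k l = 0
    by_cases hkl : k = 0 ∨ l ≠ 0
    · -- the values lie in `𝔤₋₁`
      rw [bilin_lie_apply]
      simp only [formCochain_apply]
      have m1 := lie_mem_gMinus A.2 (unit_mem_gMinus (fin_one_ne_zero hn)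
        (imForm f (lastEntry n x) (lastEntry n y)))
      have m2 := unit_mem_gMinus (fin_one_ne_zero hn)
        (imForm f (lastEntry n x) (lastEntry n ⁅A, y⁆))
      have m3 := unit_mem_gMinus (fin_one_ne_zero hn)
        (imForm f (lastEntry n ⁅A, x⁆) (lastEntry n y))
      exact ((gMinus n).sub_mem ((gMinus n).sub_mem m1 m2) m3) k l hkl
    · push Not at hkl
      rw [hkl.2, lie_torsion_apply hn, hlast, hlast]
      split_ifs with hk
      · rw [hk]
        have := imMap_actTriple f (A.1.1 0 0) (A.1.1 1 1) (A.1.1 (Fin.last n) (Fin.last n))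
          (lastEntry n x) (lastEntry n y)
        rw [hT] at this
        refine this.trans ?_
        simp [imMap_apply]
      · rw [h1 k hkl.1 hk, zero_mul, sub_zero]
  change ⁅A, torsionClass hn f⁆ = 0
  rw [lie_torsionClass, hz]
  exact LinearMap.map_zero (H2.mk n).toLinearMap

lemma torsionClass_ne_zero {n : ℕ} (hn : 2 ≤ n) {f : Fin 3 → ℍ[ℝ]} (hf : IsNormal f)
    (hf0 : f ≠ 0) : torsionClass hn f ≠ 0 := by
  intro h
  -- `Z'` would annihilate the class, but it acts on it by `3`
  have hm : gradingZ' n ∈ ann (torsionClass hn f) := by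
    rw [h]
    exact lie_zero _
  have h3 := (isTorsionShape_of_mem_ann hn hf hf0 hm).1.2.2
  have d (i : Fin (n + 1)) : ((gradingZ' n).1.1 i i).re =
      (if i = 1 then (1 : ℝ) else 0) - (if i = Fin.last n then 1 else 0) := by
    rw [gradingZ', diagElt_apply, if_pos rfl, Quaternion.re_coe]
  rw [d, d, d] at h3
  simp [(fin_one_ne_zero hn).symm, (fin_last_ne_zero hn).symm, fin_one_ne_last hn,
    (fin_one_ne_last hn).symm] at h3
  norm_num at h3

lemma unit_mem_g0 {n : ℕ} {k l : Fin (n + 1)} (h : k ≠ l) (hk : k ≠ 0) (hl : l ≠ 0) (p : ℍ[ℝ]) :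
    unit h p ∈ g0 n := by
  intro i _
  rw [unit_apply, unit_apply, if_neg (fun h => hl h.2), if_neg (fun h => hk h.1)]
  exact ⟨rfl, rfl⟩

/-- The quaternionic diagonal matrix with entries `d`, as an element of `𝔤₀`. -/
def qdiag {n : ℕ} (d : Fin (n + 1) → ℍ[ℝ]) (hd : ∑ i, (d i).re = 0) : g0 n :=
  ⟨⟨Matrix.diagonal d, by
    change (Matrix.trace (Matrix.diagonal d)).re = 0
    rw [Matrix.trace_diagonal, re_sum, hd]⟩,
    fun _ hi => ⟨Matrix.diagonal_apply_ne _ hi, Matrix.diagonal_apply_ne _ hi.symm⟩⟩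

lemma qdiag_apply {n : ℕ} (d : Fin (n + 1) → ℍ[ℝ]) (hd : ∑ i, (d i).re = 0) (i j : Fin (n + 1)) :
    (qdiag d hd).1.1 i j = if i = j then d i else 0 := by
  change Matrix.diagonal d i j = _
  rw [Matrix.diagonal_apply]

/-- Bracket of `𝔤₋₁` with the matrix unit in the upper right corner of `𝔤𝔩(n, ℍ)`. -/
lemma lie_unit_one_last {n : ℕ} (hn : 2 ≤ n) (x : gMinus n) (q : ℍ[ℝ]) :
    ⁅(x : slH (n + 1)), unit (fin_one_ne_last hn) q⁆ =
      unit (fin_one_ne_zero hn) (-(q * lastEntry n x)) := by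
  have hm : ⁅(x : slH (n + 1)), unit (fin_one_ne_last hn) q⁆ ∈ gMinus n := by
    rw [← lie_skew]
    exact neg_mem (lie_mem_gMinus (unit_mem_g0 _ (fin_one_ne_zero hn) (fin_last_ne_zero hn) q) x.2)
  refine congrArg Subtype.val (gMinus_ext (x := ⟨_, hm⟩)
    (y := ⟨_, unit_mem_gMinus (fin_one_ne_zero hn) _⟩) fun k _ => ?_)
  change (⁅(x : slH (n + 1)), unit (fin_one_ne_last hn) q⁆ : slH (n + 1)).1 k 0 = _
  rw [gMinus_lie_apply_zero, unit_apply, if_neg (fun h => fin_one_ne_zero hn h.1), mul_zero,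
    zero_sub, unit_apply]
  by_cases hk : 1 = k
  · subst hk
    rw [Finset.sum_eq_single (Fin.last n)]
    · simp [unit_apply, lastEntry_apply]
    · intro i _ hi
      rw [unit_apply, if_neg (fun h => hi h.2.symm), zero_mul]
    · simp
  · rw [if_neg (fun h => hk h.1), Finset.sum_eq_zero, neg_zero]
    intro i _
    rw [unit_apply, if_neg (fun h => hk h.1), zero_mul]

/-- The class of every torsion cocycle concentrated in the last coordinate has a normal form. -/
lemma mk_torsionCocycle {n : ℕ} (hn : 2 ≤ n) (ψ : ℍ[ℝ] →ₗ[ℝ] ℍ[ℝ] →ₗ[ℝ] ℍ[ℝ])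
    (hψ : ∀ p, ψ p p = 0) :
    ∃ f, IsNormal f ∧ H2.mk n (torsionCocycle hn ψ hψ) = torsionClass hn f := by
  obtain ⟨f, hf, g, hg⟩ := exists_normal_form ψ hψ
  refine ⟨f, hf, ?_⟩
  rw [torsionClass, ← sub_eq_zero, ← mk_sub, mk_eq_zero, mem_coboundaries_iff]
  refine ⟨(unit (fin_one_ne_last hn)).comp (g.comp (lastEntry n)), fun x y => ?_⟩
  change unit (fin_one_ne_zero hn) (ψ (lastEntry n x) (lastEntry n y)) -
    unit (fin_one_ne_zero hn) (imForm f (lastEntry n x) (lastEntry n y)) =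
    ⁅(x : slH (n + 1)), unit (fin_one_ne_last hn) (g (lastEntry n y))⁆ -
      ⁅(y : slH (n + 1)), unit (fin_one_ne_last hn) (g (lastEntry n x))⁆
  rw [lie_unit_one_last hn, lie_unit_one_last hn, ← map_sub, ← map_sub, hg, imForm_apply]
  congr 1
  abel

lemma diagWeight_Z {n : ℕ} (i j a b : Fin (n + 1)) (hi : i ≠ 0) (hj : j ≠ 0) :
    diagWeight (fun i => if i = 0 then (n : ℝ) / (n + 1) else -1 / (n + 1)) (i, j) (a, b) =
      (if a = 0 then (1 : ℝ) else 0) - (if b = 0 then 1 else 0) + 2 := by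
  rw [funext (gradingZ_entry (n := n)), diagWeight]
  simp only [if_true, if_neg hi, if_neg hj]
  ring

lemma mk_eigen {n : ℕ} {A : g0 n} {c : cocycles n} {t : ℝ} (h : ⁅A, c.1⁆ = t • c.1) :
    ⁅A, H2.mk n c⁆ = t • H2.mk n c := by
  have h' : ⁅A, c⁆ = t • c := Subtype.ext h
  rw [← mk_lie, ← mk_smul, h']

lemma gradingZ_lie_torsion {n : ℕ} (hn : 2 ≤ n) (ψ : ℍ[ℝ] →ₗ[ℝ] ℍ[ℝ] →ₗ[ℝ] ℍ[ℝ]) :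
    ⁅gradingZ n, formCochain (fin_one_ne_zero hn) ψ⁆ =
      ((1 : ℕ) : ℝ) • formCochain (fin_one_ne_zero hn) ψ := by
  rw [gradingZ, diagElt_lie_formCochain hn, diagWeight_Z _ _ _ _ (fin_last_ne_zero hn)
    (fin_last_ne_zero hn), if_neg (fin_one_ne_zero hn), if_pos rfl,
    show (0 : ℝ) - 1 + 2 = ((1 : ℕ) : ℝ) by norm_num]

lemma gradingZ'_lie_torsion {n : ℕ} (hn : 2 ≤ n) (ψ : ℍ[ℝ] →ₗ[ℝ] ℍ[ℝ] →ₗ[ℝ] ℍ[ℝ]) :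
    ⁅gradingZ' n, formCochain (fin_one_ne_zero hn) ψ⁆ =
      (3 : ℝ) • formCochain (fin_one_ne_zero hn) ψ := by
  rw [gradingZ', diagElt_lie_formCochain hn, diagWeight_Z' hn, if_neg (fin_one_ne_zero hn).symm,
    if_neg (fin_last_ne_zero hn).symm, if_neg (fin_one_ne_last hn).symm,
    if_neg (fin_one_ne_last hn), if_pos rfl, if_pos rfl,
    show (1 : ℝ) - 0 - (0 - 0) - (0 - 1) - (0 - 1) = 3 by norm_num]

lemma torsionClass_mem {n : ℕ} (hn : 2 ≤ n) (f : Fin 3 → ℍ[ℝ]) :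
    torsionClass hn f ∈ H2hom n 1 :=
  mem_H2hom_iff.2 (mk_eigen (gradingZ_lie_torsion hn _))

lemma torsionClass_eigen {n : ℕ} (hn : 2 ≤ n) (f : Fin 3 → ℍ[ℝ]) :
    ⁅gradingZ' n, torsionClass hn f⁆ = (3 : ℝ) • torsionClass hn f :=
  mk_eigen (gradingZ'_lie_torsion hn _)

/-- Eigenclasses of `Z'` in `H²₁` with eigenvalue at least `3` have eigenvalue `3` and are torsion
classes of normal maps. -/
lemma exists_torsionClass {n : ℕ} (hn : 2 ≤ n) {w : H2 n} (hw : w ≠ 0) (h1 : w ∈ H2hom n 1) {θ : ℝ}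
    (hθ : 3 ≤ θ) (h2 : ⁅gradingZ' n, w⁆ = θ • w) :
    θ = 3 ∧ ∃ f, IsNormal f ∧ f ≠ 0 ∧ w = torsionClass hn f := by
  obtain ⟨c, rfl, hc⟩ := exists_weight_cocycle h1 h2
  constructor
  · by_contra h3
    apply hw
    have : c = 0 := by
      apply Subtype.ext
      refine bilin_eq_zero fun i j a b p q hi hj => ?_
      by_contra hne
      obtain ⟨g1, g2⟩ := hc i j a b p q hi hj hne
      exact h3 (torsion_weight_le hn (by simpa using g1) hθ g2).1
    rw [this]
    exact LinearMap.map_zero (H2.mk n).toLinearMap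
  · obtain ⟨ψ, hψ, e⟩ := eq_formCochain hn (fin_one_ne_zero hn) c.1 (fun i j a b p q hi hj hne => by
      by_contra h0
      obtain ⟨g1, g2⟩ := hc i j a b p q hi hj h0
      exact hne (torsion_weight_le hn (by simpa using g1) hθ g2).2) (cocycle_alt c)
    have hcc : c = torsionCocycle hn ψ hψ := Subtype.ext e
    obtain ⟨f, hf, hfw⟩ := mk_torsionCocycle hn ψ hψ
    refine ⟨f, hf, ?_, by rw [hcc, hfw]⟩
    rintro rfl
    apply hw
    rw [hcc, hfw, torsionClass, mk_eq_zero, mem_coboundaries_iff]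
    refine ⟨0, fun x y => ?_⟩
    change unit (fin_one_ne_zero hn) (imForm 0 (lastEntry n x) (lastEntry n y)) = ⁅(x : slH (n + 1)), (0 : slH (n + 1))⁆ -
      ⁅(y : slH (n + 1)), (0 : slH (n + 1))⁆
    rw [lie_zero, lie_zero, sub_zero, imForm_apply]
    simp [imMap_apply]

lemma isExtremal_torsionClass {n : ℕ} (hn : 2 ≤ n) {f : Fin 3 → ℍ[ℝ]} (hf : IsNormal f)
    (hf0 : f ≠ 0) : IsExtremal 1 (torsionClass hn f) := by
  refine ⟨torsionClass_ne_zero hn hf hf0, torsionClass_mem hn f, 3, torsionClass_eigen hn f,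
    fun w' h1 hw' θ' h2 => ?_⟩
  by_contra hlt
  exact hlt (exists_torsionClass hn hw' h1 (not_le.1 hlt).le h2).1.le

/-- The values at `i, j, k` of a normal map stabilised by `(i, 3i)`. -/
def stableTriple : Fin 3 → ℍ[ℝ] := ![0, 1, qi]

lemma stableTriple_normal : IsNormal stableTriple := by
  rw [IsNormal]
  simp [stableTriple, qi_mul_qk]

lemma stableTriple_ne_zero : stableTriple ≠ 0 := by
  intro h
  have := congrFun h 1
  simp [stableTriple] at this

lemma stableTriple_stab : Stab stableTriple qi ((3 : ℝ) • qi) := by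
  intro ξ
  simp only [stabMap, imMap_apply, stableTriple, Matrix.cons_val_zero, Matrix.cons_val_one,
    Matrix.cons_val]
  ext <;> simp <;> ring

lemma exists_of_isExtremal_one {n : ℕ} (hn : 2 ≤ n) {w : H2 n} (hw : IsExtremal 1 w) :
    ∃ f, IsNormal f ∧ f ≠ 0 ∧ w = torsionClass hn f := by
  obtain ⟨h0, h1, θ, h2, h3⟩ := hw
  exact (exists_torsionClass hn h0 h1 (h3 _ (torsionClass_mem hn stableTriple)
    (torsionClass_ne_zero hn stableTriple_normal stableTriple_ne_zero) 3
    (torsionClass_eigen hn stableTriple)) h2).2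

/-! ### Largest annihilators -/

instance (m : ℕ) : Module.Finite ℝ (slH m) :=
  inferInstanceAs (Module.Finite ℝ (slH m).toSubmodule)

instance (n : ℕ) : Module.Finite ℝ (g0 n) :=
  inferInstanceAs (Module.Finite ℝ (g0 n).toSubmodule)

instance {n : ℕ} (w : H2 n) : Module.Finite ℝ (ann w) :=
  inferInstanceAs (Module.Finite ℝ (ann w).toSubmodule)

/-- The dimensions of annihilators are bounded by `dim 𝔤₀`, hence attain a maximum. -/
lemma exists_hasLargestAnn {n k : ℕ} (h : ∃ w : H2 n, IsExtremal k w) :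
    ∃ w : H2 n, HasLargestAnn k w := by
  let S : Set ℕ := {m | ∃ w : H2 n, IsExtremal k w ∧ Module.finrank ℝ (ann w) = m}
  have hS : S.Nonempty := by
    obtain ⟨w, hw⟩ := h
    exact ⟨_, w, hw, rfl⟩
  have hb : BddAbove S := by
    refine ⟨Module.finrank ℝ (g0 n), ?_⟩
    rintro _ ⟨w, _, rfl⟩
    exact Submodule.finrank_le (ann w).toSubmodule
  obtain ⟨w, hw, hm⟩ := Nat.sSup_mem hS hb
  refine ⟨w, hw, fun w' hw' => ?_⟩
  rw [hm]
  exact le_csSup hb ⟨w', hw', rfl⟩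

/-- A largest annihilator belongs to a class that is stabilised by a line of
`𝔰𝔭(1) ⊕ 𝔰𝔭(1)_left`: otherwise it would be properly contained in the annihilator of the class of
`stableTriple`. -/
lemma ann_of_hasLargestAnn {n : ℕ} (hn : 2 ≤ n) {w : H2 n} (hw : HasLargestAnn 1 w) :
    ∃ u ∈ sp1, ∃ v ∈ sp1, u ≠ 0 ∧ v ≠ 0 ∧ ∀ A : g0 n, A ∈ ann w ↔
      IsTorsionShape A ∧ ∃ t : ℝ, (A.1.1 0 0).im = t • u ∧ (A.1.1 1 1).im = t • v := by
  obtain ⟨hex, hmax⟩ := hw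
  obtain ⟨f, hf, hf0, rfl⟩ := exists_of_isExtremal_one hn hex
  have hmem (A : g0 n) : A ∈ ann (torsionClass hn f) ↔
      IsTorsionShape A ∧ Stab f (A.1.1 0 0).im (A.1.1 1 1).im :=
    ⟨isTorsionShape_of_mem_ann hn hf hf0, fun h => mem_ann_of_isTorsionShape hn h.1 h.2⟩
  have hmem' (A : g0 n) : A ∈ ann (torsionClass hn stableTriple) ↔
      IsTorsionShape A ∧ Stab stableTriple (A.1.1 0 0).im (A.1.1 1 1).im :=
    ⟨isTorsionShape_of_mem_ann hn stableTriple_normal stableTriple_ne_zero,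
      fun h => mem_ann_of_isTorsionShape hn h.1 h.2⟩
  obtain ⟨u, v, hu, hv, hu0, hst⟩ : ∃ u v, u.re = 0 ∧ v.re = 0 ∧ u ≠ 0 ∧ Stab f u v := by
    by_contra hno
    push Not at hno
    have hlt : (ann (torsionClass hn f)).toSubmodule <
        (ann (torsionClass hn stableTriple)).toSubmodule := by
      refine lt_of_le_of_ne (fun A hA => ?_) fun heq => ?_
      · obtain ⟨h1, h2⟩ := (hmem A).1 hA
        refine (hmem' A).2 ⟨h1, ?_⟩
        have hu0 : (A.1.1 0 0).im = 0 := by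
          by_contra hu
          exact hno _ _ (Quaternion.re_im _) (Quaternion.re_im _) hu h2
        rw [hu0] at h2 ⊢
        rw [h2.eq_zero_of_left hf0]
        intro ξ
        simp [stabMap]
      · let d : Fin (n + 1) → ℍ[ℝ] := Pi.single 0 qi + Pi.single 1 ((3 : ℝ) • qi)
        have hd : ∑ i, (d i).re = 0 := by
          refine Finset.sum_eq_zero fun i _ => ?_
          simp only [d, Pi.add_apply, Pi.single_apply]
          split_ifs <;> simp
        have h10 := fin_one_ne_zero hn
        have d0 : d 0 = qi := by simp [d, h10.symm]
        have d1 : d 1 = (3 : ℝ) • qi := by simp [d, h10]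
        have dl : d (Fin.last n) = 0 := by
          simp [d, fin_last_ne_zero hn, (fin_one_ne_last hn).symm]
        have hA : qdiag d hd ∈ ann (torsionClass hn stableTriple) := by
          refine (hmem' _).2 ⟨⟨fun k _ hk => ?_, fun j _ hj => ?_, ?_⟩, ?_⟩
          · rw [qdiag_apply, if_neg hk]
          · rw [qdiag_apply, if_neg hj.symm]
          · simp [qdiag_apply, d0, d1, dl]
          · rw [qdiag_apply, qdiag_apply, if_pos rfl, if_pos rfl, d0, d1]
            convert stableTriple_stab using 1 <;> ext <;> simp
        have hA' : qdiag d hd ∈ ann (torsionClass hn f) := by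
          change qdiag d hd ∈ (ann (torsionClass hn f)).toSubmodule
          rw [heq]
          exact hA
        refine hno _ _ (Quaternion.re_im _) (Quaternion.re_im _) ?_ ((hmem _).1 hA').2
        rw [qdiag_apply, if_pos rfl, d0]
        intro h
        simpa using congrArg QuaternionAlgebra.imI h
    exact absurd (Submodule.finrank_lt_finrank_of_lt hlt) (not_lt.2
      (hmax _ (isExtremal_torsionClass hn stableTriple_normal stableTriple_ne_zero)))
  refine ⟨u, hu, v, hv, hu0, ?_, fun A => ?_⟩
  · rintro rfl
    exact hu0 (hst.eq_zero_of_right hf0 hu)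
  · rw [hmem]
    refine and_congr_right fun _ => ⟨fun h => ?_, ?_⟩
    · exact hst.proportional hf hf0 hu (Quaternion.re_im _) hu0 h
    · rintro ⟨t, h1, h2⟩
      rw [h1, h2]
      exact hst.smul t

/-! ### The curvature module -/

/-- The algebraic Bianchi identity for a form on `ℍ`. -/
def IsBianchi (ψ : ℍ[ℝ] →ₗ[ℝ] ℍ[ℝ] →ₗ[ℝ] ℍ[ℝ]) : Prop :=
  ∀ x y z, ψ x y * z + ψ y z * x + ψ z x * y = 0

/-- The differential of a curvature cochain. -/
lemma curvature_closed {n : ℕ} (hn : 2 ≤ n) (ψ : ℍ[ℝ] →ₗ[ℝ] ℍ[ℝ] →ₗ[ℝ] ℍ[ℝ]) (x y z : gMinus n) :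
    ⁅(x : slH (n + 1)), formCochain (fin_one_ne_last hn) ψ y z⁆ -
      ⁅(y : slH (n + 1)), formCochain (fin_one_ne_last hn) ψ x z⁆ +
      ⁅(z : slH (n + 1)), formCochain (fin_one_ne_last hn) ψ x y⁆ =
    unit (fin_one_ne_zero hn) (-(ψ (lastEntry n y) (lastEntry n z) * lastEntry n x -
      ψ (lastEntry n x) (lastEntry n z) * lastEntry n y +
      ψ (lastEntry n x) (lastEntry n y) * lastEntry n z)) := by
  simp only [formCochain_apply]
  rw [lie_unit_one_last hn, lie_unit_one_last hn, lie_unit_one_last hn, ← map_sub, ← map_add]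
  congr 1
  abel

/-- The curvature cocycle with values in the upper right corner of `𝔤𝔩(n, ℍ)` given by an
alternating form in the last coordinate that satisfies the Bianchi identity. -/
def curvatureCocycle {n : ℕ} (hn : 2 ≤ n) (ψ : ℍ[ℝ] →ₗ[ℝ] ℍ[ℝ] →ₗ[ℝ] ℍ[ℝ]) (hψ : ∀ p, ψ p p = 0)
    (hb : IsBianchi ψ) : cocycles n :=
  ⟨formCochain (fin_one_ne_last hn) ψ, mem_cocycles
    (fun x => by rw [formCochain_apply, hψ, map_zero])
    (fun x y z => by
      rw [curvature_closed hn, form_skew hψ (lastEntry n x) (lastEntry n z)]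
      have := hb (lastEntry n x) (lastEntry n y) (lastEntry n z)
      rw [← map_zero (unit (fin_one_ne_zero hn))]
      congr 1
      linear_combination (norm := noncomm_ring) -this)⟩

lemma gradingZ_lie_curvature {n : ℕ} (hn : 2 ≤ n) (ψ : ℍ[ℝ] →ₗ[ℝ] ℍ[ℝ] →ₗ[ℝ] ℍ[ℝ]) :
    ⁅gradingZ n, formCochain (fin_one_ne_last hn) ψ⁆ =
      ((2 : ℕ) : ℝ) • formCochain (fin_one_ne_last hn) ψ := by
  rw [gradingZ, diagElt_lie_formCochain hn, diagWeight_Z _ _ _ _ (fin_last_ne_zero hn)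
    (fin_last_ne_zero hn), if_neg (fin_one_ne_zero hn), if_neg (fin_last_ne_zero hn),
    show (0 : ℝ) - 0 + 2 = ((2 : ℕ) : ℝ) by norm_num]

lemma gradingZ'_lie_curvature {n : ℕ} (hn : 2 ≤ n) (ψ : ℍ[ℝ] →ₗ[ℝ] ℍ[ℝ] →ₗ[ℝ] ℍ[ℝ]) :
    ⁅gradingZ' n, formCochain (fin_one_ne_last hn) ψ⁆ =
      (4 : ℝ) • formCochain (fin_one_ne_last hn) ψ := by
  rw [gradingZ', diagElt_lie_formCochain hn, diagWeight_Z' hn, if_neg (fin_one_ne_last hn).symm,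
    if_neg (fin_one_ne_last hn), if_pos rfl, if_pos rfl,
    show (1 : ℝ) - 0 - (0 - 1) - (0 - 1) - (0 - 1) = 4 by norm_num]

/-- No coboundary has a component of the largest `Z'`-weight in homogeneity two. -/
lemma curvatureCocycle_not_coboundary {n : ℕ} (hn : 2 ≤ n) {ψ : ℍ[ℝ] →ₗ[ℝ] ℍ[ℝ] →ₗ[ℝ] ℍ[ℝ]}
    {hψ : ∀ p, ψ p p = 0} {hb : IsBianchi ψ}
    (h : curvatureCocycle hn ψ hψ hb ∈ coboundaries n) (p q : ℍ[ℝ]) : ψ p q = 0 := by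
  obtain ⟨F, hF⟩ := (mem_coboundaries_iff _).1 h
  have hz (p : ℍ[ℝ]) (Y : slH (n + 1)) :
      (⁅(col n (Pi.single (Fin.last n) p) : slH (n + 1)), Y⁆ : slH (n + 1)).1 1 (Fin.last n) = 0 := by
    rw [slH_lie_apply, Finset.sum_eq_zero, Finset.sum_eq_zero, sub_zero]
    · intro i _
      rw [col_apply, if_neg (fun h => fin_last_ne_zero hn h.2), mul_zero]
    · intro i _
      rw [col_apply]
      split_ifs
      · rw [Pi.single_eq_of_ne (fin_one_ne_last hn), zero_mul]
      · rw [zero_mul]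
  have h1 := congrArg (fun X : slH (n + 1) => X.1 1 (Fin.last n))
    (hF (col n (Pi.single (Fin.last n) p)) (col n (Pi.single (Fin.last n) q)))
  have h2 := (formCochain_single hn (fin_one_ne_last hn) ψ (Fin.last n) (Fin.last n) 1 (Fin.last n)
    p q).symm.trans h1
  rw [if_pos ⟨rfl, rfl, rfl, rfl⟩] at h2
  rw [h2]
  change (⁅(col n (Pi.single (Fin.last n) p) : slH (n + 1)), _⁆ : slH (n + 1)).1 1 (Fin.last n) -
    (⁅(col n (Pi.single (Fin.last n) q) : slH (n + 1)), _⁆ : slH (n + 1)).1 1 (Fin.last n) = 0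
  rw [hz, hz, sub_zero]

/-- A nonzero alternating form on `ℍ` that satisfies the Bianchi identity. -/
def bianchiForm : ℍ[ℝ] →ₗ[ℝ] ℍ[ℝ] →ₗ[ℝ] ℍ[ℝ] :=
  LinearMap.mk₂ ℝ (fun p q => (p.re * q.imI - p.imI * q.re + (p.imJ * q.imK - p.imK * q.imJ)) • 1 -
      (p.re * q.imK - p.imK * q.re + (p.imI * q.imJ - p.imJ * q.imI)) • qj)
    (fun _ _ _ => by ext <;> simp <;> ring) (fun _ _ _ => by ext <;> simp <;> ring)
    (fun _ _ _ => by ext <;> simp <;> ring) (fun _ _ _ => by ext <;> simp <;> ring)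

lemma bianchiForm_apply (p q : ℍ[ℝ]) : bianchiForm p q =
    (p.re * q.imI - p.imI * q.re + (p.imJ * q.imK - p.imK * q.imJ)) • 1 -
      (p.re * q.imK - p.imK * q.re + (p.imI * q.imJ - p.imJ * q.imI)) • qj := rfl

lemma bianchiForm_self (p : ℍ[ℝ]) : bianchiForm p p = 0 := by
  rw [bianchiForm_apply]
  ext <;> simp <;> ring

lemma isBianchi_bianchiForm : IsBianchi bianchiForm := by
  intro x y z
  simp only [bianchiForm_apply]
  ext <;> simp <;> ring

lemma bianchiForm_ne_zero : bianchiForm 1 qi ≠ 0 := by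
  rw [bianchiForm_apply]
  intro h
  simpa using congrArg QuaternionAlgebra.re h

/-- Eigenclasses of `Z'` in `H²₂` with eigenvalue at least `4` have eigenvalue `4` and are classes
of curvature cocycles. -/
lemma exists_curvatureCocycle {n : ℕ} (hn : 2 ≤ n) {w : H2 n} (hw : w ≠ 0) (h1 : w ∈ H2hom n 2)
    {θ : ℝ} (hθ : 4 ≤ θ) (h2 : ⁅gradingZ' n, w⁆ = θ • w) :
    θ = 4 ∧ ∃ ψ, ∃ hψ : ∀ p, ψ p p = 0, ∃ hb : IsBianchi ψ,
      w = H2.mk n (curvatureCocycle hn ψ hψ hb) := by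
  obtain ⟨c, rfl, hc⟩ := exists_weight_cocycle h1 h2
  constructor
  · by_contra h3
    apply hw
    have : c = 0 := by
      apply Subtype.ext
      refine bilin_eq_zero fun i j a b p q hi hj => ?_
      by_contra hne
      exact h3 (curvature_weight_le hn hθ (hc i j a b p q hi hj hne).2).1
    rw [this]
    exact LinearMap.map_zero (H2.mk n).toLinearMap
  · obtain ⟨ψ, hψ, e⟩ := eq_formCochain hn (fin_one_ne_last hn) c.1 (fun i j a b p q hi hj hne => by
      by_contra h0
      exact hne (curvature_weight_le hn hθ (hc i j a b p q hi hj h0).2).2) (cocycle_alt c)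
    have hb : IsBianchi ψ := by
      intro x y z
      have h3 := cocycle_closed c (col n (Pi.single (Fin.last n) x))
        (col n (Pi.single (Fin.last n) y)) (col n (Pi.single (Fin.last n) z))
      rw [e, curvature_closed hn] at h3
      simp only [lastEntry_col hn, Pi.single_eq_same] at h3
      have h4 := congrArg (fun X : slH (n + 1) => X.1 1 0) h3
      simp only [unit_apply, and_self, if_true] at h4
      have h5 : -(ψ y z * x - ψ x z * y + ψ x y * z) = 0 := h4
      rw [form_skew hψ x z] at h5
      linear_combination (norm := noncomm_ring) -h5
    exact ⟨ψ, hψ, hb, congrArg (H2.mk n) (Subtype.ext e)⟩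

/-- Coboundaries do not reach the weight `4`, so that nonzero Bianchi forms give nonzero classes. -/
lemma isExtremal_curvature {n : ℕ} (hn : 2 ≤ n) : IsExtremal 2
    (H2.mk n (curvatureCocycle hn bianchiForm bianchiForm_self isBianchi_bianchiForm)) := by
  refine ⟨fun h => ?_, mem_H2hom_iff.2 (mk_eigen (gradingZ_lie_curvature hn _)), 4,
    mk_eigen (gradingZ'_lie_curvature hn _), fun w' h1 hw' θ' h2 => ?_⟩
  · exact bianchiForm_ne_zero (curvatureCocycle_not_coboundary hn (mk_eq_zero.1 h) _ _)
  · by_contra hlt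
    exact hlt (exists_curvatureCocycle hn hw' h1 (not_le.1 hlt).le h2).1.le

lemma exists_of_isExtremal_two {n : ℕ} (hn : 2 ≤ n) {w : H2 n} (hw : IsExtremal 2 w) :
    ∃ ψ, ∃ hψ : ∀ p, ψ p p = 0, ∃ hb : IsBianchi ψ,
      w = H2.mk n (curvatureCocycle hn ψ hψ hb) := by
  obtain ⟨h0, h1, θ, h2, h3⟩ := hw
  obtain ⟨e0, e1, -⟩ := isExtremal_curvature hn
  exact (exists_curvatureCocycle hn h0 h1
    (h3 _ e1 e0 4 (mk_eigen (gradingZ'_lie_curvature hn _))) h2).2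

/-- The element of the summand `𝔰𝔭(1)` of `𝔤₀` given by an imaginary quaternion. -/
def spElt (n : ℕ) (p : sp1) : g0 n :=
  qdiag (Pi.single 0 p.1) (by
    refine Finset.sum_eq_zero fun i _ => ?_
    rw [Pi.single_apply]
    split_ifs
    · exact p.2
    · rfl)

lemma spElt_apply {n : ℕ} (p : sp1) (i j : Fin (n + 1)) :
    (spElt n p).1.1 i j = if i = 0 ∧ j = 0 then p.1 else 0 := by
  rw [spElt, qdiag_apply]
  by_cases hi : i = 0
  · subst hi
    by_cases hj : j = 0
    · simp [hj]
    · simp [hj, Ne.symm hj]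
  · simp [hi]

/-- The summand `𝔰𝔭(1)` acts trivially on the extremal elements of the curvature module. -/
lemma spElt_mem_ann {n : ℕ} (hn : 2 ≤ n) {w : H2 n} (hw : IsExtremal 2 w) (p : sp1) :
    spElt n p ∈ ann w := by
  obtain ⟨ψ, hψ, hb, rfl⟩ := exists_of_isExtremal_two hn hw
  have hlast (x : gMinus n) : lastEntry n ⁅spElt n p, x⁆ = -(lastEntry n x * p.1) := by
    rw [lastEntry_apply, lie_gMinus_apply, Finset.sum_eq_zero, zero_sub, spElt_apply,
      if_pos ⟨rfl, rfl⟩]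
    · rfl
    · intro k _
      rw [spElt_apply, if_neg (fun h => fin_last_ne_zero hn h.1), zero_mul]
  have hunit (q : ℍ[ℝ]) : ⁅(spElt n p : slH (n + 1)), unit (fin_one_ne_last hn) q⁆ = 0 := by
    refine slH_ext fun k l => ?_
    rw [slH_lie_apply, Finset.sum_eq_zero, Finset.sum_eq_zero, sub_zero]
    · rfl
    · intro i _
      rw [spElt_apply, unit_apply]
      split_ifs with h1 h2
      · exact absurd (h1.2.trans h2.1) (fin_last_ne_zero hn)
      all_goals simp
    · intro i _
      rw [spElt_apply, unit_apply]
      split_ifs with h1 h2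
      · exact absurd (h2.1.trans h1.2) (fin_one_ne_zero hn)
      all_goals simp
  have hz : ⁅spElt n p, (curvatureCocycle hn ψ hψ hb).1⁆ = (0 : ℝ) •
      (curvatureCocycle hn ψ hψ hb).1 := by
    rw [zero_smul]
    refine LinearMap.ext fun x => LinearMap.ext fun y => ?_
    rw [bilin_lie_apply]
    change ⁅(spElt n p : slH (n + 1)), unit (fin_one_ne_last hn) _⁆ -
      unit (fin_one_ne_last hn) (ψ (lastEntry n x) (lastEntry n ⁅spElt n p, y⁆)) -
      unit (fin_one_ne_last hn) (ψ (lastEntry n ⁅spElt n p, x⁆) (lastEntry n y)) = 0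
    rw [hunit, zero_sub, ← map_neg, ← map_sub, hlast, hlast, map_neg, map_neg, LinearMap.neg_apply,
      ← map_zero (unit (fin_one_ne_last hn))]
    congr 1
    have := bianchi_invariant ψ hψ hb p.2 (lastEntry n x) (lastEntry n y)
    linear_combination (norm := abel) this
  change ⁅spElt n p, H2.mk n (curvatureCocycle hn ψ hψ hb)⁆ = 0
  rw [mk_eigen hz, zero_smul]

/-! ### Block diagonal matrices and the Levi factor -/

/-- The indices `0, …, n` are split into the blocks `{0}`, `{1}`, `{2, …, n-1}`, `{n}`. -/
lemma eq_mid_or {n : ℕ} (hn : 2 ≤ n) (k : Fin (n + 1)) :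
    k = 0 ∨ k = 1 ∨ (∃ m, k = mid n m) ∨ k = Fin.last n := by
  by_cases h0 : k = 0
  · exact Or.inl h0
  by_cases h1 : k = 1
  · exact Or.inr (Or.inl h1)
  by_cases hl : k = Fin.last n
  · exact Or.inr (Or.inr (Or.inr hl))
  have h0' : k.val ≠ 0 := fun h => h0 (Fin.ext h)
  have h1' : k.val ≠ 1 := fun h => h1 (Fin.ext (h.trans (fin_one_val hn).symm))
  have hl' : k.val ≠ n := fun h => hl (Fin.ext h)
  have hk := k.isLt
  exact Or.inr (Or.inr (Or.inl ⟨⟨k.val - 2, by omega⟩, Fin.ext (by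
    change k.val = k.val - 2 + 2
    omega)⟩))

lemma sum_eq_mid {n : ℕ} (hn : 2 ≤ n) {M : Type*} [AddCommMonoid M] (f : Fin (n + 1) → M) :
    ∑ k, f k = f 0 + (f 1 + (∑ m, f (mid n m) + f (Fin.last n))) := by
  obtain ⟨m, rfl⟩ := Nat.exists_eq_add_of_le' hn
  rw [Fin.sum_univ_succ, Fin.sum_univ_succ, Fin.sum_univ_castSucc]
  rfl

lemma mid_val {n : ℕ} (k : Fin (n - 2)) : (mid n k).val = k.val + 2 := rfl

lemma mid_inj {n : ℕ} {k l : Fin (n - 2)} : mid n k = mid n l ↔ k = l := by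
  simp [Fin.ext_iff, mid_val]

lemma mid_ne_zero {n : ℕ} (k : Fin (n - 2)) : mid n k ≠ 0 := by
  simp [Fin.ext_iff, mid_val]

lemma mid_ne_one {n : ℕ} (hn : 2 ≤ n) (k : Fin (n - 2)) : mid n k ≠ 1 := by
  rw [Ne, Fin.ext_iff, mid_val, fin_one_val hn]
  omega

lemma mid_ne_last {n : ℕ} (k : Fin (n - 2)) : mid n k ≠ Fin.last n := by
  rw [Ne, Fin.ext_iff, mid_val, Fin.val_last]
  omega

/-- The block diagonal matrix with the blocks `a`, `b`, `M`, `d` at the indices `{0}`, `{1}`,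
`{2, …, n-1}`, `{n}`. -/
def blocks (n : ℕ) (a b : ℍ[ℝ]) (M : Matrix (Fin (n - 2)) (Fin (n - 2)) ℍ[ℝ]) (d : ℍ[ℝ]) :
    Matrix (Fin (n + 1)) (Fin (n + 1)) ℍ[ℝ] :=
  Matrix.single 0 0 a + Matrix.single 1 1 b + (∑ i, ∑ j, Matrix.single (mid n i) (mid n j) (M i j)) +
    Matrix.single (Fin.last n) (Fin.last n) d

lemma sum_single_mid_apply {n : ℕ} (M : Matrix (Fin (n - 2)) (Fin (n - 2)) ℍ[ℝ])
    (i j : Fin (n + 1)) :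
    (∑ k, ∑ l, Matrix.single (mid n k) (mid n l) (M k l)) i j =
      ∑ k, ∑ l, if mid n k = i ∧ mid n l = j then M k l else 0 := by
  simp only [Matrix.sum_apply, Matrix.single_apply]

lemma blocks_apply {n : ℕ} (a b : ℍ[ℝ]) (M : Matrix (Fin (n - 2)) (Fin (n - 2)) ℍ[ℝ]) (d : ℍ[ℝ])
    (i j : Fin (n + 1)) :
    blocks n a b M d i j = (if 0 = i ∧ 0 = j then a else 0) + (if 1 = i ∧ 1 = j then b else 0) +
      (∑ k, ∑ l, if mid n k = i ∧ mid n l = j then M k l else 0) +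
      (if Fin.last n = i ∧ Fin.last n = j then d else 0) := by
  rw [blocks, Matrix.add_apply, Matrix.add_apply, Matrix.add_apply, sum_single_mid_apply,
    Matrix.single_apply, Matrix.single_apply, Matrix.single_apply]

/-- A matrix is block diagonal as soon as the off-diagonal entries with an index among `0`, `1`, `n`
vanish. -/
lemma eq_blocks {n : ℕ} (hn : 2 ≤ n) {X : Matrix (Fin (n + 1)) (Fin (n + 1)) ℍ[ℝ]} {a b : ℍ[ℝ]}
    {M : Matrix (Fin (n - 2)) (Fin (n - 2)) ℍ[ℝ]} {d : ℍ[ℝ]} (h0 : X 0 0 = a) (h1 : X 1 1 = b)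
    (hm : ∀ i j, X (mid n i) (mid n j) = M i j) (hl : X (Fin.last n) (Fin.last n) = d)
    (z0 : ∀ i, i ≠ 0 → X i 0 = 0 ∧ X 0 i = 0) (z1 : ∀ i, i ≠ 1 → X i 1 = 0 ∧ X 1 i = 0)
    (zl : ∀ i, i ≠ Fin.last n → X i (Fin.last n) = 0 ∧ X (Fin.last n) i = 0) :
    X = blocks n a b M d := by
  have n1 := fin_one_ne_zero hn
  have n2 := fin_last_ne_zero hn
  have n3 := fin_one_ne_last hn
  have m0 := fun k : Fin (n - 2) => (mid_ne_zero k).symm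
  have m1 := fun k : Fin (n - 2) => (mid_ne_one hn k).symm
  have ml := fun k : Fin (n - 2) => (mid_ne_last k).symm
  ext1 i j
  rw [blocks_apply]
  rcases eq_mid_or hn i with rfl | rfl | ⟨i, rfl⟩ | rfl <;>
  rcases eq_mid_or hn j with rfl | rfl | ⟨j, rfl⟩ | rfl <;>
  simp [n1, n2, n3, n1.symm, n2.symm, n3.symm, mid_ne_zero, mid_ne_one hn, mid_ne_last, m0, m1, ml,
    mid_inj, ite_and, h0, h1, hl, hm, z0, z1, zl]

/-- The entries of a block diagonal matrix. -/
lemma blocks_entries {n : ℕ} (hn : 2 ≤ n) (a b : ℍ[ℝ])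
    (M : Matrix (Fin (n - 2)) (Fin (n - 2)) ℍ[ℝ]) (d : ℍ[ℝ]) :
    blocks n a b M d 0 0 = a ∧ blocks n a b M d 1 1 = b ∧
    (∀ i j, blocks n a b M d (mid n i) (mid n j) = M i j) ∧
    blocks n a b M d (Fin.last n) (Fin.last n) = d ∧
    (∀ i, i ≠ 0 → blocks n a b M d i 0 = 0 ∧ blocks n a b M d 0 i = 0) ∧
    (∀ i, i ≠ 1 → blocks n a b M d i 1 = 0 ∧ blocks n a b M d 1 i = 0) ∧
    (∀ i, i ≠ Fin.last n →
      blocks n a b M d i (Fin.last n) = 0 ∧ blocks n a b M d (Fin.last n) i = 0) := by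
  have h1 := fin_one_ne_zero hn
  have h2 := fin_last_ne_zero hn
  have h3 := fin_one_ne_last hn
  simp only [blocks_apply]
  refine ⟨?_, ?_, fun i j => ?_, ?_, fun i hi => ⟨?_, ?_⟩, fun i hi => ⟨?_, ?_⟩,
      fun i hi => ⟨?_, ?_⟩⟩ <;>
    simp [h1.symm, h2.symm, h3.symm, mid_ne_zero, mid_ne_one hn, mid_ne_last, mid_inj,
      ite_and, eq_comm, *]

lemma blocks_add {n : ℕ} (a b a' b' : ℍ[ℝ]) (M M' : Matrix (Fin (n - 2)) (Fin (n - 2)) ℍ[ℝ])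
    (d d' : ℍ[ℝ]) :
    blocks n (a + a') (b + b') (M + M') (d + d') = blocks n a b M d + blocks n a' b' M' d' := by
  simp only [blocks, Matrix.single_add, Matrix.add_apply, Finset.sum_add_distrib]
  abel

lemma blocks_smul {n : ℕ} (c : ℝ) (a b : ℍ[ℝ]) (M : Matrix (Fin (n - 2)) (Fin (n - 2)) ℍ[ℝ])
    (d : ℍ[ℝ]) : blocks n (c • a) (c • b) (c • M) (c • d) = c • blocks n a b M d := by
  simp only [blocks, ← Matrix.smul_single, Matrix.smul_apply, smul_add, Finset.smul_sum]

lemma blocks_mul {n : ℕ} (hn : 2 ≤ n) (a b a' b' : ℍ[ℝ])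
    (M M' : Matrix (Fin (n - 2)) (Fin (n - 2)) ℍ[ℝ]) (d d' : ℍ[ℝ]) :
    blocks n a b M d * blocks n a' b' M' d' = blocks n (a * a') (b * b') (M * M') (d * d') := by
  obtain ⟨h0, h1, hm, hl, z0, z1, zl⟩ := blocks_entries hn a b M d
  obtain ⟨h0', h1', hm', hl', z0', z1', zl'⟩ := blocks_entries hn a' b' M' d'
  have n1 := fin_one_ne_zero hn
  have n2 := fin_last_ne_zero hn
  have n3 := fin_one_ne_last hn
  refine eq_blocks hn ?_ ?_ (fun i j => ?_) ?_ (fun i hi => ⟨?_, ?_⟩) (fun i hi => ⟨?_, ?_⟩)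
    (fun i hi => ⟨?_, ?_⟩) <;>
  rw [Matrix.mul_apply, sum_eq_mid hn] <;>
  simp [Matrix.mul_apply, n3.symm, mid_ne_zero, mid_ne_one hn, mid_ne_last, *]

lemma blocks_trace {n : ℕ} (hn : 2 ≤ n) (a b : ℍ[ℝ])
    (M : Matrix (Fin (n - 2)) (Fin (n - 2)) ℍ[ℝ]) (d : ℍ[ℝ]) :
    Matrix.trace (blocks n a b M d) = a + (b + (Matrix.trace M + d)) := by
  obtain ⟨h0, h1, hm, hl, -⟩ := blocks_entries hn a b M d
  rw [Matrix.trace, sum_eq_mid hn]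
  simp only [Matrix.diag_apply, h0, h1, hm, hl, Matrix.trace]

lemma gradingZ_apply {n : ℕ} (i j : Fin (n + 1)) : (gradingZ n).1.1 i j =
    if i = j then (((if i = 0 then (1 : ℝ) else 0) - 1 / (n + 1) : ℝ) : ℍ[ℝ]) else 0 := by
  rw [gradingZ, diagElt_apply, gradingZ_entry]

lemma gradingZ'_apply {n : ℕ} (i j : Fin (n + 1)) : (gradingZ' n).1.1 i j =
    if i = j then (((if i = 1 then (1 : ℝ) else 0) - (if i = Fin.last n then 1 else 0) : ℝ) : ℍ[ℝ])
      else 0 := by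
  rw [gradingZ', diagElt_apply]

/-- The element `3Z - Z'` as a block diagonal matrix. -/
lemma three_gradingZ_sub {n : ℕ} (hn : 2 ≤ n) :
    (3 : ℝ) • (gradingZ n).1.1 - (gradingZ' n).1.1 =
      blocks n ((3 - 3 / (n + 1) : ℝ) • 1) ((-1 - 3 / (n + 1) : ℝ) • 1) ((-3 / (n + 1) : ℝ) • 1)
        ((1 - 3 / (n + 1) : ℝ) • 1) := by
  have n1 := fin_one_ne_zero hn
  have n2 := fin_last_ne_zero hn
  have n3 := fin_one_ne_last hn
  have e (x : ℝ) : (x : ℍ[ℝ]) = x • 1 := by rw [← Algebra.algebraMap_eq_smul_one]; rfl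
  refine eq_blocks hn ?_ ?_ (fun i j => ?_) ?_ (fun i hi => ⟨?_, ?_⟩) (fun i hi => ⟨?_, ?_⟩)
    (fun i hi => ⟨?_, ?_⟩) <;>
  rw [Matrix.sub_apply, Matrix.smul_apply, gradingZ_apply, gradingZ'_apply]
  · rw [if_pos rfl, if_pos rfl, if_pos rfl, if_neg n1.symm, if_neg n2.symm, e, e]
    module
  · rw [if_pos rfl, if_pos rfl, if_pos rfl, if_neg n1, if_neg n3, e, e]
    module
  · by_cases hij : i = j
    · subst hij
      rw [if_pos rfl, if_pos rfl, if_neg (mid_ne_zero i), if_neg (mid_ne_one hn i),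
        if_neg (mid_ne_last i), e, e, Matrix.smul_apply, Matrix.one_apply_eq]
      module
    · rw [if_neg (mid_inj.not.2 hij), if_neg (mid_inj.not.2 hij), Matrix.smul_apply,
        Matrix.one_apply_ne hij]
      simp
  · rw [if_pos rfl, if_pos rfl, if_pos rfl, if_neg n2, if_neg n3.symm, e, e]
    module
  all_goals
    first
    | rw [if_neg hi, if_neg hi]; simp
    | rw [if_neg hi.symm, if_neg hi.symm]; simp

/-- The Levi factor consists of block diagonal matrices. -/
lemma leviMatrix_eq {n : ℕ} (hn : 2 ≤ n) (u v : ℍ[ℝ]) (t r : ℝ)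
    (B : Matrix (Fin (n - 2)) (Fin (n - 2)) ℍ[ℝ]) (q : ℍ[ℝ]) :
    leviMatrix n u v t r B q =
      blocks n (t • u + (r * (3 - 3 / (n + 1))) • 1)
        (t • v + (r * (-1 - 3 / (n + 1)) - (Matrix.trace B).re / 3 * 2) • 1)
        (B + (r * (-3 / (n + 1))) • 1)
        (q + (r * (1 - 3 / (n + 1)) - (Matrix.trace B).re / 3) • 1) := by
  have e1 : leviMatrix n u v t r B q = t • blocks n u v 0 0 +
      r • ((3 : ℝ) • (gradingZ n).1.1 - (gradingZ' n).1.1) +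
      (blocks n 0 0 B 0 + (-((Matrix.trace B).re / 3)) • blocks n 0 2 0 1) + blocks n 0 0 0 q := by
    simp [leviMatrix, blocks, sub_eq_add_neg]
    exact add_comm _ _
  have e2 : (2 : ℍ[ℝ]) = (2 : ℝ) • 1 := by
    rw [two_smul, one_add_one_eq_two]
  rw [e1, three_gradingZ_sub hn, ← blocks_smul, ← blocks_smul, ← blocks_smul, ← blocks_add,
    ← blocks_add, ← blocks_add, ← blocks_add, e2]
  congr 1 <;> simp only [smul_zero, smul_smul, add_zero, zero_add] <;> module

lemma leviMatrix_re_trace {n : ℕ} (hn : 2 ≤ n) {u v q : ℍ[ℝ]} (hu : u ∈ sp1) (hv : v ∈ sp1)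
    (hq : q ∈ sp1) (t r : ℝ) (B : Matrix (Fin (n - 2)) (Fin (n - 2)) ℍ[ℝ]) :
    (Matrix.trace (leviMatrix n u v t r B q)).re = 0 := by
  replace hu : u.re = 0 := hu
  replace hv : v.re = 0 := hv
  replace hq : q.re = 0 := hq
  have h2 : ((n - 2 : ℕ) : ℝ) = n - 2 := by rw [Nat.cast_sub hn, Nat.cast_ofNat]
  have h1 : (n : ℝ) + 1 ≠ 0 := by positivity
  rw [leviMatrix_eq hn, blocks_trace hn]
  simp [Matrix.trace_add, Matrix.trace_smul, hu, hv, hq, h2]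
  field_simp
  ring

/-- The Levi factor of the annihilator, parametrized by `𝔰𝔬(2) ⊕ ℝ ⊕ 𝔤𝔩(n-2, ℍ) ⊕ 𝔰𝔭(1)`. -/
def leviHom {n : ℕ} (hn : 2 ≤ n) {u v : ℍ[ℝ]} (hu : u ∈ sp1) (hv : v ∈ sp1) :
    (LieAlgebra.Orthogonal.so (Fin 2) ℝ × ℝ × Matrix (Fin (n - 2)) (Fin (n - 2)) ℍ[ℝ] × sp1)
      →ₗ⁅ℝ⁆ g0 n where
  toFun s := ⟨⟨leviMatrix n u v (s.1.1 1 0) s.2.1 s.2.2.1 s.2.2.2.1,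
    leviMatrix_re_trace hn hu hv s.2.2.2.2 _ _ _⟩, by
      intro i hi
      change leviMatrix n u v _ _ _ _ i 0 = 0 ∧ leviMatrix n u v _ _ _ _ 0 i = 0
      rw [leviMatrix_eq hn]
      exact (blocks_entries hn _ _ _ _).2.2.2.2.1 i hi⟩
  map_add' s s' := by
    apply Subtype.ext
    apply Subtype.ext
    change leviMatrix n u v (s.1.1 1 0 + s'.1.1 1 0) (s.2.1 + s'.2.1) (s.2.2.1 + s'.2.2.1)
      (s.2.2.2.1 + s'.2.2.2.1) = leviMatrix n u v _ _ _ _ + leviMatrix n u v _ _ _ _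
    rw [leviMatrix_eq hn, leviMatrix_eq hn, leviMatrix_eq hn, ← blocks_add, Matrix.trace_add,
      Quaternion.re_add]
    congr 1 <;> module
  map_smul' c s := by
    apply Subtype.ext
    apply Subtype.ext
    change leviMatrix n u v (c * s.1.1 1 0) (c * s.2.1) (c • s.2.2.1) (c • s.2.2.2.1) =
      c • leviMatrix n u v _ _ _ _
    rw [leviMatrix_eq hn, leviMatrix_eq hn, ← blocks_smul, Matrix.trace_smul, Quaternion.re_smul,
      smul_eq_mul]
    congr 1 <;> module
  map_lie' {s s'} := by
    apply Subtype.ext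
    apply Subtype.ext
    have hso : (⁅s.1, s'.1⁆ : LieAlgebra.Orthogonal.so (Fin 2) ℝ).1 1 0 = 0 := by
      have h1 := (LieAlgebra.Orthogonal.mem_so (Fin 2) ℝ s.1.1).1 s.1.2
      have h2 := (LieAlgebra.Orthogonal.mem_so (Fin 2) ℝ s'.1.1).1 s'.1.2
      have d1 := congrFun (congrFun h1 0) 0
      have d2 := congrFun (congrFun h1 1) 1
      have d3 := congrFun (congrFun h2 0) 0
      have d4 := congrFun (congrFun h2 1) 1
      simp only [Matrix.transpose_apply, Matrix.neg_apply] at d1 d2 d3 d4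
      rw [LieSubalgebra.coe_bracket, Ring.lie_def, Matrix.sub_apply, Matrix.mul_apply,
        Matrix.mul_apply, Fin.sum_univ_two, Fin.sum_univ_two, self_eq_neg.1 d1, self_eq_neg.1 d2,
        self_eq_neg.1 d3, self_eq_neg.1 d4]
      ring
    change leviMatrix n u v ((⁅s.1, s'.1⁆ : LieAlgebra.Orthogonal.so (Fin 2) ℝ).1 1 0)
        ⁅s.2.1, s'.2.1⁆ ⁅s.2.2.1, s'.2.2.1⁆ ⁅s.2.2.2.1, s'.2.2.2.1⁆ =
      ⁅leviMatrix n u v (s.1.1 1 0) s.2.1 s.2.2.1 s.2.2.2.1,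
        leviMatrix n u v (s'.1.1 1 0) s'.2.1 s'.2.2.1 s'.2.2.2.1⁆
    rw [hso, Ring.lie_def, Ring.lie_def, Ring.lie_def, Ring.lie_def, leviMatrix_eq hn,
      leviMatrix_eq hn, leviMatrix_eq hn, blocks_mul hn, blocks_mul hn, Matrix.trace_sub,
      Quaternion.re_sub, re_trace_mul_comm, sub_self, mul_comm s.2.1, sub_self,
      sub_eq_add_neg (blocks n _ _ _ _), ← neg_one_smul ℝ (blocks n _ _ _ _), ← blocks_smul, ← blocks_add]
    congr 1 <;> simp only [add_mul, mul_add, smul_mul_assoc, mul_smul_comm, mul_one, one_mul] <;>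
      module

/-- An element of the Levi factor is determined by its blocks at `{0}`, `{2, …, n-1}` and `{n}`:
the first one determines `r` by its real part and `t` by its imaginary part. -/
lemma leviMatrix_eq_zero {n : ℕ} (hn : 2 ≤ n) {u v q : ℍ[ℝ]} (hu : u ∈ sp1) (hu0 : u ≠ 0)
    {t r : ℝ} {B : Matrix (Fin (n - 2)) (Fin (n - 2)) ℍ[ℝ]}
    (h0 : leviMatrix n u v t r B q 0 0 = 0)
    (hm : ∀ i j, leviMatrix n u v t r B q (mid n i) (mid n j) = 0)
    (hl : leviMatrix n u v t r B q (Fin.last n) (Fin.last n) = 0) :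
    t = 0 ∧ r = 0 ∧ B = 0 ∧ q = 0 := by
  replace hu : u.re = 0 := hu
  rw [leviMatrix_eq hn] at h0 hl
  simp only [leviMatrix_eq hn] at hm
  obtain ⟨e0, -, em, el, -⟩ := blocks_entries hn (t • u + (r * (3 - 3 / (n + 1))) • 1)
        (t • v + (r * (-1 - 3 / (n + 1)) - (Matrix.trace B).re / 3 * 2) • 1)
        (B + (r * (-3 / (n + 1))) • 1)
        (q + (r * (1 - 3 / (n + 1)) - (Matrix.trace B).re / 3) • 1)
  rw [e0] at h0
  rw [el] at hl
  simp only [em] at hm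
  have hr : r = 0 := by
    have h := congrArg QuaternionAlgebra.re h0
    have h1 : (3 : ℝ) - 3 / (n + 1) ≠ 0 := by
      have h2 : (2 : ℝ) ≤ n := by exact_mod_cast hn
      have : (3 : ℝ) - 3 / (n + 1) = 3 * n / (n + 1) := by field_simp; ring
      rw [this]
      positivity
    rw [Quaternion.re_add, Quaternion.re_smul, Quaternion.re_smul, hu, Quaternion.re_one,
      Quaternion.re_zero, smul_zero, zero_add, smul_eq_mul, mul_one] at h
    exact (mul_eq_zero.1 h).resolve_right h1
  subst hr
  have hB : B = 0 := by
    ext1 i j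
    have := hm i j
    rwa [zero_mul, zero_smul, add_zero] at this
  subst hB
  refine ⟨?_, rfl, rfl, ?_⟩
  · rw [zero_mul, zero_smul, add_zero] at h0
    exact (smul_eq_zero.1 h0).resolve_right hu0
  · simpa using hl

/-! ### Structure of the annihilator of a torsion class -/

/-- `A` has the shape of an element of the annihilator of a torsion class whose stabiliser is
spanned by `(u, v)`. -/
def IsAnnShape {n : ℕ} (u v : ℍ[ℝ]) (A : g0 n) : Prop :=
  IsTorsionShape A ∧ ∃ t : ℝ, (A.1.1 0 0).im = t • u ∧ (A.1.1 1 1).im = t • v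

/-- The Heisenberg algebra in terms of the blocks `{0}`, `{1}`, `{2, …, n-1}`, `{n}`. -/
lemma mem_heis_iff {n : ℕ} (hn : 2 ≤ n) (y : g0 n) : y ∈ heis n ↔
    y.1.1 0 0 = 0 ∧ y.1.1 1 1 = 0 ∧ (∀ i j, y.1.1 (mid n i) (mid n j) = 0) ∧
      y.1.1 (Fin.last n) (Fin.last n) = 0 ∧ (∀ i, y.1.1 (mid n i) 1 = 0) ∧
      (∀ j, y.1.1 (Fin.last n) (mid n j) = 0) ∧ y.1.1 (Fin.last n) 1 = 0 := by
  have v1 := fin_one_val hn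
  have v0 : (0 : Fin (n + 1)).val = 0 := rfl
  have vl : (Fin.last n).val = n := rfl
  have vm := mid_val (n := n)
  constructor
  · intro h
    refine ⟨h _ _ ?_, h _ _ ?_, fun i j => h _ _ ?_, h _ _ ?_, fun i => h _ _ ?_, fun i => h _ _ ?_,
      h _ _ ?_⟩ <;> simp only [v0, v1, vl, vm] <;> omega
  · rintro ⟨h1, h2, h3, h4, h5, h6, h7⟩ i j hij
    by_cases hi : i = 0
    · by_cases hj : j = 0
      · rw [hi, hj, h1]
      · rw [hi, g0_zero_apply y hj]
    by_cases hj : j = 0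
    · rw [hj, g0_apply_zero y hi]
    rcases eq_mid_or hn i with rfl | rfl | ⟨i, rfl⟩ | rfl
    · exact absurd rfl hi
    · rcases eq_mid_or hn j with rfl | rfl | ⟨j, rfl⟩ | rfl
      · exact absurd rfl hj
      · exact h2
      · exact absurd (Or.inl ⟨v1, by rw [vm]; omega⟩) hij
      · exact absurd (Or.inl ⟨v1, by rw [vl]; omega⟩) hij
    · rcases eq_mid_or hn j with rfl | rfl | ⟨j, rfl⟩ | rfl
      · exact absurd rfl hj
      · exact h5 i
      · exact h3 i j
      · exact absurd (Or.inr ⟨vl, by rw [vm]; omega⟩) hij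
    · rcases eq_mid_or hn j with rfl | rfl | ⟨j, rfl⟩ | rfl
      · exact absurd rfl hj
      · exact h7
      · exact h6 j
      · exact h4

lemma isAnnShape_of_mem_heis {n : ℕ} (hn : 2 ≤ n) (u v : ℍ[ℝ]) {y : g0 n} (hy : y ∈ heis n) :
    IsAnnShape u v y := by
  obtain ⟨h1, h2, h3, h4, h5, h6, h7⟩ := (mem_heis_iff hn y).1 hy
  refine ⟨⟨fun k k0 k1 => ?_, fun j j0 jl => ?_, ?_⟩, 0, ?_, ?_⟩
  · rcases eq_mid_or hn k with rfl | rfl | ⟨k, rfl⟩ | rfl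
    exacts [absurd rfl k0, absurd rfl k1, h5 k, h7]
  · rcases eq_mid_or hn j with rfl | rfl | ⟨j, rfl⟩ | rfl
    exacts [absurd rfl j0, h7, h6 j, absurd rfl jl]
  · rw [h1, h2, h4]
    simp
  · rw [h1]
    simp
  · rw [h2]
    simp

/-- The Heisenberg algebra is an ideal of the annihilator. -/
lemma IsAnnShape.lie_mem_heis {n : ℕ} (hn : 2 ≤ n) {u v : ℍ[ℝ]} {A y : g0 n} (hA : IsAnnShape u v A)
    (hy : y ∈ heis n) : ⁅A, y⁆ ∈ heis n := by
  obtain ⟨h1, h2, h3, h4, h5, h6, h7⟩ := (mem_heis_iff hn y).1 hy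
  obtain ⟨⟨s1, s2, -⟩, -⟩ := hA
  have n1 := fin_one_ne_zero hn
  have n2 := fin_last_ne_zero hn
  have n3 := fin_one_ne_last hn
  have a0 : ∀ i, i ≠ 0 → A.1.1 i 0 = 0 := fun i hi => g0_apply_zero A hi
  have a1 : ∀ i, i ≠ 0 → A.1.1 0 i = 0 := fun i hi => g0_zero_apply A hi
  have b0 : ∀ i, i ≠ 0 → y.1.1 i 0 = 0 := fun i hi => g0_apply_zero y hi
  have b1 : ∀ i, i ≠ 0 → y.1.1 0 i = 0 := fun i hi => g0_zero_apply y hi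
  have e (i j) : (⁅A, y⁆ : g0 n).1.1 i j = _ := slH_lie_apply A.1 y.1 i j
  simp only [sum_eq_mid hn] at e
  rw [mem_heis_iff hn]
  refine ⟨?_, ?_, fun i j => ?_, ?_, fun i => ?_, fun j => ?_, ?_⟩ <;> rw [e] <;>
  simp [n1, n2, n3.symm, mid_ne_zero, mid_ne_one hn, mid_ne_last, a0, a1,
    b0, b1, s1, s2, h1, h2, h3, h4, h5, h6, h7]

/-- For `3Z - Z'` and the compensated middle blocks, the relation between the real parts of the
entries at `0`, `1`, `n` holds by the choice of the multiples. -/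
lemma isAnnShape_leviHom {n : ℕ} (hn : 2 ≤ n) {u v : ℍ[ℝ]} (hu : u ∈ sp1) (hv : v ∈ sp1) (s) :
    IsAnnShape u v (leviHom hn hu hv s) := by
  obtain ⟨s, r, B, q⟩ := s
  have e : (leviHom hn hu hv (s, r, B, q)).1.1 = _ := leviMatrix_eq hn u v (s.1 1 0) r B q
  obtain ⟨e0, e1, em, el, z0, z1, zl⟩ := blocks_entries hn (s.1 1 0 • u + (r * (3 - 3 / (n + 1))) • 1)
        (s.1 1 0 • v + (r * (-1 - 3 / (n + 1)) - (Matrix.trace B).re / 3 * 2) • 1)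
        (B + (r * (-3 / (n + 1))) • 1)
        (q.1 + (r * (1 - 3 / (n + 1)) - (Matrix.trace B).re / 3) • 1)
  have hu' : u.re = 0 := hu
  have hv' : v.re = 0 := hv
  have hq' : q.1.re = 0 := q.2
  have im_eq {x : ℍ[ℝ]} (hx : x.re = 0) (t c : ℝ) : (t • x + c • (1 : ℍ[ℝ])).im = t • x := by
    ext <;> simp [hx]
  refine ⟨⟨fun k _ k1 => ?_, fun j _ jl => ?_, ?_⟩, s.1 1 0, ?_, ?_⟩
  · rw [e, (z1 k k1).1]
  · rw [e, (zl j jl).2]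
  · rw [e, e0, e1, el]
    simp [hu', hv', hq']
    field_simp
    ring
  · rw [e, e0, im_eq hu']
  · rw [e, e1, im_eq hv']

/-- The element of `𝔰𝔬(2)` with the entry `t` in the lower left corner. -/
def soElt (t : ℝ) : LieAlgebra.Orthogonal.so (Fin 2) ℝ :=
  ⟨!![0, -t; t, 0], (LieAlgebra.Orthogonal.mem_so _ _ _).2 (by
    ext i j
    fin_cases i <;> fin_cases j <;> simp)⟩

lemma soElt_apply (t : ℝ) : (soElt t).1 1 0 = t := rfl

/-- The entries of the Levi component of `A` are read off from the diagonal blocks of `A`; the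
relation between the real parts of the entries at `0`, `1`, `n` and the vanishing of the real trace
make the remainder vanish on these blocks. -/
lemma IsAnnShape.exists_sub_mem_heis {n : ℕ} (hn : 2 ≤ n) {u v : ℍ[ℝ]} (hu : u ∈ sp1) (hv : v ∈ sp1)
    {A : g0 n} (hA : IsAnnShape u v A) : ∃ s, A - leviHom hn hu hv s ∈ heis n := by
  obtain ⟨⟨s1, s2, s3⟩, t, ht0, ht1⟩ := hA
  have htr : (Matrix.trace A.1.1).re = 0 := A.1.2
  rw [Matrix.trace, sum_eq_mid hn] at htr
  simp only [Quaternion.re_add, Matrix.diag_apply, re_sum] at htr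
  set r : ℝ := (A.1.1 0 0).re * (n + 1) / (3 * n) with hr
  set B : Matrix (Fin (n - 2)) (Fin (n - 2)) ℍ[ℝ] :=
    (Matrix.of fun i j => A.1.1 (mid n i) (mid n j)) + (r * (3 / (n + 1))) • 1 with hB
  let q : sp1 := ⟨(A.1.1 (Fin.last n) (Fin.last n)).im, Quaternion.re_im _⟩
  have hn0 : (n : ℝ) ≠ 0 := by positivity
  have hn1 : (n : ℝ) + 1 ≠ 0 := by positivity
  have h2 : ((n - 2 : ℕ) : ℝ) = n - 2 := by rw [Nat.cast_sub hn, Nat.cast_ofNat]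
  have hBt : (Matrix.trace B).re =
      ∑ i, (A.1.1 (mid n i) (mid n i)).re + (n - 2) * (r * (3 / (n + 1))) := by
    rw [hB, Matrix.trace_add, Matrix.trace_smul, Matrix.trace_one, Quaternion.re_add,
      Quaternion.re_smul, Matrix.trace, re_sum, Fintype.card_fin]
    simp [h2]
    ring
  have hr0 : (A.1.1 0 0).re = r * (3 - 3 / (n + 1)) := by
    rw [hr]
    field_simp
    ring
  have split (x : ℍ[ℝ]) : x = x.im + x.re • 1 := by ext <;> simp
  have e : (leviHom hn hu hv (soElt t, r, B, q)).1.1 = _ := leviMatrix_eq hn u v t r B q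
  obtain ⟨e0, e1, em, el, z0, z1, zl⟩ := blocks_entries hn (t • u + (r * (3 - 3 / (n + 1))) • 1)
        (t • v + (r * (-1 - 3 / (n + 1)) - (Matrix.trace B).re / 3 * 2) • 1)
        (B + (r * (-3 / (n + 1))) • 1)
        (q.1 + (r * (1 - 3 / (n + 1)) - (Matrix.trace B).re / 3) • 1)
  have hl : (A.1.1 (Fin.last n) (Fin.last n)).re = r * (1 - 3 / (n + 1)) - (Matrix.trace B).re / 3 := by
    rw [hBt]
    have : (3 : ℝ) * (1 - 3 / (n + 1)) - (n - 2) * (3 / (n + 1)) = 0 := by field_simp; ring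
    linear_combination (1 / 3) * htr - (1 / 3) * s3 - (r / 3) * this
  have h1 : (A.1.1 1 1).re = r * (-1 - 3 / (n + 1)) - (Matrix.trace B).re / 3 * 2 := by
    linear_combination s3 - hr0 + 2 * hl
  refine ⟨(soElt t, r, B, q), ?_⟩
  have es (i j) : (A - leviHom hn hu hv (soElt t, r, B, q)).1.1 i j =
    A.1.1 i j - (leviHom hn hu hv (soElt t, r, B, q)).1.1 i j := rfl
  rw [e] at es
  rw [mem_heis_iff hn]
  refine ⟨?_, ?_, fun i j => ?_, ?_, fun i => ?_, fun j => ?_, ?_⟩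
  · rw [es, e0, ← ht0, ← hr0, ← split, sub_self]
  · rw [es, e1, ← ht1, ← h1, ← split, sub_self]
  · rw [es, em, hB]
    simp only [Matrix.add_apply, Matrix.of_apply, Matrix.smul_apply]
    module
  · rw [es, el, ← hl, ← split, sub_self]
  · rw [es, (z1 _ (mid_ne_one hn i)).1, s1 _ (mid_ne_zero i) (mid_ne_one hn i), sub_zero]
  · rw [es, (zl _ (mid_ne_last j)).2, s2 _ (mid_ne_zero j) (mid_ne_last j), sub_zero]
  · rw [es, (zl _ (fin_one_ne_last hn)).2, s2 _ (fin_one_ne_zero hn) (fin_one_ne_last hn), sub_zero]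

lemma so_two_eq_zero {s : LieAlgebra.Orthogonal.so (Fin 2) ℝ} (h : s.1 1 0 = 0) : s = 0 := by
  have h1 := (LieAlgebra.Orthogonal.mem_so (Fin 2) ℝ s.1).1 s.2
  have d1 := congrFun (congrFun h1 0) 0
  have d2 := congrFun (congrFun h1 1) 1
  have d3 := congrFun (congrFun h1 0) 1
  simp only [Matrix.transpose_apply, Matrix.neg_apply] at d1 d2 d3
  have d3' : s.1 0 1 = 0 := by linarith
  apply Subtype.ext
  ext i j
  fin_cases i <;> fin_cases j
  exacts [self_eq_neg.1 d1, d3', h, self_eq_neg.1 d2]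

/-- The Levi factor meets the Heisenberg algebra trivially. -/
lemma leviHom_eq_zero {n : ℕ} (hn : 2 ≤ n) {u v : ℍ[ℝ]} (hu : u ∈ sp1) (hv : v ∈ sp1)
    (hu0 : u ≠ 0) {s} (h : leviHom hn hu hv s ∈ heis n) : s = 0 := by
  obtain ⟨s, r, B, q⟩ := s
  obtain ⟨h1, -, h3, h4, -⟩ := (mem_heis_iff hn _).1 h
  obtain ⟨ht, rfl, rfl, hq⟩ := leviMatrix_eq_zero hn hu hu0 h1 h3 h4
  rw [show s = 0 from so_two_eq_zero ht, show q = 0 from Subtype.ext hq]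
  rfl

lemma leviHom_injective {n : ℕ} (hn : 2 ≤ n) {u v : ℍ[ℝ]} (hu : u ∈ sp1) (hv : v ∈ sp1)
    (hu0 : u ≠ 0) : Function.Injective (leviHom hn hu hv) := by
  rw [injective_iff_map_eq_zero]
  intro s hs
  apply leviHom_eq_zero hn hu hv hu0
  rw [hs]
  exact zero_mem _

/-! ### Dimensions -/

lemma finrank_sp1 : Module.finrank ℝ sp1 = 3 := by
  let re' : ℍ[ℝ] →ₗ[ℝ] ℝ :=
    { toFun := fun q => q.re, map_add' := fun _ _ => rfl, map_smul' := fun _ _ => rfl }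
  have h1 : sp1.toSubmodule = LinearMap.ker re' := rfl
  have h2 : Function.Surjective re' := fun x => ⟨(x : ℍ[ℝ]), Quaternion.re_coe x⟩
  have h3 := LinearMap.finrank_range_add_finrank_ker re'
  rw [LinearMap.range_eq_top.2 h2, finrank_top, Module.finrank_self, Quaternion.finrank_eq_four]
    at h3
  change Module.finrank ℝ sp1.toSubmodule = 3
  rw [h1]
  omega

lemma finrank_so_two : Module.finrank ℝ (LieAlgebra.Orthogonal.so (Fin 2) ℝ) = 1 := by
  let e : LieAlgebra.Orthogonal.so (Fin 2) ℝ →ₗ[ℝ] ℝ :=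
    { toFun := fun s => s.1 1 0, map_add' := fun _ _ => rfl, map_smul' := fun _ _ => rfl }
  have he : Function.Bijective e := by
    refine ⟨(injective_iff_map_eq_zero e).2 fun s hs => so_two_eq_zero hs,
      fun t => ⟨soElt t, soElt_apply t⟩⟩
  rw [(LinearEquiv.ofBijective e he).finrank_eq, Module.finrank_self]

lemma finrank_heis {n : ℕ} (hn : 2 ≤ n) : Module.finrank ℝ (heis n) = 8 * n - 12 := by
  have n1 := fin_one_ne_zero hn
  have n2 := fin_last_ne_zero hn
  have n3 := fin_one_ne_last hn
  have m1 := fun k => (mid_ne_one hn k).symm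
  let e : heis n →ₗ[ℝ] (Fin (n - 2) → ℍ[ℝ]) × ℍ[ℝ] × (Fin (n - 2) → ℍ[ℝ]) :=
    { toFun := fun y => (fun k => y.1.1.1 1 (mid n k), y.1.1.1 1 (Fin.last n),
        fun k => y.1.1.1 (mid n k) (Fin.last n))
      map_add' := fun _ _ => rfl
      map_smul' := fun _ _ => rfl }
  have he : Function.Bijective e := by
    constructor
    · refine (injective_iff_map_eq_zero e).2 fun y hy => ?_
      have y1 : ∀ k, y.1.1.1 1 (mid n k) = 0 := congrFun (congrArg Prod.fst hy)
      have y2 : y.1.1.1 1 (Fin.last n) = 0 := congrArg (fun z => z.2.1) hy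
      have y3 : ∀ k, y.1.1.1 (mid n k) (Fin.last n) = 0 :=
        congrFun (congrArg (fun z => z.2.2) hy)
      obtain ⟨h1, h2, h3, h4, h5, h6, h7⟩ := (mem_heis_iff hn y.1).1 y.2
      refine Subtype.ext (g0_ext fun i j => ?_)
      change y.1.1.1 i j = 0
      by_cases hi : i = 0
      · by_cases hj : j = 0
        · rw [hi, hj, h1]
        · rw [hi, g0_zero_apply y.1 hj]
      by_cases hj : j = 0
      · rw [hj, g0_apply_zero y.1 hi]
      rcases eq_mid_or hn i with rfl | rfl | ⟨i, rfl⟩ | rfl <;>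
      rcases eq_mid_or hn j with rfl | rfl | ⟨j, rfl⟩ | rfl <;>
      simp_all
    · rintro ⟨a, b, c⟩
      let X : slH (n + 1) := ∑ k, unit (m1 k) (a k) + unit n3 b + ∑ k, unit (mid_ne_last k) (c k)
      have hX : X ∈ g0 n := add_mem (add_mem (sum_mem fun k _ => unit_mem_g0 _ n1 (mid_ne_zero k) _)
        (unit_mem_g0 _ n1 n2 _)) (sum_mem fun k _ => unit_mem_g0 _ (mid_ne_zero k) n2 _)
      have eX (i j) : X.1 i j = (∑ k, if 1 = i ∧ mid n k = j then a k else 0) +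
          (if 1 = i ∧ Fin.last n = j then b else 0) +
          ∑ k, if mid n k = i ∧ Fin.last n = j then c k else 0 := by
        have hs (f : Fin (n - 2) → slH (n + 1)) : (∑ k, f k).1 i j = ∑ k, (f k).1 i j := by
          rw [AddSubmonoidClass.coe_finsetSum, Matrix.sum_apply]
        change (∑ k, unit (m1 k) (a k)).1 i j + (unit n3 b).1 i j +
          (∑ k, unit (mid_ne_last k) (c k)).1 i j = _
        rw [hs, hs]
        simp only [unit_apply]
      have hh : (⟨X, hX⟩ : g0 n) ∈ heis n := by
        rw [mem_heis_iff hn]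
        simp [eX, n1, n2, n3, n3.symm, mid_ne_zero, mid_ne_one hn, mid_ne_last,
          m1, fun k : Fin (n - 2) => (mid_ne_last k).symm]
      refine ⟨⟨⟨X, hX⟩, hh⟩, ?_⟩
      change (fun k => X.1 1 (mid n k), X.1 1 (Fin.last n), fun k => X.1 (mid n k) (Fin.last n)) = _
      simp [eX, mid_ne_one hn, mid_ne_last, mid_inj, m1, fun k : Fin (n - 2) => (mid_ne_last k).symm]
  rw [(LinearEquiv.ofBijective e he).finrank_eq, Module.finrank_prod, Module.finrank_prod,
    Module.finrank_pi_fintype, Quaternion.finrank_eq_four]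
  simp only [Finset.sum_const, Finset.card_univ, Fintype.card_fin, smul_eq_mul]
  omega

lemma finrank_gMinus (n : ℕ) : Module.finrank ℝ (gMinus n) = 4 * n := by
  let e : gMinus n →ₗ[ℝ] (Fin n → ℍ[ℝ]) :=
    { toFun := fun x i => x.1.1 i.succ 0
      map_add' := fun _ _ => rfl
      map_smul' := fun _ _ => rfl }
  have he : Function.Bijective e := by
    constructor
    · refine (injective_iff_map_eq_zero e).2 fun x hx => gMinus_ext fun i hi => ?_
      obtain ⟨i, rfl⟩ := Fin.exists_succ_eq.2 hi
      exact congrFun hx i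
    · exact fun v => ⟨col n (Fin.cons 0 v), funext fun i => col_apply_zero _ (Fin.succ_ne_zero i)⟩
  rw [(LinearEquiv.ofBijective e he).finrank_eq, Module.finrank_pi_fintype,
    Quaternion.finrank_eq_four]
  simp [mul_comm]

lemma eq_zero_of_mem_gMinus_of_mem_g0 {n : ℕ} {X : slH (n + 1)} (h1 : X ∈ gMinus n) (h2 : X ∈ g0 n) : X = 0 := by
  apply slH_ext
  intro i j
  by_cases h : i = 0 ∨ j ≠ 0
  · exact h1 i j h
  · push Not at h
    rw [h.2]
    exact (h2 i h.1).1

/-- `𝔤₋₁ ⊕ ann(w)` as a vector space. -/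
def gradedEquiv {n : ℕ} (w : H2 n) : (gMinus n × ann w) ≃ₗ[ℝ] gradedAlg w :=
  LinearEquiv.ofBijective
    { toFun := fun p => ⟨p.1.1 + p.2.1.1, p.1.1, p.1.2, p.2.1, p.2.2, rfl⟩
      map_add' := fun p q => Subtype.ext (add_add_add_comm p.1.1 q.1.1 p.2.1.1 q.2.1.1)
      map_smul' := fun c p => Subtype.ext (smul_add c p.1.1 p.2.1.1).symm }
    ⟨by
      refine (injective_iff_map_eq_zero _).2 fun p hp => ?_
      have h : p.1.1 + p.2.1.1 = 0 := congrArg Subtype.val hp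
      have h1 : p.1.1 = 0 := eq_zero_of_mem_gMinus_of_mem_g0 p.1.2 (by
        rw [eq_neg_of_add_eq_zero_left h]
        exact neg_mem p.2.1.2)
      rw [h1, zero_add] at h
      exact Prod.ext (Subtype.ext h1) (Subtype.ext (Subtype.ext h)),
    by
      rintro ⟨_, v, hv, A, hA, rfl⟩
      exact ⟨(⟨v, hv⟩, ⟨A, hA⟩), rfl⟩⟩

lemma finrank_gradedAlg {n : ℕ} (w : H2 n) :
    Module.finrank ℝ (gradedAlg w) = 4 * n + Module.finrank ℝ (ann w) := by
  have : Module.Finite ℝ (gMinus n) :=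
    inferInstanceAs (Module.Finite ℝ (gMinus n).toSubmodule)
  rw [← (gradedEquiv w).finrank_eq, Module.finrank_prod, finrank_gMinus]

/-- The decomposition of the annihilator into the Levi factor and the Heisenberg algebra. -/
lemma ann_eq_sup {n : ℕ} (hn : 2 ≤ n) {u v : ℍ[ℝ]} (hu : u ∈ sp1) (hv : v ∈ sp1) {w : H2 n}
    (h : ∀ A : g0 n, A ∈ ann w ↔ IsAnnShape u v A) :
    (ann w).toSubmodule = (leviHom hn hu hv).range.toSubmodule ⊔ (heis n).toSubmodule := by
  apply le_antisymm
  · intro A hA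
    obtain ⟨s, hs⟩ := ((h A).1 hA).exists_sub_mem_heis hn hu hv
    rw [← add_sub_cancel (leviHom hn hu hv s) A]
    exact Submodule.add_mem_sup ⟨s, rfl⟩ hs
  · refine sup_le ?_ fun A hA => (h A).2 (isAnnShape_of_mem_heis hn u v hA)
    rintro _ ⟨s, rfl⟩
    exact (h _).2 (isAnnShape_leviHom hn hu hv s)

lemma disjoint_levi_heis {n : ℕ} (hn : 2 ≤ n) {u v : ℍ[ℝ]} (hu : u ∈ sp1) (hv : v ∈ sp1)
    (hu0 : u ≠ 0) :
    Disjoint (leviHom hn hu hv).range.toSubmodule (heis n).toSubmodule := by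
  rw [Submodule.disjoint_def]
  rintro _ ⟨s, rfl⟩ hs
  have h0 := leviHom_eq_zero hn hu hv hu0 hs
  rw [h0]
  exact map_zero (leviHom hn hu hv)

lemma finrank_ann {n : ℕ} (hn : 2 ≤ n) {u v : ℍ[ℝ]} (hu : u ∈ sp1) (hv : v ∈ sp1) (hu0 : u ≠ 0)
    {w : H2 n} (h : ∀ A : g0 n, A ∈ ann w ↔ IsAnnShape u v A) :
    Module.finrank ℝ (ann w) = 5 + 4 * (n - 2) ^ 2 + (8 * n - 12) := by
  have h1 := Submodule.finrank_sup_add_finrank_inf_eq (leviHom hn hu hv).range.toSubmodule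
    (heis n).toSubmodule
  rw [(disjoint_levi_heis hn hu hv hu0).eq_bot, finrank_bot, ← ann_eq_sup hn hu hv h] at h1
  have h2 : Module.finrank ℝ (leviHom hn hu hv).range.toSubmodule = 5 + 4 * (n - 2) ^ 2 := by
    have h3 := LinearMap.finrank_range_of_inj
      (f := (leviHom hn hu hv).toLinearMap) (leviHom_injective hn hu hv hu0)
    refine Eq.trans h3 ?_
    have : Module.Finite ℝ sp1 := inferInstanceAs (Module.Finite ℝ sp1.toSubmodule)
    have : Module.Finite ℝ (LieAlgebra.Orthogonal.so (Fin 2) ℝ) :=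
      inferInstanceAs (Module.Finite ℝ (LieAlgebra.Orthogonal.so (Fin 2) ℝ).toSubmodule)
    rw [Module.finrank_prod, Module.finrank_prod, Module.finrank_prod, finrank_so_two, finrank_sp1,
      Module.finrank_self, Module.finrank_matrix, Quaternion.finrank_eq_four, Fintype.card_fin]
    ring
  have h3 : Module.finrank ℝ (heis n).toSubmodule = 8 * n - 12 := finrank_heis hn
  rw [h2, h3] at h1
  exact h1

/-! ### The annihilators are not isomorphic -/

/-- The summand `𝔰𝔭(1)` is an ideal of `𝔤₀`. -/
lemma lie_spElt {n : ℕ} (p : sp1) (A : g0 n) : ∃ q : sp1, ⁅spElt n p, A⁆ = spElt n q ∧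
    q.1 = p.1 * A.1.1 0 0 - A.1.1 0 0 * p.1 := by
  refine ⟨⟨p.1 * A.1.1 0 0 - A.1.1 0 0 * p.1, ?_⟩, g0_ext fun i j => ?_, rfl⟩
  · change (p.1 * A.1.1 0 0 - A.1.1 0 0 * p.1).re = 0
    rw [Quaternion.re_sub, Quaternion.re_mul, Quaternion.re_mul]
    ring
  · refine (slH_lie_apply (spElt n p).1 A.1 i j).trans ?_
    simp only [spElt_apply]
    by_cases hi : i = 0
    · by_cases hj : j = 0
      · simp [hi, hj]
      · simp [hi, hj, g0_zero_apply A hj]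
    · by_cases hj : j = 0
      · simp [hi, hj, g0_apply_zero A hi]
      · simp [hi, hj]

lemma lie_spElt_spElt {n : ℕ} (p q : sp1) : ⁅spElt n p, spElt n q⁆ = spElt n ⁅p, q⁆ := by
  obtain ⟨r, h1, h2⟩ := lie_spElt p (spElt n q)
  rw [h1]
  congr 1
  apply Subtype.ext
  rw [h2, LieSubalgebra.coe_bracket, Ring.lie_def, spElt_apply, if_pos ⟨rfl, rfl⟩]

lemma spElt_eq_zero {n : ℕ} {p : sp1} (h : spElt n p = 0) : p = 0 := by
  have h1 := spElt_apply (n := n) p 0 0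
  rw [h, if_pos ⟨rfl, rfl⟩] at h1
  exact Subtype.ext h1.symm

lemma coe_lie_sp1 (p q : sp1) : (⁅p, q⁆ : sp1).1 = p.1 * q.1 - q.1 * p.1 := by
  rw [LieSubalgebra.coe_bracket, Ring.lie_def]

/-- The imaginary unit `i` as an element of `𝔰𝔭(1)`. -/
def spI : sp1 := ⟨qi, re_qi⟩

/-- The imaginary unit `j` as an element of `𝔰𝔭(1)`. -/
def spJ : sp1 := ⟨qj, re_qj⟩

lemma lie_spI_spJ : ⁅spI, spJ⁆ ≠ 0 := by
  intro h
  have h1 := coe_lie_sp1 spI spJ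
  rw [h] at h1
  have h2 := congrArg (fun q : ℍ[ℝ] => q.imK) h1
  simp [spI, spJ] at h2
  norm_num at h2

/-- `ad q` is twice the cross product with `q`, so that `(ad q)³ = -4|q|² ad q`. -/
lemma sp1_eq_zero {q : sp1} (h : ∀ r : sp1, ⁅q, ⁅q, ⁅q, r⁆⁆⁆ = 0) : q = 0 := by
  have hq : q.1.re = 0 := q.2
  have key (r : sp1) : (⁅q, ⁅q, ⁅q, r⁆⁆⁆ : sp1).1 =
      (-4 * (q.1.imI ^ 2 + q.1.imJ ^ 2 + q.1.imK ^ 2)) • (⁅q, r⁆ : sp1).1 := by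
    have hr : r.1.re = 0 := r.2
    simp only [coe_lie_sp1]
    ext <;> simp [hq, hr] <;> ring
  by_contra hq0
  have hne : -4 * (q.1.imI ^ 2 + q.1.imJ ^ 2 + q.1.imK ^ 2) ≠ 0 := by
    intro h0
    apply hq0
    apply Subtype.ext
    ext
    · exact hq
    · change q.1.imI = 0
      nlinarith [sq_nonneg q.1.imI, sq_nonneg q.1.imJ, sq_nonneg q.1.imK]
    · change q.1.imJ = 0
      nlinarith [sq_nonneg q.1.imI, sq_nonneg q.1.imJ, sq_nonneg q.1.imK]
    · change q.1.imK = 0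
      nlinarith [sq_nonneg q.1.imI, sq_nonneg q.1.imJ, sq_nonneg q.1.imK]
  have h1 (r : sp1) : q.1 * r.1 - r.1 * q.1 = 0 := by
    have := key r
    rw [h r] at this
    rw [← coe_lie_sp1]
    exact (smul_eq_zero.1 this.symm).resolve_left hne
  have hI := h1 spI
  have hJ := h1 spJ
  have i1 := congrArg (fun q : ℍ[ℝ] => q.imJ) hI
  have i2 := congrArg (fun q : ℍ[ℝ] => q.imK) hI
  have i3 := congrArg (fun q : ℍ[ℝ] => q.imK) hJ
  simp [spI, spJ] at i1 i2 i3
  apply hq0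
  apply Subtype.ext
  ext
  · exact hq
  · change q.1.imI = 0
    linarith
  · change q.1.imJ = 0
    linarith
  · change q.1.imK = 0
    linarith

/-- Let `e` embed `𝔰𝔭(1)` as an ideal. It centralizes every ideal whose elements are
`ad`-nilpotent of order three, because `𝔰𝔭(1)` has no such elements. -/
lemma lie_eq_zero_of_adNilpotent {L : Type*} [LieRing L] {e : sp1 → L}
    (e0 : e 0 = 0) (einj : ∀ q, e q = 0 → q = 0) (elie : ∀ p q, ⁅e p, e q⁆ = e ⁅p, q⁆)
    (eideal : ∀ p a, ∃ q, ⁅e p, a⁆ = e q) {H : Set L} (hH : ∀ a : L, ∀ y ∈ H, ⁅a, y⁆ ∈ H)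
    (hnil : ∀ z ∈ H, ∀ a : L, ⁅z, ⁅z, ⁅z, a⁆⁆⁆ = 0) (p : sp1) {y : L} (hy : y ∈ H) : ⁅e p, y⁆ = 0 := by
  -- the commutator lies in both ideals
  obtain ⟨q, hq⟩ := eideal p y
  have hz : e q ∈ H := hq ▸ hH _ y hy
  have : q = 0 := sp1_eq_zero fun r => einj _ (by
    rw [← elie, ← elie, ← elie]
    exact hnil _ hz _)
  rw [hq, this, e0]

/-- The Heisenberg algebra is two-step nilpotent. -/
lemma heis_lie_lie {n : ℕ} (hn : 2 ≤ n) {x y z : g0 n} (hx : x ∈ heis n) (hy : y ∈ heis n)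
    (hz : z ∈ heis n) : ⁅x, ⁅y, z⁆⁆ = 0 := by
  have n1 := fin_one_ne_zero hn
  have n2 := fin_last_ne_zero hn
  have n3 := fin_one_ne_last hn
  have main (x y : g0 n) (hx : x ∈ heis n) (hy : y ∈ heis n) (i j) :
      (⁅x, y⁆ : g0 n).1.1 i j = if i = 1 ∧ j = Fin.last n then
        ∑ k, x.1.1 1 (mid n k) * y.1.1 (mid n k) (Fin.last n) -
        ∑ k, y.1.1 1 (mid n k) * x.1.1 (mid n k) (Fin.last n) else 0 := by
    obtain ⟨h1, h2, h3, h4, h5, h6, h7⟩ := (mem_heis_iff hn x).1 hx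
    obtain ⟨k1, k2, k3, k4, k5, k6, k7⟩ := (mem_heis_iff hn y).1 hy
    have a0 : ∀ i, i ≠ 0 → x.1.1 i 0 = 0 := fun i hi => g0_apply_zero x hi
    have a1 : ∀ i, i ≠ 0 → x.1.1 0 i = 0 := fun i hi => g0_zero_apply x hi
    have b0 : ∀ i, i ≠ 0 → y.1.1 i 0 = 0 := fun i hi => g0_apply_zero y hi
    have b1 : ∀ i, i ≠ 0 → y.1.1 0 i = 0 := fun i hi => g0_zero_apply y hi
    refine (slH_lie_apply x.1 y.1 i j).trans ?_
    rw [sum_eq_mid hn, sum_eq_mid hn]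
    rcases eq_mid_or hn i with rfl | rfl | ⟨i, rfl⟩ | rfl <;>
    rcases eq_mid_or hn j with rfl | rfl | ⟨j, rfl⟩ | rfl <;>
    simp [n1, n2, n3, n1.symm, n2.symm, n3.symm, mid_ne_zero, mid_ne_one hn, mid_ne_last, a0, a1,
      b0, b1, h1, h2, h3, h4, h5, h6, h7, k1, k2, k3, k4, k5, k6, k7]
  have hyz : ⁅y, z⁆ ∈ heis n := (heis n).lie_mem hy hz
  refine g0_ext fun i j => (main _ _ hx hyz i j).trans ?_
  simp only [main _ _ hy hz]
  simp [mid_ne_one hn, mid_ne_last]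

lemma lie_unit_apply {m : ℕ} (X : slH m) {k l : Fin m} (h : k ≠ l) (p : ℍ[ℝ]) (i j : Fin m) :
    (⁅X, unit h p⁆ : slH m).1 i j =
      (if j = l then X.1 i k * p else 0) - (if i = k then p * X.1 l j else 0) := by
  rw [slH_lie_apply]
  simp only [unit_apply]
  congr 1
  · rw [Finset.sum_eq_single k (fun b _ hb => by rw [if_neg fun h => hb h.1.symm, mul_zero])
      (by simp)]
    by_cases hj : j = l
    · rw [if_pos ⟨rfl, hj.symm⟩, if_pos hj]
    · rw [if_neg fun h => hj h.2.symm, if_neg hj, mul_zero]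
  · rw [Finset.sum_eq_single l (fun b _ hb => by rw [if_neg fun h => hb h.2.symm, zero_mul])
      (by simp)]
    by_cases hi : i = k
    · rw [if_pos ⟨hi.symm, rfl⟩, if_pos hi]
    · rw [if_neg fun h => hi h.1.symm, if_neg hi, zero_mul]

lemma unit_mem_heis {n : ℕ} {k l : Fin (n + 1)} (h : k ≠ l) (hk : k ≠ 0) (hl : l ≠ 0) (p : ℍ[ℝ])
    (hkl : (k.val = 1 ∧ 1 < l.val) ∨ (l.val = n ∧ 1 ≤ k.val ∧ k.val < n)) :
    (⟨unit h p, unit_mem_g0 h hk hl p⟩ : g0 n) ∈ heis n := by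
  intro i j hij
  change (unit h p).1 i j = 0
  rw [unit_apply, if_neg]
  rintro ⟨rfl, rfl⟩
  exact hij hkl

lemma eq_re_smul_one_of_commute {x : ℍ[ℝ]} (h : ∀ p, x * p = p * x) : x = x.re • 1 := by
  have hI := h qi
  have hJ := h qj
  have i1 := congrArg (fun q : ℍ[ℝ] => q.imJ) hI
  have i2 := congrArg (fun q : ℍ[ℝ] => q.imK) hI
  have i3 := congrArg (fun q : ℍ[ℝ] => q.imK) hJ
  simp at i1 i2 i3
  ext
  · simp
  · change x.imI = _
    simp
    linarith
  · change x.imJ = _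
    simp
    linarith
  · change x.imK = _
    simp
    linarith

/-- The elements of the annihilator that centralize the Heisenberg algebra are, up to the entry in
the upper right corner of `𝔤𝔩(n, ℍ)`, real diagonal matrices. -/
lemma IsAnnShape.centralizer {n : ℕ} (hn : 2 ≤ n) {u v : ℍ[ℝ]} (hv0 : v ≠ 0) {X : g0 n}
    (hX : IsAnnShape u v X) (hc : ∀ y ∈ heis n, ⁅X, y⁆ = 0) :
    ∃ (a l : ℝ) (b : ℍ[ℝ]), ∀ i j, X.1.1 i j = if i = j then (if i = 0 then a else l) • 1 else
      if i = 1 ∧ j = Fin.last n then b else 0 := by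
  have n1 := fin_one_ne_zero hn
  have n2 := fin_last_ne_zero hn
  have n3 := fin_one_ne_last hn
  have m1 := fun k => (mid_ne_one hn k).symm
  have ml := fun k : Fin (n - 2) => (mid_ne_last k).symm
  have v1 := fin_one_val hn
  have vl : (Fin.last n).val = n := rfl
  obtain ⟨⟨s1, s2, s3⟩, t, ht0, ht1⟩ := hX
  have E {k l : Fin (n + 1)} (h : k ≠ l) (hk : k ≠ 0) (hl : l ≠ 0) (p : ℍ[ℝ])
      (hkl : (k.val = 1 ∧ 1 < l.val) ∨ (l.val = n ∧ 1 ≤ k.val ∧ k.val < n)) (i j : Fin (n + 1)) :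
      (if j = l then X.1.1 i k * p else 0) - (if i = k then p * X.1.1 l j else 0) = 0 := by
    rw [← lie_unit_apply X.1 h p]
    exact congrArg (fun Y : g0 n => Y.1.1 i j) (hc _ (unit_mem_heis h hk hl p hkl))
  have c1 (p : ℍ[ℝ]) : X.1.1 1 1 * p = p * X.1.1 (Fin.last n) (Fin.last n) := by
    have := E n3 n1 n2 p (by rw [v1, vl]; omega) 1 (Fin.last n)
    rwa [if_pos rfl, if_pos rfl, sub_eq_zero] at this
  have c2 (m) : ∀ j, (if j = mid n m then X.1.1 1 1 * 1 else 0) - 1 * X.1.1 (mid n m) j = 0 := by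
    intro j
    have := E (m1 m) n1 (mid_ne_zero m) 1
      (by rw [v1, mid_val]; omega) 1 j
    rwa [if_pos rfl] at this
  have c3 (m) : X.1.1 1 (mid n m) = 0 := by
    have := E (mid_ne_last m) (mid_ne_zero m) n2 1
      (by rw [vl, mid_val]; omega)
      1 (Fin.last n)
    rwa [if_pos rfl, if_neg (m1 m), sub_zero, mul_one] at this
  have hll : X.1.1 (Fin.last n) (Fin.last n) = X.1.1 1 1 := by simpa using (c1 1).symm
  have h11 : X.1.1 1 1 = (X.1.1 1 1).re • 1 := eq_re_smul_one_of_commute fun p => by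
    rw [c1, hll]
  have ht : t = 0 := by
    rw [h11] at ht1
    have : t • v = 0 := by rw [← ht1]; ext <;> simp
    exact (smul_eq_zero.1 this).resolve_right hv0
  have h00 : X.1.1 0 0 = (X.1.1 0 0).re • 1 := by
    rw [ht, zero_smul] at ht0
    have := Quaternion.re_add_im (X.1.1 0 0)
    rw [ht0, add_zero] at this
    rw [← Algebra.algebraMap_eq_smul_one]
    exact this.symm
  have a0 : ∀ i, i ≠ 0 → X.1.1 i 0 = 0 := fun i hi => g0_apply_zero X hi
  have a1 : ∀ i, i ≠ 0 → X.1.1 0 i = 0 := fun i hi => g0_zero_apply X hi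
  refine ⟨(X.1.1 0 0).re, (X.1.1 1 1).re, X.1.1 1 (Fin.last n), fun i j => ?_⟩
  by_cases hi : i = 0
  · subst hi
    by_cases hj : j = 0
    · rw [hj, if_pos rfl, if_pos rfl, ← h00]
    · rw [if_neg (Ne.symm hj), if_neg fun h => n1 h.1.symm, a1 j hj]
  rw [if_neg hi, ← h11]
  rcases eq_mid_or hn i with rfl | rfl | ⟨i, rfl⟩ | rfl
  · exact absurd rfl hi
  · rcases eq_mid_or hn j with rfl | rfl | ⟨j, rfl⟩ | rfl
    · simp [n1, n2.symm, a0]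
    · simp
    · simp [m1, c3, mid_ne_last]
    · simp [n3]
  · have := sub_eq_zero.1 (c2 i j)
    rw [one_mul, mul_one] at this
    rw [← this]
    simp [mid_ne_one hn, eq_comm]
  · by_cases hj : j = Fin.last n
    · rw [hj, hll, if_pos rfl]
    · rw [if_neg (Ne.symm hj), if_neg fun h => n3 h.1.symm]
      by_cases hj0 : j = 0
      · rw [hj0, a0 _ n2]
      · exact s2 j hj0 hj

lemma IsAnnShape.lie_eq_zero_of_centralizer {n : ℕ} (hn : 2 ≤ n) {u v : ℍ[ℝ]} (hv0 : v ≠ 0)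
    {X Y : g0 n} (hX : IsAnnShape u v X) (hcX : ∀ y ∈ heis n, ⁅X, y⁆ = 0) (hY : IsAnnShape u v Y)
    (hcY : ∀ y ∈ heis n, ⁅Y, y⁆ = 0) : ⁅X, Y⁆ = 0 := by
  obtain ⟨a, l, b, e⟩ := hX.centralizer hn hv0 hcX
  obtain ⟨a', l', b', e'⟩ := hY.centralizer hn hv0 hcY
  have n1 := fin_one_ne_zero hn
  have n2 := fin_last_ne_zero hn
  have n3 := fin_one_ne_last hn
  have m1 := fun k => (mid_ne_one hn k).symm
  have m0 := fun k : Fin (n - 2) => (mid_ne_zero k).symm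
  have ml := fun k : Fin (n - 2) => (mid_ne_last k).symm
  refine g0_ext fun i j => (slH_lie_apply X.1 Y.1 i j).trans ?_
  change _ = (0 : ℍ[ℝ])
  simp only [e, e', sum_eq_mid hn]
  rcases eq_mid_or hn i with rfl | rfl | ⟨i, rfl⟩ | rfl <;>
  rcases eq_mid_or hn j with rfl | rfl | ⟨j, rfl⟩ | rfl <;>
  simp [n1, n2, n3, n1.symm, n2.symm, n3.symm, mid_ne_zero, mid_ne_one hn, mid_ne_last, m0, m1, ml,
    mid_inj, smul_smul, mul_comm]
  abel

/-- An isomorphism would carry the ideal `𝔰𝔭(1)` of the annihilator of an extremal curvature class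
into the centralizer of the Heisenberg algebra, which is abelian. -/
lemma isEmpty_ann_equiv {n : ℕ} (hn : 2 ≤ n) {u v : ℍ[ℝ]} (hv0 : v ≠ 0) {w w' : H2 n}
    (h : ∀ A : g0 n, A ∈ ann w ↔ IsAnnShape u v A) (hw' : IsExtremal 2 w') :
    IsEmpty (ann w ≃ₗ⁅ℝ⁆ ann w') := by
  constructor
  intro φ
  let e' : sp1 → ann w' := fun p => ⟨spElt n p, spElt_mem_ann hn hw' p⟩
  let e : sp1 → ann w := fun p => φ.symm (e' p)
  have elie' (p q) : ⁅e' p, e' q⁆ = e' ⁅p, q⁆ := Subtype.ext (lie_spElt_spElt p q)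
  have elie (p q) : ⁅e p, e q⁆ = e ⁅p, q⁆ := by
    change ⁅φ.symm _, φ.symm _⁆ = φ.symm _
    rw [← LieEquiv.map_lie, elie']
  have einj (q) (hq : e q = 0) : q = 0 := by
    have h1 : e' q = 0 := by
      rw [← φ.apply_symm_apply (e' q)]
      change φ (e q) = 0
      rw [hq]
      exact φ.toLinearEquiv.map_zero
    exact spElt_eq_zero (congrArg Subtype.val h1)
  have e0 : e 0 = 0 := by
    have h1 := elie 0 0
    rwa [lie_self, lie_self, eq_comm] at h1
  have eideal (p) (a : ann w) : ∃ q, ⁅e p, a⁆ = e q := by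
    obtain ⟨q, hq, -⟩ := lie_spElt p (φ a).1
    have h1 : ⁅e' p, φ a⁆ = e' q := Subtype.ext hq
    refine ⟨q, ?_⟩
    change _ = φ.symm _
    rw [← h1, LieEquiv.map_lie, φ.symm_apply_apply]
  have heis_le {y : g0 n} (hy : y ∈ heis n) : y ∈ ann w :=
    (h y).2 (isAnnShape_of_mem_heis hn u v hy)
  have shape (a : ann w) : IsAnnShape u v a.1 := (h a.1).1 a.2
  have lie_heis {y : g0 n} (a : ann w) (hy : y ∈ heis n) : ⁅a.1, y⁆ ∈ heis n :=
    (shape a).lie_mem_heis hn hy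
  have hcent (p) {y : g0 n} (hy : y ∈ heis n) : ⁅(e p).1, y⁆ = 0 := by
    have := lie_eq_zero_of_adNilpotent (L := ann w) e0 einj elie eideal
      (H := {y | y.1 ∈ heis n}) (fun a y hy => lie_heis a hy) (fun z hz a => by
        have h1 : ⁅z.1, a.1⁆ ∈ heis n := by
          rw [← lie_skew]
          exact neg_mem (lie_heis a hz)
        exact Subtype.ext (heis_lie_lie hn hz hz h1)) p (y := ⟨y, heis_le hy⟩) hy
    exact congrArg Subtype.val this
  apply lie_spI_spJ
  apply einj
  rw [← elie]
  exact Subtype.ext ((shape _).lie_eq_zero_of_centralizer hn hv0 (fun y hy => hcent _ hy) (shape _)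
    (fun y hy => hcent _ hy))

/-! ### The graded algebras are not isomorphic -/

lemma gMinus_mem_gradedAlg {n : ℕ} (w : H2 n) (x : gMinus n) : (x : slH (n + 1)) ∈ gradedAlg w :=
  ⟨x.1, x.2, 0, zero_mem _, (add_zero _).symm⟩

lemma g0_mem_gradedAlg {n : ℕ} {w : H2 n} {A : g0 n} (hA : A ∈ ann w) :
    (A : slH (n + 1)) ∈ gradedAlg w :=
  ⟨0, zero_mem _, A, hA, (zero_add _).symm⟩

/-- The action of the graded algebra of a torsion class on the line of the first coordinate vector
in `𝔤₋₁`. -/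
lemma exists_lie_col_one {n : ℕ} (hn : 2 ≤ n) {u v : ℍ[ℝ]} {w : H2 n}
    (h : ∀ A : g0 n, A ∈ ann w ↔ IsAnnShape u v A) {X : slH (n + 1)} (hX : X ∈ gradedAlg w) :
    ∃ α β t : ℝ, ∀ p, ⁅X, (col n (Pi.single 1 p) : slH (n + 1))⁆ =
      col n (Pi.single 1 ((α • 1 + t • v) * p - p * (β • 1 + t • u))) := by
  obtain ⟨x, hx, A, hA, rfl⟩ := hX
  obtain ⟨⟨s1, -, -⟩, t, ht0, ht1⟩ := (h A).1 hA
  have n1 := fin_one_ne_zero hn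
  have split (x : ℍ[ℝ]) : x = x.re • 1 + x.im := by ext <;> simp
  refine ⟨(A.1.1 1 1).re, (A.1.1 0 0).re, t, fun p => ?_⟩
  rw [← ht0, ← ht1, ← split, ← split, add_lie]
  have h1 : ⁅x, (col n (Pi.single 1 p) : slH (n + 1))⁆ = 0 :=
    congrArg Subtype.val (gMinus_lie_eq_zero ⟨x, hx⟩ (col n (Pi.single 1 p)))
  rw [h1, zero_add, ← coe_lie_gMinus]
  congr 1
  refine gMinus_ext fun i hi => ?_
  rw [lie_col_single A 1 p hi n1, col_apply_zero _ hi]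
  by_cases hi1 : i = 1
  · rw [hi1, Pi.single_eq_same, Pi.single_eq_same]
  · rw [Pi.single_eq_of_ne hi1, Pi.single_eq_of_ne hi1, s1 i hi hi1, zero_mul, zero_mul, sub_zero]

/-- In the graded algebra of a torsion class the first coordinate vector of `𝔤₋₁` commutes with
all brackets. -/
lemma lie_lie_col_one {n : ℕ} (hn : 2 ≤ n) {u v : ℍ[ℝ]} {w : H2 n}
    (h : ∀ A : g0 n, A ∈ ann w ↔ IsAnnShape u v A) {X Y : slH (n + 1)} (hX : X ∈ gradedAlg w)
    (hY : Y ∈ gradedAlg w) (p : ℍ[ℝ]) : ⁅⁅X, Y⁆, (col n (Pi.single 1 p) : slH (n + 1))⁆ = 0 := by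
  obtain ⟨α, β, t, e⟩ := exists_lie_col_one hn h hX
  obtain ⟨α', β', t', e'⟩ := exists_lie_col_one hn h hY
  rw [lie_lie, e, e', e, e', sub_eq_zero]
  congr 3
  simp only [add_mul, mul_add, mul_sub, sub_mul, smul_mul_assoc, mul_smul_comm, one_mul, mul_one,
    smul_add, smul_sub, smul_smul, mul_assoc]
  module

/-- In the graded algebra of an extremal curvature class no nonzero element commutes with all
brackets. -/
lemma eq_zero_of_lie_lie {n : ℕ} (hn : 2 ≤ n) {w : H2 n} (hsp : ∀ p, spElt n p ∈ ann w) {X : slH (n + 1)}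
    (hX : X ∈ gradedAlg w) (h : ∀ Y ∈ gradedAlg w, ∀ Z ∈ gradedAlg w, ⁅⁅Y, Z⁆, X⁆ = 0) : X = 0 := by
  have hr : ⁅spI, spJ⁆.1 ≠ 0 := fun h => lie_spI_spJ (Subtype.ext h)
  have h0 (i) (hi : i ≠ 0) : X.1 0 i = 0 := by
    obtain ⟨x, hx, A, -, rfl⟩ := hX
    change x.1 0 i + A.1.1 0 i = 0
    rw [hx 0 i (Or.inl rfl), g0_zero_apply A hi, add_zero]
  have h1 (i) (hi : i ≠ 0) : X.1 i 0 = 0 := by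
    have e1 := h _ (g0_mem_gradedAlg (hsp spI)) _ (g0_mem_gradedAlg (hsp spJ))
    have e2 : ⁅(spElt n spI : slH (n + 1)), (spElt n spJ : slH (n + 1))⁆ = spElt n ⁅spI, spJ⁆ :=
      congrArg Subtype.val (lie_spElt_spElt spI spJ)
    rw [e2] at e1
    have e3 := congrArg (fun Y : slH (n + 1) => Y.1 i 0) e1
    simp only [slH_lie_apply, spElt_apply, hi, false_and, if_false, zero_mul, Finset.sum_const_zero,
      zero_sub, and_true, mul_ite, mul_zero, Finset.sum_ite_eq', Finset.mem_univ, if_true] at e3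
    exact (mul_eq_zero.1 (neg_eq_zero.1 e3)).resolve_right hr
  have h2 (k) (hk : k ≠ 0) (p : ℍ[ℝ]) (i) (hi : i ≠ 0) :
      (if i = k then p * X.1 0 0 else 0) - X.1 i k * p = 0 := by
    -- the coordinate vectors are brackets
    have e1 : ⁅spElt n ⁅spI, spJ⁆, col n (Pi.single k (-(p * (⁅spI, spJ⁆.1)⁻¹)))⁆ =
        col n (Pi.single k p) := by
      refine gMinus_ext fun i hi => ?_
      rw [lie_col_single _ _ _ hi hk, col_apply_zero _ hi, spElt_apply, spElt_apply,
        if_neg fun h => hi h.1, if_pos ⟨rfl, rfl⟩, zero_mul, zero_sub]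
      by_cases hik : i = k
      · rw [hik, Pi.single_eq_same, Pi.single_eq_same, neg_mul, neg_neg, mul_assoc,
          inv_mul_cancel₀ hr, mul_one]
      · rw [Pi.single_eq_of_ne hik, Pi.single_eq_of_ne hik, zero_mul, neg_zero]
    have e2 := h _ (g0_mem_gradedAlg (hsp ⁅spI, spJ⁆)) _
      (gMinus_mem_gradedAlg w (col n (Pi.single k (-(p * (⁅spI, spJ⁆.1)⁻¹)))))
    rw [← coe_lie_gMinus, e1] at e2
    have e3 := congrArg (fun Y : slH (n + 1) => Y.1 i 0) e2
    have e4 := (gMinus_lie_apply_zero (col n (Pi.single k p)) X i).symm.trans e3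
    rw [Finset.sum_eq_single k (fun j _ hj => by
      by_cases hj0 : j = 0
      · rw [hj0, h1 i hi, zero_mul]
      · rw [col_apply_zero _ hj0, Pi.single_eq_of_ne hj, mul_zero]) (by simp), col_apply_zero _ hi,
      col_apply_zero _ hk, Pi.single_eq_same, Pi.single_apply] at e4
    refine Eq.trans ?_ e4
    congr 1
    split_ifs <;> simp
  have n1 := fin_one_ne_zero hn
  have h3 (i) (hi : i ≠ 0) (k) (hk : k ≠ 0) : X.1 i k = if i = k then X.1 0 0 else 0 := by
    have := h2 k hk 1 i hi
    rw [one_mul, mul_one] at this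
    exact (sub_eq_zero.1 this).symm
  have h4 : X.1 0 0 = (X.1 0 0).re • 1 := eq_re_smul_one_of_commute fun p => by
    have := h2 1 n1 p 1 n1
    rw [if_pos rfl, h3 1 n1 1 n1, if_pos rfl] at this
    exact (sub_eq_zero.1 this).symm
  have h5 (i k) : X.1 i k = if i = k then X.1 0 0 else 0 := by
    by_cases hi : i = 0
    · by_cases hk : k = 0
      · rw [hi, hk, if_pos rfl]
      · rw [hi, h0 k hk, if_neg (Ne.symm hk)]
    by_cases hk : k = 0
    · rw [hk, h1 i hi, if_neg hi]
    · exact h3 i hi k hk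
  have htr : (Matrix.trace X.1).re = 0 := X.2
  rw [Matrix.trace, re_sum] at htr
  have h7 (i) : (X.1 i i).re = (X.1 0 0).re := by rw [h5 i i, if_pos rfl]
  simp only [Matrix.diag_apply, h7, Finset.sum_const, Finset.card_univ, Fintype.card_fin,
    nsmul_eq_mul] at htr
  have h6 : (X.1 0 0).re = 0 := (mul_eq_zero.1 htr).resolve_left (by positivity)
  refine slH_ext fun i k => ?_
  rw [h5, h4, h6, zero_smul, ite_self]
  rfl

/-- An isomorphism would preserve the elements that commute with all brackets. -/
lemma isEmpty_gradedAlg_equiv {n : ℕ} (hn : 2 ≤ n) {u v : ℍ[ℝ]} {w w' : H2 n}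
    (h : ∀ A : g0 n, A ∈ ann w ↔ IsAnnShape u v A) (hw' : IsExtremal 2 w') :
    IsEmpty (gradedAlg w ≃ₗ⁅ℝ⁆ gradedAlg w') := by
  constructor
  intro φ
  let x : gradedAlg w :=
    ⟨((col n (Pi.single 1 1) : gMinus n) : slH (n + 1)), gMinus_mem_gradedAlg w _⟩
  have hx (a b : gradedAlg w) : ⁅⁅a, b⁆, x⁆ = 0 := Subtype.ext (lie_lie_col_one hn h a.2 b.2 1)
  have h1 : φ x = 0 := by
    refine Subtype.ext (eq_zero_of_lie_lie hn (fun p => spElt_mem_ann hn hw' p) (φ x).2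
      fun Y hY Z hZ => ?_)
    have h2 : ⁅⁅(⟨Y, hY⟩ : gradedAlg w'), (⟨Z, hZ⟩ : gradedAlg w')⁆, φ x⁆ = 0 := by
      rw [← φ.apply_symm_apply ⟨Y, hY⟩, ← φ.apply_symm_apply ⟨Z, hZ⟩, ← LieEquiv.map_lie,
        ← LieEquiv.map_lie]
      refine (congrArg φ (hx _ _)).trans ?_
      exact φ.toLinearEquiv.map_zero
    exact congrArg Subtype.val h2
  have h3 : x = 0 := by
    rw [← φ.symm_apply_apply x, h1]
    exact φ.symm.toLinearEquiv.map_zero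
  have h4 : x.1.1 1 0 = 0 := by
    rw [h3]
    rfl
  have h5 : x.1.1 1 0 = 1 :=
    (col_apply_zero _ (fin_one_ne_zero hn)).trans (Pi.single_eq_same _ _)
  exact one_ne_zero (h5.symm.trans h4)

end AlmostQuat

end

theorem mainTheorem5 (n : ℕ) (hn : 2 ≤ n) :
    (∃ w : AlmostQuat.H2 n, AlmostQuat.HasLargestAnn 1 w) ∧
    (∃ w' : AlmostQuat.H2 n, AlmostQuat.HasLargestAnn 2 w') ∧
    ∀ w : AlmostQuat.H2 n, AlmostQuat.HasLargestAnn 1 w →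
      (∃ u ∈ AlmostQuat.sp1, ∃ v ∈ AlmostQuat.sp1, u ≠ 0 ∧ v ≠ 0 ∧
        ∃ f : (LieAlgebra.Orthogonal.so (Fin 2) ℝ × ℝ ×
            Matrix (Fin (n - 2)) (Fin (n - 2)) ℍ[ℝ] × AlmostQuat.sp1) →ₗ⁅ℝ⁆ AlmostQuat.g0 n,
          Function.Injective f ∧
          (∀ (s : LieAlgebra.Orthogonal.so (Fin 2) ℝ) (r : ℝ)
            (B : Matrix (Fin (n - 2)) (Fin (n - 2)) ℍ[ℝ]) (q : AlmostQuat.sp1),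
            (f (s, r, B, q)).1.1 = AlmostQuat.leviMatrix n u v (s.1 1 0) r B q.1) ∧
          (AlmostQuat.ann w).toSubmodule = f.range.toSubmodule ⊔ (AlmostQuat.heis n).toSubmodule ∧
          Disjoint f.range.toSubmodule (AlmostQuat.heis n).toSubmodule ∧
          (∀ x ∈ AlmostQuat.ann w, ∀ y ∈ AlmostQuat.heis n, ⁅x, y⁆ ∈ AlmostQuat.heis n)) ∧
      Module.finrank ℝ (AlmostQuat.heis n) = 8 * n - 12 ∧
      (Module.finrank ℝ (AlmostQuat.gradedAlg w) : ℤ) = 4 * (n : ℤ) ^ 2 - 4 * n + 9 ∧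
      ∀ w' : AlmostQuat.H2 n, AlmostQuat.HasLargestAnn 2 w' →
        IsEmpty (AlmostQuat.ann w ≃ₗ⁅ℝ⁆ AlmostQuat.ann w') ∧
        IsEmpty (AlmostQuat.gradedAlg w ≃ₗ⁅ℝ⁆ AlmostQuat.gradedAlg w') := by
  refine ⟨AlmostQuat.exists_hasLargestAnn ⟨_, AlmostQuat.isExtremal_torsionClass hn
      AlmostQuat.stableTriple_normal AlmostQuat.stableTriple_ne_zero⟩,
    AlmostQuat.exists_hasLargestAnn ⟨_, AlmostQuat.isExtremal_curvature hn⟩, fun w hw => ?_⟩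
  obtain ⟨u, hu, v, hv, hu0, hv0, h⟩ := AlmostQuat.ann_of_hasLargestAnn hn hw
  refine ⟨⟨u, hu, v, hv, hu0, hv0, AlmostQuat.leviHom hn hu hv,
    AlmostQuat.leviHom_injective hn hu hv hu0, fun _ _ _ _ => rfl, AlmostQuat.ann_eq_sup hn hu hv h,
    AlmostQuat.disjoint_levi_heis hn hu hv hu0,
    fun x hx y hy => AlmostQuat.IsAnnShape.lie_mem_heis hn ((h x).1 hx) hy⟩,
    AlmostQuat.finrank_heis hn, ?_, fun w' hw' =>
      ⟨AlmostQuat.isEmpty_ann_equiv hn hv0 h hw'.1, AlmostQuat.isEmpty_gradedAlg_equiv hn h hw'.1⟩⟩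
  rw [AlmostQuat.finrank_gradedAlg, AlmostQuat.finrank_ann hn hu hv hu0 h]
  obtain ⟨m, rfl⟩ := Nat.exists_eq_add_of_le' hn
  rw [Nat.add_sub_cancel, show 8 * (m + 2) - 12 = 8 * m + 4 by omega]
  push_cast
  ring
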